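/- **Setting.** Let $D\subseteq\mathbb R$, let $\rho$ be a probability measure on $D$ and $\mu=\rho^{\otimes\mathbb N}$. Let $\mathcal U$ be the set of finite subsets of $\mathbb N$ and $(\gamma_u)_{u\in\mathcal U}$ non-negative weights. Write $H(\cdot)$ for reproducing kernel Hilbert spaces. Assume: (A1) $k\neq0$ is a measurable reproducing kernel on $D\times D$; (A2) $H(k)\cap H(1)=\{0\}$; (A2a) $\int_D k(x,y)\,\rho(dx)=0$ for all $y\in D$; (A3) $M:=\int_D k(x,x)\,\rho(dx)<\infty$; (A4) $\gamma_\emptyset=1$ and $\sum_u\gamma_uM^{|u|}<\infty$; (A5) $k(x,x)>0$ for all $x\in D$; (A6) $\gamma_v>0$ and $u\subseteq v$ imply $\gamma_u>0$. Put $k_u(x,y)=\prod_{j\in u}k(x_j,y_j)$, $\mathcal X=\{x\in D^{\mathbb N}:\sum_u\gamma_uk_u(x,x)<\infty\}$ and $K=\sum_u\gamma_uk_u$ on $\mathcal X$. Let $B(K)$ be the unit ball of $H(K)$ and $I(f)=\int_{\mathcal X}f\,d\mu$. Fix $a\in D$ with $\sum_u\gamma_uk(a,a)^{|u|}<\infty$,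 put $\mathbf a=(a,a,\dots)\in\mathcal X$, and let $$\mathrm{decay}_\gamma=\sup\Big\{p>0:\ \sum_u(\gamma_uk(a,a)^{|u|})^{1/p}<\infty\Big\}\in(0,\infty],\qquad r^2_{u,u,\mathbf a}=\sum_{u'\in\mathcal U,\,u'\cap u=\emptyset}\gamma_{u\cup u'}k(a,a)^{|u'|}.$$ **Algorithms, cost, error.** Let $\$:\mathbb N_0\to[1,\infty]$ be increasing. Put $\mathcal X_{v,\mathbf a}=\{x\in D^{\mathbb N}:x_j=a\text{ for }j\notin v\}$; an evaluation of $f$ at $x$ costs $\inf\{\$(|u|):u\in\mathcal U,\ x\in\mathcal X_{u,\mathbf a}\}$. The class $\mathcal A^{\rm res}$ consists of all (possibly adaptive and nonlinear) randomized algorithms $Q$ for which there are $n\in\mathbb N_0$ and $v_1,\dots,v_n\in\mathcal U$ such that for every $f\in H(K)$ exactly $n$ values of $f$ are used, the $i$th sample point lies in $\mathcal X_{v_i,\mathbf a}$, the expected cost is $\sum_{i=1}^n\$(|v_i|)$, and $Q(f)$ is square integrable. Let $\mathrm{cost}(Q,B(K))$ be the supremum over $B(K)$ of the expected cost, $e(Q,B(K))^2=\sup_{f\in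 B(K)}\mathbb E(I(f)-Q(f))^2$, $$e(N,B(K))=\inf\{e(Q,B(K)):Q\in\mathcal A^{\rm res},\ \mathrm{cost}(Q,B(K))\le N\},$$ and let $p^{\rm res}$ be the infimum of all $p\ge0$ for which there is $C_p>0$ such that for all $\varepsilon>0$, $\inf\{\mathrm{cost}(Q,B(K)):Q\in\mathcal A^{\rm res},\ e(Q,B(K))\le\varepsilon\}\le C_p\,\varepsilon^{-p}$. **Building blocks (A7).** Let $c,C,\tau>0$, $\alpha_1\ge0$, $\alpha_2\in[0,1]$. For every $u\in\mathcal U$ and $n\in\mathbb N$ let $Q_{u,n}(\omega,f)=\sum_{i=1}^nt_if(x^{(i)}(\omega))$, $\omega\in\Omega^u$, where $\Omega=\Omega_{u,n}$ is a probability space ($\Omega^u$ carrying the product measure), $t_i\in\mathbb R$, $\sum_it_i=1$, and the coordinates $x^{(i)}_j(\omega)=x^{(i)}_j(\omega_j)$, $j\in u$, depend on $\omega_j$ only and have law $\rho$. Assume that for all $\emptyset\ne u\in\mathcal U$ with $\gamma_u>0$, all $n\in\mathbb N$ and all $w\subseteq u$ with $\gamma_w>0$ $$\mathrm{Var}(Q_{u,n}(f_w))\le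 c\,C^{|u|}(n+1)^{-\tau}F_w(n)\,\|f_w\|_{k_w}^2\qquad\text{for all }f_w\in H(k_w),$$ where $F_w(n)=1$ if $|w|\le1$ and $F_w(n)=\Big(1+\frac{\ln(n+1)}{(|w|-1)^{\alpha_2}}\Big)^{\alpha_1(|w|-1)^{\alpha_2}}$ if $|w|\ge2$. **Changing dimension algorithms.** Assume $\mathrm{decay}_\gamma>1$. Call $(\tau',\alpha_0)$ admissible if $0<\tau'\le\tau$, $\tau'<\mathrm{decay}_\gamma-1$, with $\tau'=\tau$ in case $\tau<\mathrm{decay}_\gamma-1$, and $\tau'/\mathrm{decay}_\gamma<\alpha_0<1-1/\mathrm{decay}_\gamma$. Put $L=\sum_{u\ne\emptyset}\gamma_u^{1-\alpha_0}$, $\widehat C=\max\{C(1+k(a,a)),4k(a,a)\}$ and, for $\varepsilon>0$, $n_u'=0$ if $cL\widehat C^{|u|}\gamma_u^{\alpha_0}<\varepsilon^2$ and $n_u'=\lfloor(cL\widehat C^{|u|}\gamma_u^{\alpha_0}\varepsilon^{-2})^{1/\tau'}\rfloor$ otherwise. Let $n_\emptyset=1$ and, for $u\ne\emptyset$, $n_u=\max\{1,n_u'\}$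 if $n_v'\ge1$ for some $v\supseteq u$, and $n_u=0$ otherwise. Let $$\mathcal Q=\{u:n_u>0\},\qquad d(\varepsilon)=\max_{u\in\mathcal Q}|u|,\qquad\mathcal B(\varepsilon)=\max_{u\in\mathcal Q}\max_{w\subseteq u}F_w(n_u),$$ $$Q^{\rm CD}_\varepsilon(f)=f(\mathbf a)+\sum_{\emptyset\ne u\in\mathcal Q}Q_{u,n_u}(f_{u,\mathbf a}),\qquad f_{u,\mathbf a}(x)=\sum_{v\subseteq u}(-1)^{|u\setminus v|}f(x_v;\mathbf a),$$ with independent randomness for different $u$, where $(x_v;\mathbf a)$ agrees with $x$ on $v$ and with $\mathbf a$ elsewhere. Its cost is counted as $\sum_{u\in\mathcal Q}n_u\sum_{v\subseteq u}\$(|v|)$. **Theorem.** Let $\$(\nu)=O(e^{\sigma\nu})$ for some $\sigma\in(0,\infty)$, let $\mathrm{decay}_\gamma>1$, let (A7) hold, and assume that for some admissible $(\tau_0,\alpha_0)$ $$r^2_{u,u,\mathbf a}=O(\gamma_u),\qquad d(\varepsilon)=o(\ln(1/\varepsilon)),\qquad\mathcal B(\varepsilon)=\varepsilon^{-o(1)}\quad(\varepsilon\to0).$$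 Then for all $\delta>0$, as $N\to\infty$, $$e(N,B(K))^2=O\big(N^{-\min\{\tau,\,\mathrm{decay}_\gamma-1\}+\delta}\big),$$ and $$p^{\rm res}\le\max\Big\{\frac2\tau,\ \frac2{\mathrm{decay}_\gamma-1}\Big\}\qquad(2/\infty=0).$$ Moreover the rate is attained by the changing dimension algorithms: for every admissible $(\tau',\alpha')$ and every $\delta>0$ there is a constant $A$ such that for all sufficiently large $N$ there is $\varepsilon>0$ such that $Q^{\rm CD}_\varepsilon$, built with the parameters $(\tau',\alpha')$, has cost at most $N$ and satisfies $e(Q^{\rm CD}_\varepsilon,B(K))^2\le A\,N^{-\tau'+\delta}$. -/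

import Mathlib

open MeasureTheory ProbabilityTheory Filter Topology
open scoped ENNReal NNReal

namespace InfDimInt

noncomputable section

/-! ### Reproducing kernels and their Hilbert spaces -/

/-- A real reproducing kernel on `X`: a symmetric positive semidefinite function. -/
structure ReproducingKernel (X : Type) where
  toFun : X → X → ℝ
  posSemidef : Matrix.PosSemidef (Matrix.of toFun)

namespace ReproducingKernel

variable {X Y : Type}

instance : CoeFun (ReproducingKernel X) (fun _ => X → X → ℝ) := ⟨toFun⟩

/-- The kernel, with numbers regarded as operators on `ℝ`. -/
def matrix (K : ReproducingKernel X) : Matrix X X (ℝ →L[ℝ] ℝ) :=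
  Matrix.of fun x y => K x y • (1 : ℝ →L[ℝ] ℝ)

theorem symm (K : ReproducingKernel X) (x y : X) : K x y = K y x := by
  have := K.posSemidef.1.apply y x
  simpa using this

theorem matrix_posSemidef (K : ReproducingKernel X) : K.matrix.PosSemidef := by
  have key := (RKHS.posSemidef_tfae (K := K.matrix)).out 0 2
  refine key.2 ⟨?_, fun vv => ?_⟩
  · ext x y
    simp [matrix, K.symm x y]
  · have h := K.posSemidef.2 vv
    simp only [Matrix.of_apply, star_trivial] at h
    simp only [matrix, Matrix.of_apply, FunLike.coe_smul, Pi.smul_apply,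
      one_apply_eq_self, smul_eq_mul, RCLike.re_to_real]
    refine h.trans_eq ?_
    refine Finsupp.sum_congr fun x _ => Finsupp.sum_congr fun y _ => ?_
    rw [K.symm x y]
    simp
    ring

instance (K : ReproducingKernel X) : Fact K.matrix.PosSemidef := ⟨K.matrix_posSemidef⟩

/-- The reproducing kernel Hilbert space `H(K)`; its elements coerce to functions `X → ℝ`. -/
abbrev Space (K : ReproducingKernel X) : Type := RKHS.OfKernel K.matrix

/-- The constant kernel `1`. -/
def one (X : Type) : ReproducingKernel X where
  toFun _ _ := 1
  posSemidef := by
    refine ⟨by ext; simp, fun x => ?_⟩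
    have : (x.sum fun i xi => x.sum fun j xj => star xi * Matrix.of (fun _ _ : X => (1 : ℝ)) i j * xj)
        = (x.sum fun _ xi => xi) * (x.sum fun _ xi => xi) := by
      simp [Finsupp.sum, Finset.sum_mul_sum]
    rw [this]
    exact mul_self_nonneg _

/-- The product of two kernels. -/
def mul (K L : ReproducingKernel X) : ReproducingKernel X where
  toFun x y := K x y * L x y
  posSemidef := K.posSemidef.hadamard L.posSemidef

/-- The pullback of a kernel. -/
def comap (K : ReproducingKernel X) (g : Y → X) : ReproducingKernel Y where
  toFun x y := K (g x) (g y)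
  posSemidef := K.posSemidef.submatrix g

theorem abs_le (K : ReproducingKernel X) (x y : X) : |K x y| ≤ (K x x + K y y) / 2 := by
  have hs := K.symm x y
  have h2 : ∀ t : ℝ, 0 ≤ K x x + 2 * t * K x y + t ^ 2 * K y y := by
    intro t
    have h := ((K.posSemidef.submatrix (![x, y])).dotProduct_mulVec_nonneg ![1, t])
    simp [Matrix.mulVec, dotProduct, Fin.sum_univ_two] at h
    rw [← hs] at h
    nlinarith [h]
  have ha := h2 1
  have hb := h2 (-1)
  rw [_root_.abs_le]
  constructor <;> linarith

theorem prod_posSemidef {S : Type} (k : ReproducingKernel S) (u : Finset ℕ) :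
    Matrix.PosSemidef (Matrix.of fun x y : ℕ → S => ∏ j ∈ u, k (x j) (y j)) := by
  induction u using Finset.induction_on with
  | empty => simpa [one] using (one (ℕ → S)).posSemidef
  | insert j u hj ih =>
    have h := ((k.comap (fun x : ℕ → S => x j)).mul ⟨_, ih⟩).posSemidef
    simpa [Finset.prod_insert hj, mul, comap] using h

/-- The kernel `k_u(x, y) = ∏_{j ∈ u} k(x_j, y_j)` on `S^ℕ`. -/
def prod {S : Type} (k : ReproducingKernel S) (u : Finset ℕ) : ReproducingKernel (ℕ → S) where
  toFun x y := ∏ j ∈ u, k (x j) (y j)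
  posSemidef := k.prod_posSemidef u

end ReproducingKernel

variable {S : Type} (k : ReproducingKernel S) (γ : Finset ℕ → ℝ≥0)

/-- The domain `𝒳 ⊆ S^ℕ` of functions of infinitely many variables. -/
def domain : Set (ℕ → S) :=
  {x | Summable fun u : Finset ℕ => (γ u : ℝ) * ∏ j ∈ u, k (x j) (x j)}

theorem summable_weighted (x y : domain k γ) :
    Summable fun u : Finset ℕ => (γ u : ℝ) * ∏ j ∈ u, k (x.1 j) (y.1 j) := by
  refine Summable.of_norm_bounded ((x.2.add y.2).div_const 2) fun u => ?_
  have h := (k.prod u).abs_le x.1 y.1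
  simp only [ReproducingKernel.prod] at h
  rw [norm_mul, Real.norm_eq_abs, Real.norm_eq_abs, abs_of_nonneg (γ u).coe_nonneg]
  calc (γ u : ℝ) * |∏ j ∈ u, k (x.1 j) (y.1 j)| ≤ _ := mul_le_mul_of_nonneg_left h (γ u).2
    _ = _ := by ring

/-- The kernel `K(x, y) = ∑_u γ_u k_u(x, y)` on `𝒳`. -/
def weightedKernel : ReproducingKernel (domain k γ) where
  toFun x y := ∑' u : Finset ℕ, (γ u : ℝ) * ∏ j ∈ u, k (x.1 j) (y.1 j)
  posSemidef := by
    constructor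
    · ext x y
      simp only [Matrix.conjTranspose_apply, Matrix.of_apply, star_trivial]
      simp_rw [k.symm (y.1 _) (x.1 _)]
    · intro c
      have hs : HasSum (fun u : Finset ℕ => c.sum fun i ci => c.sum fun j cj =>
          star ci * ((γ u : ℝ) * ∏ l ∈ u, k (i.1 l) (j.1 l)) * cj)
          (c.sum fun i ci => c.sum fun j cj => star ci *
            (∑' u : Finset ℕ, (γ u : ℝ) * ∏ l ∈ u, k (i.1 l) (j.1 l)) * cj) :=
        hasSum_sum fun i _ => hasSum_sum fun j _ =>
          (((summable_weighted k γ i j).hasSum).mul_left _).mul_right _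
      refine hs.nonneg fun u => ?_
      have h := ((k.prod u).posSemidef.submatrix
        (fun x : domain k γ => x.1)).smul (γ u).2
      exact h.2 c

/-- Functions on `𝒳` are set to `0` outside of `𝒳`. -/
def extendZero (f : domain k γ → ℝ) : (ℕ → S) → ℝ :=
  open Classical in fun x => if h : x ∈ domain k γ then f ⟨x, h⟩ else 0

/-- The elements of `H(K)` as functions on `S^ℕ`. -/
def toFunction (f : (weightedKernel k γ).Space) : (ℕ → S) → ℝ :=
  extendZero k γ (fun x => f x)

/-- The norm unit ball `B(K)` of `H(K)`. -/
def unitBall : Set (weightedKernel k γ).Space := {f | ‖f‖ ≤ 1}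

/-- The integration functional `I`; `μ` is the product of countably many copies of `ρ`. -/
def integral [MeasurableSpace S] (ρ : Measure S) [IsProbabilityMeasure ρ]
    (f : (weightedKernel k γ).Space) : ℝ :=
  ∫ x, toFunction k γ f x ∂(Measure.infinitePi fun _ : ℕ => ρ)

/-! ### The anchor `(a, a, …)` -/

variable (a : S)

/-- The point `(x_u; 𝐚)`. -/
def anchorAt (u : Finset ℕ) (x : ℕ → S) : ℕ → S := fun j => if j ∈ u then x j else a

/-- The component `f_{u,𝐚}` of the anchored decomposition,
`f_{u,𝐚}(x) = ∑_{v ⊆ u} (-1)^{|u ∖ v|} f(x_v; 𝐚)`. -/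
def anchoredComponent (f : (ℕ → S) → ℝ) (u : Finset ℕ) : (ℕ → S) → ℝ :=
  fun x => ∑ v ∈ u.powerset, (-1 : ℝ) ^ (u \ v).card * f (anchorAt a v x)

/-- `r²_{v,u,𝐚} = ∑_{u' ⊆ ℕ ∖ v} γ_{u ∪ u'} k_{u'}(𝐚, 𝐚)`. -/
def rSq (v u : Finset ℕ) : ℝ :=
  ∑' u' : {u' : Finset ℕ // Disjoint u' v}, (γ (u ∪ u'.1) : ℝ) * k a a ^ u'.1.card

/-- `decay_γ = sup {p | ∑_u (γ_u k_u(𝐚, 𝐚))^{1/p} < ∞}`; the value `⊤` is possible. -/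
def decay : EReal :=
  sSup {q : EReal | ∃ p : ℝ, 0 < p ∧ q = (p : EReal) ∧
    Summable fun u : Finset ℕ => ((γ u : ℝ) * k a a ^ u.card) ^ (1 / p)}

/-! ### Algorithms, cost and error -/

variable (price : ℕ → ℝ≥0∞)

/-- The affine subspace `𝒳_{v,𝐚}`. -/
def affineSubspace (v : Finset ℕ) : Set (ℕ → S) := {x | ∀ j, j ∉ v → x j = a}

/-- The cost of one function evaluation in the unrestricted subspace sampling model. -/
def evalCost (x : ℕ → S) : ℝ≥0∞ :=
  ⨅ (u : Finset ℕ) (_ : x ∈ affineSubspace a u), price u.card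

/-- The list of the first `i` function values, where the `i`th sample point may depend on the
values observed before. -/
def history (point : ℕ → List ℝ → ℕ → S) (f : (ℕ → S) → ℝ) : ℕ → List ℝ
  | 0 => []
  | i + 1 => history point f i ++ [f (point i (history point f i))]

/-- The class `𝒜^res` of (possibly adaptive and nonlinear) randomized algorithms on `H(K)`
that perform exactly `n` function evaluations, the `i`th one in `𝒳_{v_i,𝐚}`, at expected cost
`∑_i $(|v_i|)`. -/
structure RestrictedAlgorithm where
  Ω : Type
  [mΩ : MeasurableSpace Ω]
  P : Measure Ω
  [isProb : IsProbabilityMeasure P]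
  n : ℕ
  v : ℕ → Finset ℕ
  point : ℕ → Ω → List ℝ → ℕ → S
  output : Ω → List ℝ → ℝ
  point_mem : ∀ i < n, ∀ ω y, point i ω y ∈ affineSubspace a (v i)
  square_integrable : ∀ f : (weightedKernel k γ).Space,
    MemLp (fun ω => output ω (history (fun i => point i ω) (toFunction k γ f) n)) 2 P
  cost_measurable : ∀ f : (weightedKernel k γ).Space,
    AEMeasurable (fun ω => ∑ i ∈ Finset.range n, evalCost a price
      (point i ω (history (fun i => point i ω) (toFunction k γ f) i))) P
  cost_eq : ∀ f : (weightedKernel k γ).Space,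
    ∫⁻ ω, ∑ i ∈ Finset.range n, evalCost a price
      (point i ω (history (fun i => point i ω) (toFunction k γ f) i)) ∂P
      = ∑ i ∈ Finset.range n, price (v i).card

attribute [instance] RestrictedAlgorithm.mΩ RestrictedAlgorithm.isProb

namespace RestrictedAlgorithm

variable {k γ a price}

/-- The random variable `Q(f)`. -/
def value (Q : RestrictedAlgorithm k γ a price) (f : (weightedKernel k γ).Space) (ω : Q.Ω) : ℝ :=
  Q.output ω (history (fun i => Q.point i ω) (toFunction k γ f) Q.n)

/-- The cost of `Q` applied to `f`, a random variable. -/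
def cost (Q : RestrictedAlgorithm k γ a price) (f : (weightedKernel k γ).Space) (ω : Q.Ω) : ℝ≥0∞ :=
  ∑ i ∈ Finset.range Q.n, evalCost a price
    (Q.point i ω (history (fun i => Q.point i ω) (toFunction k γ f) i))

/-- The worst case cost `cost(Q, B(K))`. -/
def worstCost (Q : RestrictedAlgorithm k γ a price) : ℝ≥0∞ :=
  ⨆ f ∈ unitBall k γ, ∫⁻ ω, Q.cost f ω ∂Q.P

/-- The randomized worst case error `e(Q, B(K))`. -/
def error [MeasurableSpace S] (Q : RestrictedAlgorithm k γ a price) (ρ : Measure S)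
    [IsProbabilityMeasure ρ] : ℝ≥0∞ :=
  (⨆ f ∈ unitBall k γ,
    ∫⁻ ω, ENNReal.ofReal ((integral k γ ρ f - Q.value f ω) ^ 2) ∂Q.P) ^ (1 / 2 : ℝ)

end RestrictedAlgorithm

/-- The `N`th minimal error `e(N, B(K))`. -/
def minimalError [MeasurableSpace S] (ρ : Measure S) [IsProbabilityMeasure ρ] (N : ℝ) : ℝ≥0∞ :=
  ⨅ (Q : RestrictedAlgorithm k γ a price) (_ : Q.worstCost ≤ ENNReal.ofReal N), Q.error ρ

/-- The `ε`-complexity `comp(ε, B(K))`. -/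
def complexity [MeasurableSpace S] (ρ : Measure S) [IsProbabilityMeasure ρ] (ε : ℝ) : ℝ≥0∞ :=
  ⨅ (Q : RestrictedAlgorithm k γ a price) (_ : Q.error ρ ≤ ENNReal.ofReal ε), Q.worstCost

/-- The exponent of strong polynomial tractability `p^res`. -/
def strongExponent [MeasurableSpace S] (ρ : Measure S) [IsProbabilityMeasure ρ] : EReal :=
  sInf {q : EReal | ∃ p : ℝ, 0 ≤ p ∧ q = (p : EReal) ∧ ∃ C : ℝ, 0 < C ∧ ∀ ε : ℝ, 0 < ε →
    complexity k γ a price ρ ε ≤ ENNReal.ofReal (C * ε ^ (-p))}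

/-! ### Building blocks -/

/-- A randomized quadrature `Q(ω, f) = ∑_{i ≤ n} t_i f(x^{(i)}(ω))`, `ω ∈ Ω^u`, on `S^u` with
`∑ t_i = 1` whose `j`th node coordinates depend on `ω_j` only and have the law `ρ`. -/
structure UnbiasedQuadrature [MeasurableSpace S] (ρ : Measure S) (u : Finset ℕ) (n : ℕ+) where
  Ω : Type
  [mΩ : MeasurableSpace Ω]
  P : Measure Ω
  [isProb : IsProbabilityMeasure P]
  coeff : Fin n → ℝ
  coeff_sum : ∑ i, coeff i = 1
  node : Fin n → u → Ω → S
  node_law : ∀ i j, MeasurePreserving (node i j) P ρ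

attribute [instance] UnbiasedQuadrature.mΩ UnbiasedQuadrature.isProb

namespace UnbiasedQuadrature

variable [MeasurableSpace S] {ρ : Measure S} {u : Finset ℕ} {n : ℕ+}

/-- The `i`th node, as a point of `𝒳_{u,𝐚}`. -/
def nodePoint (Q : UnbiasedQuadrature ρ u n) (i : Fin n) (ω : u → Q.Ω) : ℕ → S :=
  fun j => if h : j ∈ u then Q.node i ⟨j, h⟩ (ω ⟨j, h⟩) else a

/-- The quadrature applied to a function of the variables in `u`, given as a function on `S^ℕ`;
the variables outside of `u` are frozen at the anchor. -/
def eval (Q : UnbiasedQuadrature ρ u n) (g : (ℕ → S) → ℝ) (ω : u → Q.Ω) : ℝ :=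
  ∑ i, Q.coeff i * g (Q.nodePoint a i ω)

end UnbiasedQuadrature

/-- The factor `F_w(n)`. -/
def growth (α₁ α₂ : ℝ) (w : Finset ℕ) (n : ℕ) : ℝ :=
  if w.card ≤ 1 then 1
  else (1 + Real.log (n + 1) / ((w.card : ℝ) - 1) ^ α₂) ^ (α₁ * ((w.card : ℝ) - 1) ^ α₂)

/-- The variance bound for the quadratures `Q_{u,n}`. -/
def VarianceBound [MeasurableSpace S] {ρ : Measure S}
    (q : (u : Finset ℕ) → (n : ℕ+) → UnbiasedQuadrature ρ u n) (c C τ α₁ α₂ : ℝ) : Prop :=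
  ∀ u : Finset ℕ, u.Nonempty → 0 < γ u → ∀ n : ℕ+, ∀ w ⊆ u, 0 < γ w → ∀ f : (k.prod w).Space,
    variance (fun ω => (q u n).eval a (fun x => f x) ω) (Measure.pi fun _ : u => (q u n).P)
      ≤ c * C ^ u.card * ((n : ℝ) + 1) ^ (-τ) * growth α₁ α₂ w n * ‖f‖ ^ 2

/-! ### Changing dimension algorithms -/

/-- The parameters of the construction: the rate `τ'` is `τ` if `τ < decay_γ - 1`, otherwise it
is some positive number less than `decay_γ - 1`; and `τ' / decay_γ < α₀ < 1 - 1 / decay_γ`. -/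
def Admissible (τ τ' α₀ : ℝ) : Prop :=
  0 < τ' ∧ τ' ≤ τ ∧ (τ' : EReal) < decay k γ a - 1 ∧
    ((τ : EReal) < decay k γ a - 1 → τ' = τ) ∧
    (τ' : EReal) / decay k γ a < α₀ ∧ (α₀ : EReal) < 1 - 1 / decay k γ a

/-- `L_{1-α₀} = ∑_{u ≠ ∅} γ_u^{1-α₀}`. -/
def weightSum (α₀ : ℝ) : ℝ≥0∞ :=
  ∑' u : {u : Finset ℕ // u.Nonempty}, (γ u.1 : ℝ≥0∞) ^ (1 - α₀)

/-- `Ĉ = max {C (1 + k(a,a)), 4 k(a,a)}`. -/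
def cHat (C : ℝ) : ℝ := max (C * (1 + k a a)) (4 * k a a)

/-- `c L_{1-α₀} Ĉ^{|u|} γ_u^{α₀}`. -/
def importance (c C α₀ : ℝ) (u : Finset ℕ) : ℝ≥0∞ :=
  ENNReal.ofReal c * weightSum γ α₀ * ENNReal.ofReal (cHat k a C) ^ u.card *
    (γ u : ℝ≥0∞) ^ α₀

/-- The preliminary number `n_u'(ε)`. -/
def prePoints (c C τ' α₀ ε : ℝ) (u : Finset ℕ) : ℕ∞ :=
  if importance k γ a c C α₀ u < ENNReal.ofReal (ε ^ 2) then 0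
  else ENat.floor ((importance k γ a c C α₀ u / ENNReal.ofReal (ε ^ 2)) ^ (1 / τ'))

/-- The number `n_u(ε)` of sample points used for `f_{u,𝐚}`, where `n_∅ = 1`. -/
def numPoints (c C τ' α₀ ε : ℝ) (u : Finset ℕ) : ℕ∞ :=
  open Classical in
  if u = ∅ then 1
  else if ∃ v, u ⊆ v ∧ 1 ≤ prePoints k γ a c C τ' α₀ ε v then
    max 1 (prePoints k γ a c C τ' α₀ ε u)
  else 0

/-- The set `𝒬 = 𝒬(ε)` of the coordinate sets that are used. -/
def activeSets (c C τ' α₀ ε : ℝ) : Set (Finset ℕ) :=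
  {u | 0 < numPoints k γ a c C τ' α₀ ε u}

/-- The `ε`-dimension `d(ε)`. -/
def epsDim (c C τ' α₀ ε : ℝ) : ℕ∞ :=
  ⨆ u ∈ activeSets k γ a c C τ' α₀ ε, (u.card : ℕ∞)

/-- `ℬ(ε) = max_{u ∈ 𝒬} max_{w ⊆ u} F_w(n_u)`. -/
def growthMax (α₁ α₂ c C τ' α₀ ε : ℝ) : ℝ≥0∞ :=
  ⨆ u ∈ activeSets k γ a c C τ' α₀ ε, ⨆ w ∈ u.powerset,
    if numPoints k γ a c C τ' α₀ ε u = ⊤ then ⊤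
    else ENNReal.ofReal (growth α₁ α₂ w (numPoints k γ a c C τ' α₀ ε u).toNat)

/-- `r²_{u,u,𝐚} = O(γ_u)`, `d(ε) = o(ln(1/ε))` and `ℬ(ε) = ε^{-o(1)}` as `ε → 0`. -/
def GrowthCondition (α₁ α₂ c C τ' α₀ : ℝ) : Prop :=
  (∃ R : ℝ, ∀ u : Finset ℕ, rSq k γ a u u ≤ R * γ u) ∧
  (∀ η : ℝ, 0 < η → ∀ᶠ ε in 𝓝[>] (0 : ℝ),
    (epsDim k γ a c C τ' α₀ ε : ℝ≥0∞) ≤ ENNReal.ofReal (η * Real.log (1 / ε))) ∧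
  (∃ g : ℝ → ℝ, Tendsto g (𝓝[>] 0) (𝓝 0) ∧ ∀ᶠ ε in 𝓝[>] (0 : ℝ),
    growthMax k γ a α₁ α₂ c C τ' α₀ ε = ENNReal.ofReal (ε ^ (-g ε)))

section ChangingDimension

variable [MeasurableSpace S] {ρ : Measure S}
  (q : (u : Finset ℕ) → (n : ℕ+) → UnbiasedQuadrature ρ u n)

/-- The quadrature `Q_{u,n_u}` used for `f_{u,𝐚}`. -/
def cdQuadrature (c C τ' α₀ ε : ℝ) (u : Finset ℕ) :
    UnbiasedQuadrature ρ u (numPoints k γ a c C τ' α₀ ε u).toNat.toPNat' :=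
  q u _

/-- The law of the randomness of the changing dimension algorithm: the randomness of the
quadratures for different sets `u` is independent. -/
def cdMeasure (c C τ' α₀ ε : ℝ) :
    Measure (∀ u : Finset ℕ, u → (cdQuadrature k γ a q c C τ' α₀ ε u).Ω) :=
  Measure.infinitePi fun u : Finset ℕ =>
    Measure.pi fun _ : u => (cdQuadrature k γ a q c C τ' α₀ ε u).P

/-- The changing dimension algorithm
`Q^CD(f) = f(𝐚) + ∑_{∅ ≠ u ∈ 𝒬} Q_{u,n_u}(f_{u,𝐚})`. -/
def cdValue (c C τ' α₀ ε : ℝ) (f : (weightedKernel k γ).Space)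
    (ω : ∀ u : Finset ℕ, u → (cdQuadrature k γ a q c C τ' α₀ ε u).Ω) : ℝ :=
  toFunction k γ f (fun _ => a) +
    ∑ᶠ u ∈ activeSets k γ a c C τ' α₀ ε \ {∅},
      (cdQuadrature k γ a q c C τ' α₀ ε u).eval a (anchoredComponent a (toFunction k γ f) u) (ω u)

/-- The cost of the changing dimension algorithm: each of the `n_u` evaluations of `f_{u,𝐚}` uses
one evaluation of `f` in `𝒳_{v,𝐚}`, at the price `$(|v|)`, for every `v ⊆ u`. If this cost is
finite, so are `𝒬` and all the `n_u`. -/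
def cdCost (c C τ' α₀ ε : ℝ) : ℝ≥0∞ :=
  ∑' u : activeSets k γ a c C τ' α₀ ε,
    (numPoints k γ a c C τ' α₀ ε u.1 : ℝ≥0∞) * ∑ v ∈ u.1.powerset, price v.card

/-- The randomized worst case error `e(Q^CD, B(K))`. -/
def cdError [IsProbabilityMeasure ρ] (c C τ' α₀ ε : ℝ) : ℝ≥0∞ :=
  (⨆ f ∈ unitBall k γ, ∫⁻ ω,
    ENNReal.ofReal ((integral k γ ρ f - cdValue k γ a q c C τ' α₀ ε f ω) ^ 2)
      ∂(cdMeasure k γ a q c C τ' α₀ ε)) ^ (1 / 2 : ℝ)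

end ChangingDimension

end

end InfDimInt

/-! A function `f` in `H(K)` is a superposition `∑_w √γ_w e_w` with `e` in the Hilbert sum of the
`H(k_w)` and `‖e‖ ≤ ‖f‖` (`exists_superposition`). By (A2a) every `e_w` with `w ≠ ∅` has integral
zero, so `I(f) = e_∅`. In `f_{u,𝐚}` only the terms with `w ⊇ u` survive, and `f_{u,𝐚}` is an
alternating sum over `v ⊆ u` of elements of `H(k_v)` with squared norm at most `k(a,a)^{|u∖v|}
r²_{u,u,𝐚} ‖e‖²` (`exists_section`, `anchoredComponent_eq_sum`). With (A7) this bounds the variance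
of `Q_{u,n}(f_{u,𝐚})`. Different `u` use independent randomness, so the squared error is the squared
bias plus the sum of the variances. The bias comes only from the `w` outside `𝒬` and is controlled
by `∑_{w ∉ 𝒬} γ_w (4k(a,a))^{|w|}` (`bias_sq_le`, `lintegral_error_sq_le`).

The parameters enter through the importance `r_u = c L Ĉ^{|u|} γ_u^{α₀}`. A set outside `𝒬` has `r_w
< ε²`, and a nonempty set in `𝒬` has `(n_u + 1)^{-τ'} ≤ ε² / r_u`. After `r²_{u,u,𝐚} = O(γ_u)` is
inserted, both error terms become `ε²` times a series in `γ_u^{1-α₀}`, up to factors exponential in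
`|u|` and the factors `F_w`. The cost is `ε^{-2/τ'}` times a series in `γ_u^{α₀/τ'}`, again up to
factors exponential in `|u|`. Admissibility says that both exponents exceed `1/decay_γ`.

The factors exponential in `|u|` are handled by a property of the weights alone: `d(ε) = o(ln(1/ε))`
for a single admissible pair forces `|u| ≤ K_η - η ln γ_u` for every `η > 0`
(`cardLogBound_of_epsDim`). Hence `B^{|u|}` costs an arbitrarily small power of `γ_u`, and the
bounds hold for every admissible pair; the factors `F_w` then contribute at most `ε^{-η}`
(`exists_growth_le`). The outcome is squared error `O(ε^{2-η})` at cost `O(ε^{-2/τ'})`. The first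
two assertions follow by letting `τ'` approach `min{τ, decay_γ - 1}`, once the algorithms are
realised in `𝒜^res` (`exists_restrictedAlgorithm_cd`). -/

namespace InfDimInt

noncomputable section

/-! ### Kernel sections and feature maps. -/

namespace ReproducingKernel

variable {X : Type}

/-- The kernel section `K(x, ·)` as an element of `H(K)`. -/
def sect (K : ReproducingKernel X) (x : X) : K.Space := RKHS.kerFun K.Space x 1

theorem inner_sect (K : ReproducingKernel X) (f : K.Space) (x : X) :
    inner ℝ f (K.sect x) = f x := by
  simp [sect]

theorem sect_apply (K : ReproducingKernel X) (x y : X) : K.sect x y = K x y := by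
  rw [sect, RKHS.kerFun_apply, RKHS.OfKernel.kernel_ofKernel]
  simp [matrix, K.symm x y]

theorem inner_sect_sect (K : ReproducingKernel X) (x y : X) :
    inner ℝ (K.sect x) (K.sect y) = K x y := by
  rw [inner_sect, sect_apply]

theorem norm_sect_sq (K : ReproducingKernel X) (x : X) : ‖K.sect x‖ ^ 2 = K x x := by
  rw [← real_inner_self_eq_norm_sq, inner_sect_sect]

theorem diag_nonneg (K : ReproducingKernel X) (x : X) : 0 ≤ K x x := by
  rw [← norm_sect_sq]; positivity

theorem apply_sq_le (K : ReproducingKernel X) (f : K.Space) (x : X) :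
    f x ^ 2 ≤ ‖f‖ ^ 2 * K x x := by
  rw [← norm_sect_sq, ← mul_pow, ← K.inner_sect f x]
  exact sq_le_sq' (by linarith [neg_abs_le (inner ℝ f (K.sect x)),
    abs_real_inner_le_norm f (K.sect x)]) (real_inner_le_norm f (K.sect x))

theorem denseRange_linearCombination_sect (K : ReproducingKernel X) :
    DenseRange (Finsupp.linearCombination ℝ K.sect) := by
  have h := RKHS.kerFun_dense K.Space
  rw [DenseRange, ← LinearMap.coe_range, Finsupp.range_linearCombination,
    Submodule.dense_iff_topologicalClosure_eq_top, ← top_le_iff, ← h]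
  refine Submodule.topologicalClosure_mono (Submodule.span_le.2 ?_)
  rintro _ ⟨x, v, rfl⟩
  have : RKHS.kerFun K.Space x v = v • K.sect x := by
    rw [sect, ← map_smul]; simp
  rw [this]
  exact Submodule.smul_mem _ _ (Submodule.subset_span ⟨x, rfl⟩)

theorem induction_closure (K : ReproducingKernel X) {p : K.Space → Prop} (f : K.Space)
    (hp : IsClosed {f | p f}) (h : ∀ c : X →₀ ℝ, p (Finsupp.linearCombination ℝ K.sect c)) : p f :=
  K.denseRange_linearCombination_sect.induction_on f hp h

section FeatureMap

variable {E : Type} [NormedAddCommGroup E] [InnerProductSpace ℝ E] [CompleteSpace E]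

/-- `Φ` and the kernel sections have the same Gram matrices, so `K(x,·) ↦ Φ x` preserves norms on
the span of the sections, which is dense. Only the contraction property is needed later. -/
theorem exists_isometry (K : ReproducingKernel X) (Φ : X → E)
    (hΦ : ∀ x y, inner ℝ (Φ x) (Φ y) = K x y) :
    ∃ V : K.Space →L[ℝ] E, (∀ f, ‖V f‖ ≤ ‖f‖) ∧ ∀ x, V (K.sect x) = Φ x := by
  have hn : ∀ c : X →₀ ℝ, ‖Finsupp.linearCombination ℝ Φ c‖
      ≤ 1 * ‖Finsupp.linearCombination ℝ K.sect c‖ := by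
    intro c
    rw [one_mul]
    refine le_of_eq ((sq_eq_sq₀ (norm_nonneg _) (norm_nonneg _)).1 ?_)
    simp only [← real_inner_self_eq_norm_sq, Finsupp.linearCombination_apply, Finsupp.sum_inner,
      Finsupp.inner_sum, inner_smul_left, inner_smul_right, hΦ, inner_sect_sect]
  refine ⟨(Finsupp.linearCombination ℝ Φ).extendOfNorm (Finsupp.linearCombination ℝ K.sect),
    fun f => ?_, fun x => ?_⟩
  · simpa using LinearMap.norm_extendOfNorm_apply_le K.denseRange_linearCombination_sect 1 hn f
  · have := LinearMap.extendOfNorm_eq K.denseRange_linearCombination_sect ⟨1, hn⟩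
      (Finsupp.single x 1)
    simpa using this

theorem exists_feature_of_mem (K : ReproducingKernel X) (Φ : X → E)
    (hΦ : ∀ x y, inner ℝ (Φ x) (Φ y) = K x y) (f : K.Space) :
    ∃ e : E, ‖e‖ ≤ ‖f‖ ∧ ∀ x, f x = inner ℝ e (Φ x) := by
  obtain ⟨V, hV, hVs⟩ := K.exists_isometry Φ hΦ
  refine ⟨V f, hV f, fun x => ?_⟩
  rw [← K.inner_sect]
  refine K.induction_closure (p := fun f => inner ℝ f (K.sect x) = inner ℝ (V f) (Φ x)) f
    (isClosed_eq (by fun_prop) (by fun_prop)) fun c => ?_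
  simp only [Finsupp.linearCombination_apply, map_finsuppSum, map_smul, hVs, Finsupp.sum_inner,
    inner_smul_left, inner_sect_sect, hΦ]

/-- The function is represented by `V* e`, where `V` is the contraction sending sections to
features. -/
theorem exists_mem_of_feature (K : ReproducingKernel X) (Φ : X → E)
    (hΦ : ∀ x y, inner ℝ (Φ x) (Φ y) = K x y) (e : E) :
    ∃ f : K.Space, ‖f‖ ≤ ‖e‖ ∧ ∀ x, f x = inner ℝ e (Φ x) := by
  obtain ⟨V, hV, hVs⟩ := K.exists_isometry Φ hΦ
  have hV1 : ‖V‖ ≤ 1 := V.opNorm_le_bound zero_le_one (by simpa using hV)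
  refine ⟨ContinuousLinearMap.adjoint V e, ?_, fun x => ?_⟩
  · refine (ContinuousLinearMap.le_opNorm _ _).trans ?_
    rw [LinearIsometryEquiv.norm_map]
    exact mul_le_of_le_one_left (norm_nonneg _) hV1
  · rw [← K.inner_sect, ContinuousLinearMap.adjoint_inner_left, hVs]

/-- A feature map for a multiple `t ^ 2 * K` of the kernel `K`. -/
theorem exists_mem_of_scaled_feature (K : ReproducingKernel X) (Φ : X → E) {t : ℝ} (ht : 0 ≤ t)
    (hΦ : ∀ x y, inner ℝ (Φ x) (Φ y) = t ^ 2 * K x y) (e : E) :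
    ∃ f : K.Space, ‖f‖ ≤ t * ‖e‖ ∧ ∀ x, f x = inner ℝ e (Φ x) := by
  rcases ht.eq_or_lt with rfl | ht
  · refine ⟨0, by simp, fun x => ?_⟩
    have : Φ x = 0 := by
      rw [← inner_self_eq_zero (𝕜 := ℝ), hΦ]; simp
    simp [this]
  · obtain ⟨f, hf, hfx⟩ := K.exists_mem_of_feature (fun x => t⁻¹ • Φ x) (fun x y => by
      rw [inner_smul_left, inner_smul_right, hΦ]; simp; field_simp) e
    refine ⟨t • f, ?_, fun x => ?_⟩
    · rw [norm_smul, Real.norm_of_nonneg ht.le]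
      gcongr
    · rw [RKHS.coe_smul, Pi.smul_apply, hfx, inner_smul_right, smul_eq_mul]
      field_simp

end FeatureMap

/-! ### The Hilbert sum of the spaces `H(k_u)` -/

variable {S : Type} (k : ReproducingKernel S)

/-- The Hilbert sum of the spaces `H(k_u)`. -/
abbrev FeatureSpace : Type := lp (fun u : Finset ℕ => (k.prod u).Space) 2

/-- The vector `(s_u k_u(x, ·))_u`. -/
def featureVec (s : Finset ℕ → ℝ) (x : ℕ → S)
    (h : Summable fun u => s u ^ 2 * ∏ j ∈ u, k (x j) (x j)) : k.FeatureSpace :=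
  ⟨fun u => s u • (k.prod u).sect x, by
    refine memℓp_gen ?_
    convert h using 2 with u
    have h := (k.prod u).norm_sect_sq x
    simp only [ENNReal.toReal_ofNat, Real.rpow_ofNat, norm_smul, mul_pow, h, Real.norm_eq_abs,
      sq_abs]
    rfl⟩

theorem hasSum_inner_featureVec (s : Finset ℕ → ℝ) (x : ℕ → S)
    (h : Summable fun u => s u ^ 2 * ∏ j ∈ u, k (x j) (x j)) (e : k.FeatureSpace) :
    HasSum (fun u => s u * e u x) (inner ℝ e (k.featureVec s x h)) := by
  refine (lp.hasSum_inner e (k.featureVec s x h)).congr_fun fun u => ?_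
  simp [featureVec, inner_smul_right, inner_sect]

theorem inner_featureVec (s : Finset ℕ → ℝ) (x y : ℕ → S)
    (hx : Summable fun u => s u ^ 2 * ∏ j ∈ u, k (x j) (x j))
    (hy : Summable fun u => s u ^ 2 * ∏ j ∈ u, k (y j) (y j)) :
    inner ℝ (k.featureVec s x hx) (k.featureVec s y hy)
      = ∑' u, s u ^ 2 * ∏ j ∈ u, k (x j) (y j) := by
  rw [← (k.hasSum_inner_featureVec s y hy (k.featureVec s x hx)).tsum_eq]
  refine tsum_congr fun u => ?_
  have : (k.prod u).sect x y = ∏ j ∈ u, k (x j) (y j) := sect_apply _ _ _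
  simp only [featureVec, RKHS.coe_smul, Pi.smul_apply, this, smul_eq_mul]
  ring

theorem norm_featureVec_sq (s : Finset ℕ → ℝ) (x : ℕ → S)
    (hx : Summable fun u => s u ^ 2 * ∏ j ∈ u, k (x j) (x j)) :
    ‖k.featureVec s x hx‖ ^ 2 = ∑' u, s u ^ 2 * ∏ j ∈ u, k (x j) (x j) := by
  rw [← real_inner_self_eq_norm_sq, inner_featureVec]

end ReproducingKernel

end

end InfDimInt

namespace InfDimInt

noncomputable section

/-! ### Elements of `H(k_v)` at random points with independent coordinates of law `ρ` -/

namespace ReproducingKernel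

variable {S : Type} [MeasurableSpace S] {k : ReproducingKernel S} {ρ : Measure S}
  [IsProbabilityMeasure ρ] {Ω : Type*} [MeasurableSpace Ω] {P : Measure Ω}
  {X : Ω → ℕ → S} {v : Finset ℕ}

/-- Combinations of sections are measurable because `k` is. Norm convergence in `H(k_v)` implies
pointwise convergence, so measurability passes to the closure. -/
theorem measurable_comp_of_measurable (hk : Measurable fun p : S × S => k p.1 p.2)
    (hX : ∀ j ∈ v, Measurable fun ω => X ω j) (g : (k.prod v).Space) :
    Measurable fun ω => g (X ω) := by
  refine (k.prod v).induction_closure (p := fun g => Measurable fun ω => g (X ω)) g ?_ fun c => ?_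
  · refine IsSeqClosed.isClosed fun G g hG hg => ?_
    refine measurable_of_tendsto_metrizable hG (tendsto_pi_nhds.2 fun ω => ?_)
    exact ((RKHS.continuous_eval (X ω)).tendsto g).comp hg
  · simp only [← inner_sect, Finsupp.linearCombination_apply, Finsupp.sum_inner, inner_smul_left,
      inner_sect_sect]
    refine Finset.measurable_fun_sum _ fun y _ => Measurable.const_mul ?_ _
    refine Finset.measurable_prod _ fun j hj => ?_
    exact hk.comp (measurable_const.prodMk (hX j hj))

variable (hX : MeasurePreserving (fun ω (j : v) => X ω j) P (Measure.pi fun _ : v => ρ))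


include hX

omit [IsProbabilityMeasure ρ] in
theorem measurable_coord (j : ℕ) (hj : j ∈ v) : Measurable fun ω => X ω j :=
  (measurable_pi_apply (⟨j, hj⟩ : v)).comp hX.measurable

theorem integral_prod_coord {φ : ℕ → S → ℝ} (hφ : ∀ j ∈ v, Measurable (φ j)) :
    ∫ ω, ∏ j ∈ v, φ j (X ω j) ∂P = ∏ j ∈ v, ∫ x, φ j x ∂ρ := by
  have h := integral_fintype_prod_eq_prod (μ := fun _ : v => ρ) (fun (j : v) x => φ j x)
  rw [← hX.map_eq, integral_map hX.measurable.aemeasurable] at h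
  · rw [Finset.univ_eq_attach, Finset.prod_attach v (fun j => ∫ x, φ j x ∂ρ)] at h
    rw [← h]
    refine integral_congr_ae (ae_of_all _ fun ω => ?_)
    exact (Finset.prod_attach v (fun j => φ j (X ω j))).symm
  · exact (Finset.measurable_prod _ fun (j : v) _ =>
      (hφ j j.2).comp (measurable_pi_apply j)).aestronglyMeasurable

theorem integrable_prod_coord {φ : ℕ → S → ℝ} (hφ : ∀ j ∈ v, Integrable (φ j) ρ) :
    Integrable (fun ω => ∏ j ∈ v, φ j (X ω j)) P := by
  have h := Integrable.fintype_prod_dep (μ := fun _ : v => ρ) (f := fun (j : v) x => φ j x)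
    (fun j => hφ j j.2)
  have h2 := hX.integrable_comp_of_integrable h
  refine h2.congr (ae_of_all _ fun ω => ?_)
  exact Finset.prod_attach v (fun j => φ j (X ω j))

variable (hk : Measurable fun p : S × S => k p.1 p.2) (hM : Integrable (fun x => k x x) ρ)

include hk hM

omit hk in
theorem integrable_diag_comp : Integrable (fun ω => ∏ j ∈ v, k (X ω j) (X ω j)) P :=
  integrable_prod_coord (φ := fun _ x => k x x) hX fun _ _ => hM

omit hM in
theorem integral_diag_comp :
    ∫ ω, ∏ j ∈ v, k (X ω j) (X ω j) ∂P = (∫ x, k x x ∂ρ) ^ v.card := by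
  rw [integral_prod_coord (φ := fun _ x => k x x) hX fun _ _ =>
    hk.comp (measurable_id.prodMk measurable_id), Finset.prod_const]

theorem memLp_two_comp (g : (k.prod v).Space) : MemLp (fun ω => g (X ω)) 2 P := by
  have hm := measurable_comp_of_measurable hk (measurable_coord hX) g
  rw [memLp_two_iff_integrable_sq hm.aestronglyMeasurable]
  refine ((integrable_diag_comp hX hM).const_mul (‖g‖ ^ 2)).mono'
    (hm.pow_const 2).aestronglyMeasurable (ae_of_all _ fun ω => ?_)
  rw [Real.norm_of_nonneg (sq_nonneg _)]
  exact (k.prod v).apply_sq_le g (X ω)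

theorem integrable_comp [IsProbabilityMeasure P] (g : (k.prod v).Space) :
    Integrable (fun ω => g (X ω)) P :=
  (memLp_two_comp hX hk hM g).integrable one_le_two

/-- The mean is a bounded linear functional on `H(k_v)`. On a section it factorises over the
independent coordinates, and each factor vanishes by (A2a). -/
theorem integral_comp_eq_zero [IsProbabilityMeasure P] (hv : v.Nonempty)
    (h0 : ∀ y, ∫ x, k x y ∂ρ = 0) (g : (k.prod v).Space) : ∫ ω, g (X ω) ∂P = 0 := by
  let J : (k.prod v).Space →ₗ[ℝ] ℝ :=
    { toFun g := ∫ ω, g (X ω) ∂P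
      map_add' g g' := by
        simp only [RKHS.coe_add, Pi.add_apply]
        exact integral_add (integrable_comp hX hk hM g) (integrable_comp hX hk hM g')
      map_smul' c g := by
        simp only [RKHS.coe_smul, Pi.smul_apply, smul_eq_mul, RingHom.id_apply]
        exact integral_const_mul _ _ }
  -- A crude constant, from `√t ≤ 1 + t`; only continuity of `J` matters.
  have hbound : ∀ g, ‖J g‖ ≤ (∫ ω, (1 + ∏ j ∈ v, k (X ω j) (X ω j)) ∂P) * ‖g‖ := by
    intro g
    rw [← integral_mul_const]
    refine norm_integral_le_of_norm_le
      (((integrable_const _).add (integrable_diag_comp hX hM)).mul_const _)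
      (ae_of_all _ fun ω => ?_)
    have h1 : g (X ω) ^ 2 ≤ ‖g‖ ^ 2 * ∏ j ∈ v, k (X ω j) (X ω j) :=
      (k.prod v).apply_sq_le g (X ω)
    have h2 : 0 ≤ ∏ j ∈ v, k (X ω j) (X ω j) := (k.prod v).diag_nonneg (X ω)
    refine abs_le_of_sq_le_sq (h1.trans ?_) (by positivity)
    rw [mul_pow, mul_comm]
    gcongr
    nlinarith
  let J' := J.mkContinuous _ hbound
  refine (k.prod v).induction_closure (p := fun g => J' g = 0) g
    (isClosed_eq J'.continuous continuous_const) fun c => ?_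
  rw [Finsupp.linearCombination_apply, map_finsuppSum]
  refine Finset.sum_eq_zero fun y _ => ?_
  have : J' ((k.prod v).sect y) = 0 := by
    change ∫ ω, (k.prod v).sect y (X ω) ∂P = 0
    simp only [sect_apply]
    change ∫ ω, ∏ j ∈ v, k (y j) (X ω j) ∂P = 0
    rw [integral_prod_coord (φ := fun j x => k (y j) x) hX fun j _ =>
      hk.comp (measurable_const.prodMk measurable_id)]
    obtain ⟨j, hj⟩ := hv
    refine Finset.prod_eq_zero hj ?_
    simp_rw [k.symm (y j)]
    exact h0 _
  simp only [map_smul, this, smul_zero]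

end ReproducingKernel

end

end InfDimInt

namespace InfDimInt

noncomputable section

/-! ### The anchored decomposition of the elements of `H(K)` -/

/-- The subsets `v` and `v ∪ {j}` carry opposite signs and cancel in pairs. -/
theorem sum_powerset_neg_one_pow_mul_eq_zero {u : Finset ℕ} {j : ℕ} (hj : j ∈ u)
    (F : Finset ℕ → ℝ) (hF : ∀ v ⊆ u, j ∉ v → F (insert j v) = F v) :
    ∑ v ∈ u.powerset, (-1 : ℝ) ^ (u \ v).card * F v = 0 := by
  obtain ⟨u', hu', rfl⟩ : ∃ u', j ∉ u' ∧ insert j u' = u :=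
    ⟨u.erase j, Finset.notMem_erase j u, Finset.insert_erase hj⟩
  rw [Finset.sum_powerset_insert hu', ← Finset.sum_add_distrib]
  refine Finset.sum_eq_zero fun v hv => ?_
  rw [Finset.mem_powerset] at hv
  have hjv : j ∉ v := fun h => hu' (hv h)
  have h1 : insert j u' \ v = insert j (u' \ v) := Finset.insert_sdiff_of_notMem _ hjv
  have h2 : insert j u' \ insert j v = u' \ v := by
    rw [Finset.insert_sdiff_insert, Finset.sdiff_insert_of_notMem hu']
  rw [h1, h2, Finset.card_insert_of_notMem (by simp [hu']),
    hF v (hv.trans (Finset.subset_insert _ _)) hjv, pow_succ]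
  ring

variable {S : Type} {k : ReproducingKernel S} {γ : Finset ℕ → ℝ≥0} {a : S}

/-- This later permits discarding the function values at nodes that meet the anchor in some
coordinate of `u`. -/
theorem anchoredComponent_eq_zero (f : (ℕ → S) → ℝ) {u : Finset ℕ} {x : ℕ → S} {j : ℕ}
    (hj : j ∈ u) (hx : x j = a) : anchoredComponent a f u x = 0 := by
  refine sum_powerset_neg_one_pow_mul_eq_zero hj (fun v => f (anchorAt a v x)) fun v _ hjv => ?_
  congr 1
  ext i
  by_cases hi : i = j
  · subst hi; simp [anchorAt, hjv, hx]
  · simp [anchorAt, hi]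

namespace ReproducingKernel

theorem prod_apply_congr {w : Finset ℕ} (g : (k.prod w).Space) {x y : ℕ → S}
    (h : ∀ j ∈ w, x j = y j) : g x = g y := by
  have : (k.prod w).sect x = (k.prod w).sect y := by
    refine RKHS.ext fun z => ?_
    rw [sect_apply, sect_apply]
    exact Finset.prod_congr rfl fun j hj => by rw [h j hj]
  rw [← inner_sect, ← inner_sect, this]

theorem prod_anchorAt (v w : Finset ℕ) (x y : ℕ → S) :
    ∏ j ∈ w, k (anchorAt a v x j) (anchorAt a v y j)
      = (∏ j ∈ w ∩ v, k (x j) (y j)) * k a a ^ (w \ v).card := by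
  rw [← Finset.prod_inter_mul_prod_sdiff w v, ← Finset.prod_const]
  congr 1
  · refine Finset.prod_congr rfl fun j hj => ?_
    simp [anchorAt, (Finset.mem_inter.1 hj).2]
  · refine Finset.prod_congr rfl fun j hj => ?_
    simp [anchorAt, (Finset.mem_sdiff.1 hj).2]

end ReproducingKernel

open ReproducingKernel

theorem anchorAt_mem_domain (hκ : 0 < k a a)
    (ha : Summable fun u : Finset ℕ => (γ u : ℝ) * k a a ^ u.card) (v : Finset ℕ) (x : ℕ → S) :
    anchorAt a v x ∈ domain k γ := by
  -- Freezing all but the coordinates in `v` changes `k_w(𝐚,𝐚)` by a factor depending only on `w ∩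
  -- v`. The sum over all possible intersections bounds this factor uniformly in `w`.
  set B : ℝ := ∑ t ∈ v.powerset, (∏ j ∈ t, k (x j) (x j)) / k a a ^ t.card with hB
  have hnn : ∀ t : Finset ℕ, 0 ≤ (∏ j ∈ t, k (x j) (x j)) / k a a ^ t.card := fun t =>
    div_nonneg ((k.prod t).diag_nonneg x) (by positivity)
  refine Summable.of_nonneg_of_le (fun w => ?_) (fun w => ?_) (ha.mul_left B)
  · exact mul_nonneg (γ w).2 ((k.prod w).diag_nonneg _)
  · rw [prod_anchorAt]
    have h1 : (∏ j ∈ w ∩ v, k (x j) (x j)) / k a a ^ (w ∩ v).card ≤ B :=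
      Finset.single_le_sum (f := fun t => (∏ j ∈ t, k (x j) (x j)) / k a a ^ t.card)
        (fun t _ => hnn t) (Finset.mem_powerset.2 Finset.inter_subset_right)
    rw [div_le_iff₀ (by positivity)] at h1
    have h2 : k a a ^ w.card = k a a ^ (w ∩ v).card * k a a ^ (w \ v).card := by
      rw [← pow_add, Finset.card_inter_add_card_sdiff]
    rw [h2]
    calc (γ w : ℝ) * ((∏ j ∈ w ∩ v, k (x j) (x j)) * k a a ^ (w \ v).card)
        ≤ (γ w : ℝ) * (B * k a a ^ (w ∩ v).card * k a a ^ (w \ v).card) := by gcongr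
      _ = _ := by ring

theorem toFunction_of_mem (f : (weightedKernel k γ).Space) {x : ℕ → S} (hx : x ∈ domain k γ) :
    toFunction k γ f x = f ⟨x, hx⟩ := by
  simp [toFunction, extendZero, hx]

/-- Elements of `H(K)` are superpositions of elements of the spaces `H(γ_w k_w)`. -/
theorem exists_superposition (f : (weightedKernel k γ).Space) :
    ∃ e : k.FeatureSpace, ‖e‖ ≤ ‖f‖ ∧ ∀ x ∈ domain k γ,
      HasSum (fun w => √(γ w) * e w x) (toFunction k γ f x) := by
  have hs : ∀ x : domain k γ, Summable fun u : Finset ℕ =>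
      √(γ u : ℝ) ^ 2 * ∏ j ∈ u, k (x.1 j) (x.1 j) := fun x => by
    simp only [Real.sq_sqrt (NNReal.coe_nonneg _)]
    exact x.2
  obtain ⟨e, he, hf⟩ := (weightedKernel k γ).exists_feature_of_mem
    (fun x => k.featureVec (fun u => √(γ u)) x.1 (hs x)) (fun x y => by
      rw [inner_featureVec]
      simp only [Real.sq_sqrt (NNReal.coe_nonneg _)]
      rfl) f
  refine ⟨e, he, fun x hx => ?_⟩
  rw [toFunction_of_mem f hx, hf]
  exact k.hasSum_inner_featureVec _ _ _ e

theorem tsum_superset_eq_rSq (u : Finset ℕ) :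
    ∑' w : Finset ℕ, (if u ⊆ w then (γ w : ℝ) * k a a ^ (w \ u).card else 0) = rSq k γ a u u := by
  let E : {u' : Finset ℕ // Disjoint u' u} ≃ {w : Finset ℕ // u ⊆ w} :=
    { toFun t := ⟨u ∪ t.1, Finset.subset_union_left⟩
      invFun w := ⟨w.1 \ u, Finset.sdiff_disjoint⟩
      left_inv t := by
        refine Subtype.ext ?_
        simp [Finset.union_sdiff_left, Finset.sdiff_eq_self_of_disjoint t.2]
      right_inv w := Subtype.ext (Finset.union_sdiff_of_subset w.2) }
  have h1 : ∑' w : Finset ℕ, (if u ⊆ w then (γ w : ℝ) * k a a ^ (w \ u).card else 0)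
      = ∑' w : {w : Finset ℕ // u ⊆ w}, (γ w.1 : ℝ) * k a a ^ (w.1 \ u).card := by
    refine Eq.trans (tsum_congr fun w => ?_)
      (tsum_subtype {w : Finset ℕ | u ⊆ w} fun w => (γ w : ℝ) * k a a ^ (w \ u).card).symm
    simp [Set.indicator_apply]
  rw [h1, ← E.tsum_eq, rSq]
  refine tsum_congr fun t => ?_
  have : (u ∪ t.1) \ u = t.1 := by
    simp [Finset.union_sdiff_left, Finset.sdiff_eq_self_of_disjoint t.2]
  simp only [E, Equiv.coe_fn_mk, this]

theorem rSq_nonneg (hκ : 0 < k a a) (u : Finset ℕ) : 0 ≤ rSq k γ a u u :=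
  tsum_nonneg fun _ => by positivity

/-- The function `x ↦ ∑_{w ⊇ u} √γ_w e_w(x_v; 𝐚)` belongs to `H(k_v)`. -/
theorem exists_section (hκ : 0 < k a a)
    (ha : Summable fun u : Finset ℕ => (γ u : ℝ) * k a a ^ u.card) (e : k.FeatureSpace)
    {u v : Finset ℕ} (hv : v ⊆ u) :
    ∃ g : (k.prod v).Space, ‖g‖ ≤ √(k a a ^ (u \ v).card * rSq k γ a u u) * ‖e‖ ∧
      ∀ x, HasSum (fun w => if u ⊆ w then √(γ w) * e w (anchorAt a v x) else 0) (g x) := by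
  have hsq : ∀ w, (if u ⊆ w then √(γ w : ℝ) else 0) ^ 2 = if u ⊆ w then (γ w : ℝ) else 0 := by
    intro w; split_ifs <;> simp
  have hs : ∀ x, Summable fun w : Finset ℕ => (if u ⊆ w then √(γ w : ℝ) else 0) ^ 2 *
      ∏ j ∈ w, k (anchorAt a v x j) (anchorAt a v x j) := fun x => by
    refine Summable.of_nonneg_of_le (fun w => ?_) (fun w => ?_) (anchorAt_mem_domain hκ ha v x)
    · exact mul_nonneg (sq_nonneg _) ((k.prod w).diag_nonneg _)
    · refine mul_le_mul_of_nonneg_right ?_ ((k.prod w).diag_nonneg _)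
      rw [hsq]; split_ifs <;> simp
  have hr : 0 ≤ k a a ^ (u \ v).card * rSq k γ a u u := mul_nonneg (by positivity) (rSq_nonneg hκ u)
  -- For `w ⊇ u ⊇ v` only the coordinates in `v` are free; the other `|u∖v| + |w∖u|` factors equal
  -- `k(a,a)`. Summing over `w` turns the kernel of this feature map into `k(a,a)^{|u∖v|} r²_{u,u,𝐚}
  -- k_v`.
  obtain ⟨g, hg, hgx⟩ := (k.prod v).exists_mem_of_scaled_feature
    (fun x => k.featureVec _ (anchorAt a v x) (hs x)) (Real.sqrt_nonneg _) (fun x y => by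
      rw [inner_featureVec, Real.sq_sqrt hr, ← tsum_superset_eq_rSq, ← tsum_mul_left,
        ← tsum_mul_right]
      refine tsum_congr fun w => ?_
      rw [hsq]
      split_ifs with huw
      · have h1 : w ∩ v = v := Finset.inter_eq_right.2 (hv.trans huw)
        have h2 : (w \ v).card = (u \ v).card + (w \ u).card := by
          rw [← Finset.card_union_of_disjoint]
          · congr 1
            ext j
            simp only [Finset.mem_sdiff, Finset.mem_union]
            constructor
            · rintro ⟨h, h'⟩; by_cases hj : j ∈ u <;> simp [*]
            · rintro (⟨h, h'⟩ | ⟨h, h'⟩)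
              · exact ⟨huw h, h'⟩
              · exact ⟨h, fun hj => h' (hv hj)⟩
          · exact Finset.disjoint_of_subset_left Finset.sdiff_subset Finset.disjoint_sdiff
        rw [prod_anchorAt, h1, h2, pow_add]
        simp only [ReproducingKernel.prod]
        ring
      · simp) e
  refine ⟨g, hg, fun x => ?_⟩
  rw [hgx]
  refine (k.hasSum_inner_featureVec _ _ (hs x) e).congr_fun fun w => ?_
  split_ifs <;> simp

/-- The components `f_{u,𝐚}` in terms of the sections of `f`. -/
theorem anchoredComponent_eq_sum (hκ : 0 < k a a)
    (ha : Summable fun u : Finset ℕ => (γ u : ℝ) * k a a ^ u.card)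
    {F : (ℕ → S) → ℝ} {e : k.FeatureSpace}
    (hF : ∀ x ∈ domain k γ, HasSum (fun w => √(γ w) * e w x) (F x))
    {u : Finset ℕ} (g : ∀ v : Finset ℕ, (k.prod v).Space)
    (hg : ∀ v ⊆ u, ∀ x,
      HasSum (fun w => if u ⊆ w then √(γ w) * e w (anchorAt a v x) else 0) (g v x)) (x : ℕ → S) :
    anchoredComponent a F u x = ∑ v ∈ u.powerset, (-1 : ℝ) ^ (u \ v).card * g v x := by
  have h1 : HasSum (fun w => ∑ v ∈ u.powerset, (-1 : ℝ) ^ (u \ v).card *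
      (√(γ w) * e w (anchorAt a v x))) (anchoredComponent a F u x) :=
    hasSum_sum fun v _ => (hF _ (anchorAt_mem_domain hκ ha v x)).mul_left _
  have h2 : HasSum (fun w => ∑ v ∈ u.powerset, (-1 : ℝ) ^ (u \ v).card *
      (if u ⊆ w then √(γ w) * e w (anchorAt a v x) else 0))
      (∑ v ∈ u.powerset, (-1 : ℝ) ^ (u \ v).card * g v x) :=
    hasSum_sum fun v hv => (hg v (Finset.mem_powerset.1 hv) x).mul_left _
  refine h1.unique (h2.congr_fun fun w => ?_)
  by_cases huw : u ⊆ w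
  · simp [huw]
  -- If `w` misses some `j ∈ u`, then `e_w` does not depend on the `j`th variable, and the
  -- alternating sum cancels.
  · simp only [huw, if_false, mul_zero, Finset.sum_const_zero]
    obtain ⟨j, hj, hjw⟩ := Finset.not_subset.1 huw
    refine sum_powerset_neg_one_pow_mul_eq_zero hj
      (fun v => √(γ w) * e w (anchorAt a v x)) fun v _ _ => ?_
    congr 1
    refine prod_apply_congr _ fun i hi => ?_
    have : i ≠ j := fun h => hjw (h ▸ hi)
    simp [anchorAt, this]

end

end InfDimInt

namespace InfDimInt

noncomputable section

open ReproducingKernel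

/-! ### The integral and the bias of truncated anchored decompositions -/

section Integral

variable {S : Type} [MeasurableSpace S] {k : ReproducingKernel S} {γ : Finset ℕ → ℝ≥0}
  {ρ : Measure S} [IsProbabilityMeasure ρ]

theorem measurePreserving_infinitePi_restrict (v : Finset ℕ) :
    MeasurePreserving (fun (x : ℕ → S) (j : v) => x j) (Measure.infinitePi fun _ : ℕ => ρ)
      (Measure.pi fun _ : v => ρ) :=
  ⟨by fun_prop, Measure.infinitePi_map_restrict (fun _ : ℕ => ρ) (I := v)⟩

variable (hk : Measurable fun p : S × S => k p.1 p.2) (hM : Integrable (fun x => k x x) ρ)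
  (hsum : Summable fun u : Finset ℕ => (γ u : ℝ) * (∫ x, k x x ∂ρ) ^ u.card)

include hk hM hsum

/-- By Tonelli, `∑_u γ_u k_u(x,x)` has integral `∑_u γ_u M^{|u|} < ∞`, hence is finite almost
everywhere. -/
theorem ae_mem_domain : ∀ᵐ x ∂(Measure.infinitePi fun _ : ℕ => ρ), x ∈ domain k γ := by
  have hm : ∀ u : Finset ℕ, Measurable fun x : ℕ → S => ∏ j ∈ u, k (x j) (x j) := fun u =>
    Finset.measurable_prod _ fun j _ => hk.comp (f := fun x : ℕ → S => (x j, x j))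
      ((measurable_pi_apply j).prodMk (measurable_pi_apply j))
  have hlin : ∀ u : Finset ℕ, ∫⁻ x, ENNReal.ofReal ((γ u : ℝ) * ∏ j ∈ u, k (x j) (x j))
      ∂(Measure.infinitePi fun _ : ℕ => ρ)
      = ENNReal.ofReal ((γ u : ℝ) * (∫ x, k x x ∂ρ) ^ u.card) := by
    intro u
    have hi : Integrable (fun x : ℕ → S => (γ u : ℝ) * ∏ j ∈ u, k (x j) (x j))
        (Measure.infinitePi fun _ : ℕ => ρ) :=
      (integrable_diag_comp (measurePreserving_infinitePi_restrict u) hM).const_mul _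
    rw [← ofReal_integral_eq_lintegral_ofReal hi (ae_of_all _ fun x => mul_nonneg (γ u).2 ((k.prod u).diag_nonneg x)),
      integral_const_mul, integral_diag_comp (measurePreserving_infinitePi_restrict u) hk]
  have hfin : ∫⁻ x, ∑' u : Finset ℕ, ENNReal.ofReal ((γ u : ℝ) * ∏ j ∈ u, k (x j) (x j))
      ∂(Measure.infinitePi fun _ : ℕ => ρ) ≠ ∞ := by
    rw [lintegral_tsum fun u => ((hm u).const_mul _).ennreal_ofReal.aemeasurable]
    simp_rw [hlin]
    exact hsum.tsum_ofReal_ne_top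
  filter_upwards [ae_lt_top (Measurable.tsum fun u => ((hm u).const_mul _).ennreal_ofReal)
    hfin] with x hx
  have h := ENNReal.summable_toReal hx.ne
  refine h.congr fun u => ?_
  exact ENNReal.toReal_ofReal (mul_nonneg (γ u).2 ((k.prod u).diag_nonneg x))

/-- Integrate the superposition term by term: the terms with `w ≠ ∅` vanish by (A2a), and `e_∅` is
constant, so `z` is arbitrary. -/
theorem integral_toFunction_eq (h0 : ∀ y, ∫ x, k x y ∂ρ = 0) (hγ : γ ∅ = 1)
    {F : (ℕ → S) → ℝ} {e : k.FeatureSpace}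
    (hF : ∀ x ∈ domain k γ, HasSum (fun w => √(γ w) * e w x) (F x)) (z : ℕ → S) :
    ∫ x, F x ∂(Measure.infinitePi fun _ : ℕ => ρ) = e ∅ z := by
  have hint : ∀ w, Integrable (fun x => √(γ w : ℝ) * e w x) (Measure.infinitePi fun _ : ℕ => ρ) :=
    fun w => (integrable_comp (measurePreserving_infinitePi_restrict w) hk hM (e w)).const_mul _
  -- Domination by `‖e_w‖² + γ_w k_w(x,x)`: the reproducing property bounds the square of the term
  -- by the product of these two summands.
  have hnorm : Summable fun w => ∫ x, ‖√(γ w : ℝ) * e w x‖ ∂(Measure.infinitePi fun _ : ℕ => ρ) := by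
    have he : Summable fun w => ‖e w‖ ^ 2 := by
      have := (lp.memℓp e).summable (by norm_num)
      simpa using this
    refine Summable.of_nonneg_of_le (fun w => integral_nonneg fun x => norm_nonneg _) (fun w => ?_)
      (he.add hsum)
    have hd := integrable_diag_comp (measurePreserving_infinitePi_restrict (ρ := ρ) w) hM
    have : ‖e w‖ ^ 2 + (γ w : ℝ) * (∫ x, k x x ∂ρ) ^ w.card
        = ∫ x, (‖e w‖ ^ 2 + (γ w : ℝ) * ∏ j ∈ w, k (x j) (x j))
          ∂(Measure.infinitePi fun _ : ℕ => ρ) := by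
      rw [integral_add (integrable_const _) (hd.const_mul _), integral_const_mul,
        integral_diag_comp (measurePreserving_infinitePi_restrict w) hk]
      simp
    rw [this]
    refine integral_mono (hint w).norm ((integrable_const _).add (hd.const_mul _)) fun x => ?_
    have h1 : e w x ^ 2 ≤ ‖e w‖ ^ 2 * ∏ j ∈ w, k (x j) (x j) := (k.prod w).apply_sq_le (e w) x
    have h2 : 0 ≤ ∏ j ∈ w, k (x j) (x j) := (k.prod w).diag_nonneg x
    have h3 : (0 : ℝ) ≤ γ w := (γ w).2
    refine abs_le_of_sq_le_sq ?_ (by positivity)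
    rw [mul_pow, Real.sq_sqrt h3]
    calc (γ w : ℝ) * e w x ^ 2 ≤ γ w * (‖e w‖ ^ 2 * ∏ j ∈ w, k (x j) (x j)) := by gcongr
      _ = ‖e w‖ ^ 2 * (γ w * ∏ j ∈ w, k (x j) (x j)) := by ring
      _ ≤ _ := by nlinarith [sq_nonneg (‖e w‖ ^ 2), mul_nonneg h3 h2, sq_nonneg ‖e w‖,
          sq_nonneg (γ w * ∏ j ∈ w, k (x j) (x j)), mul_nonneg (sq_nonneg ‖e w‖) (mul_nonneg h3 h2)]
  have h1 := hasSum_integral_of_summable_integral_norm hint hnorm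
  have h2 : ∀ w, w ≠ ∅ → ∫ x, √(γ w : ℝ) * e w x ∂(Measure.infinitePi fun _ : ℕ => ρ) = 0 := by
    intro w hw
    rw [integral_const_mul, integral_comp_eq_zero (measurePreserving_infinitePi_restrict w) hk hM
      (Finset.nonempty_iff_ne_empty.2 hw) h0, mul_zero]
  have h3 := h1.unique (hasSum_single ∅ h2)
  have h4 : ∀ᵐ x ∂(Measure.infinitePi fun _ : ℕ => ρ), F x = ∑' w, √(γ w : ℝ) * e w x := by
    filter_upwards [ae_mem_domain hk hM hsum] with x hx using (hF x hx).tsum_eq.symm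
  rw [integral_congr_ae h4, h3]
  have h5 : ∀ x, e ∅ x = e ∅ z := fun x => prod_apply_congr _ (by simp)
  simp [hγ, h5]

end Integral

section Bias

variable {S : Type} {k : ReproducingKernel S} {γ : Finset ℕ → ℝ≥0} {a : S}

theorem abs_sum_filter_neg_one_pow_le (Q : Finset (Finset ℕ)) (w : Finset ℕ) :
    |∑ u ∈ Q with u ⊆ w, (-1 : ℝ) ^ u.card| ≤ 2 ^ w.card := by
  refine (Finset.abs_sum_le_sum_abs _ _).trans ?_
  simp only [abs_pow, abs_neg, abs_one, one_pow, Finset.sum_const, nsmul_eq_mul, mul_one]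
  have : (Q.filter (· ⊆ w)).card ≤ w.powerset.card :=
    Finset.card_le_card fun u hu => Finset.mem_powerset.2 (Finset.mem_filter.1 hu).2
  rw [Finset.card_powerset] at this
  exact_mod_cast this

theorem sum_filter_neg_one_pow_eq {Q : Finset (Finset ℕ)} (hQ : ∀ w ∈ Q, ∀ u ⊆ w, u ∈ Q)
    {w : Finset ℕ} (hw : w ∈ Q) :
    ∑ u ∈ Q with u ⊆ w, (-1 : ℝ) ^ u.card = if w = ∅ then 1 else 0 := by
  have h : Q.filter (· ⊆ w) = w.powerset := by
    ext u
    simp only [Finset.mem_filter, Finset.mem_powerset]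
    exact ⟨fun h => h.2, fun h => ⟨hQ w hw u h, h⟩⟩
  rw [h]
  exact_mod_cast Finset.sum_powerset_neg_one_pow_card (x := w)

/-- The bias of a truncated anchored decomposition; the integral of `f` is `e ∅`, and the integral
of the component `f_{u,𝐚}` is `(-1)^{|u|} b u`. -/
theorem bias_sq_le (hκ : 0 < k a a) (hγ : γ ∅ = 1) (e : k.FeatureSpace) {Q : Finset (Finset ℕ)}
    (hQ0 : ∅ ∈ Q) (hQ : ∀ w ∈ Q, ∀ u ⊆ w, u ∈ Q) {b : Finset ℕ → ℝ}
    (hb : ∀ u ∈ Q, HasSum (fun w => if u ⊆ w then √(γ w) * e w (fun _ => a) else 0) (b u))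
    (hs : Summable fun w => if w ∈ Q then 0 else (γ w : ℝ) * (4 * k a a) ^ w.card) :
    (e ∅ (fun _ => a) - ∑ u ∈ Q, (-1 : ℝ) ^ u.card * b u) ^ 2
      ≤ ‖e‖ ^ 2 * ∑' w, if w ∈ Q then 0 else (γ w : ℝ) * (4 * k a a) ^ w.card := by
  -- The coefficient of `e_w(𝐚)` in the bias. For `w ∈ Q` the inner sum runs over all subsets of
  -- `w`, since `Q` is closed under subsets, and the coefficient is zero. Otherwise the sum is at
  -- most `2^{|w|}`; its square is the source of the factor 4.
  set s : Finset ℕ → ℝ := fun w =>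
    √(γ w) * ((if w = ∅ then 1 else 0) - ∑ u ∈ Q with u ⊆ w, (-1 : ℝ) ^ u.card) with hsdef
  have hle : ∀ w, s w ^ 2 * ∏ j ∈ w, k a a ≤
      if w ∈ Q then 0 else (γ w : ℝ) * (4 * k a a) ^ w.card := by
    intro w
    rw [Finset.prod_const, hsdef]
    simp only
    by_cases h2 : w ∈ Q
    · rw [sum_filter_neg_one_pow_eq hQ h2]; simp [h2]
    · have h1 : w ≠ ∅ := fun h => h2 (h ▸ hQ0)
      rw [if_neg h1, if_neg h2, mul_pow, mul_pow, Real.sq_sqrt (NNReal.coe_nonneg _), zero_sub,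
        neg_sq, mul_assoc]
      refine mul_le_mul_of_nonneg_left (mul_le_mul_of_nonneg_right ?_ (by positivity)) (γ w).2
      have h3 := abs_sum_filter_neg_one_pow_le Q w
      calc (∑ u ∈ Q with u ⊆ w, (-1 : ℝ) ^ u.card) ^ 2 ≤ (2 ^ w.card) ^ 2 :=
            sq_le_sq' (by linarith [(abs_le.1 h3).1]) (abs_le.1 h3).2
        _ = 4 ^ w.card := by rw [← pow_mul, mul_comm, pow_mul]; norm_num
  have hss : Summable fun w => s w ^ 2 * ∏ j ∈ w, k a a :=
    Summable.of_nonneg_of_le (fun w => mul_nonneg (sq_nonneg _)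
      (Finset.prod_nonneg fun _ _ => hκ.le)) hle hs
  have h1 := k.hasSum_inner_featureVec s (fun _ => a) hss e
  have h2 : HasSum (fun w => √(γ w : ℝ) * (if w = ∅ then 1 else 0) * e w (fun _ => a))
      (e ∅ (fun _ => a)) := by
    have := hasSum_single (f := fun w => √(γ w : ℝ) * (if w = ∅ then 1 else 0) * e w (fun _ => a)) ∅
      (fun w hw => by simp [hw])
    simpa [hγ] using this
  have h3 : HasSum (fun w => ∑ u ∈ Q, (-1 : ℝ) ^ u.card *
      (if u ⊆ w then √(γ w) * e w (fun _ => a) else 0)) (∑ u ∈ Q, (-1 : ℝ) ^ u.card * b u) :=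
    hasSum_sum fun u hu => (hb u hu).mul_left _
  -- As an inner product with `e`, the bias is amenable to the Cauchy–Schwarz inequality.
  have h4 : e ∅ (fun _ => a) - ∑ u ∈ Q, (-1 : ℝ) ^ u.card * b u
      = inner ℝ e (k.featureVec s (fun _ => a) hss) := by
    refine (h2.sub h3).unique (h1.congr_fun fun w => ?_)
    have : ∑ u ∈ Q, (-1 : ℝ) ^ u.card * (if u ⊆ w then √(γ w) * e w (fun _ => a) else 0)
        = (∑ u ∈ Q with u ⊆ w, (-1 : ℝ) ^ u.card) * (√(γ w) * e w (fun _ => a)) := by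
      rw [Finset.sum_mul, Finset.sum_filter]
      refine Finset.sum_congr rfl fun u _ => ?_
      split_ifs <;> simp
    rw [this, hsdef]
    ring
  rw [h4]
  calc (inner ℝ e (k.featureVec s (fun _ => a) hss)) ^ 2
      ≤ ‖e‖ ^ 2 * ‖k.featureVec s (fun _ => a) hss‖ ^ 2 := by
        rw [← mul_pow]
        exact sq_le_sq' (by linarith [neg_abs_le (inner ℝ e (k.featureVec s (fun _ => a) hss)),
          abs_real_inner_le_norm e (k.featureVec s (fun _ => a) hss)]) (real_inner_le_norm _ _)
    _ ≤ _ := by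
        rw [k.norm_featureVec_sq]
        exact mul_le_mul_of_nonneg_left (hss.tsum_le_tsum hle hs) (sq_nonneg _)

end Bias

end

end InfDimInt

namespace InfDimInt

noncomputable section

open ReproducingKernel

/-! ### Mean and variance of the quadratures applied to the anchored components -/

/-- Cauchy–Schwarz for the centred variables. No independence is available where this is applied:
the sections for different `v ⊆ u` are evaluated at the same nodes. -/
theorem variance_sum_le_card_mul {Ω ι : Type*} [MeasurableSpace Ω] {P : Measure Ω}
    [IsProbabilityMeasure P] (s : Finset ι) (X : ι → Ω → ℝ) (hX : ∀ i ∈ s, MemLp (X i) 2 P) :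
    variance (fun ω => ∑ i ∈ s, X i ω) P ≤ s.card * ∑ i ∈ s, variance (X i) P := by
  have hint : ∀ i ∈ s, Integrable (X i) P := fun i hi => (hX i hi).integrable one_le_two
  have hsq : ∀ i ∈ s, Integrable (fun ω => (X i ω - ∫ x, X i x ∂P) ^ 2) P := fun i hi =>
    ((hX i hi).sub (memLp_const _)).integrable_sq
  have hsum : MemLp (fun ω => ∑ i ∈ s, X i ω) 2 P := memLp_finsetSum s hX
  rw [variance_eq_integral hsum.aemeasurable, integral_finsetSum _ hint]
  have h1 : ∑ i ∈ s, variance (X i) P = ∫ ω, ∑ i ∈ s, (X i ω - ∫ x, X i x ∂P) ^ 2 ∂P := by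
    rw [integral_finsetSum _ hsq]
    exact Finset.sum_congr rfl fun i hi => variance_eq_integral (hX i hi).aemeasurable
  rw [h1, ← integral_const_mul]
  refine integral_mono ?_ ((integrable_finsetSum _ hsq).const_mul _) fun ω => ?_
  · exact (hsum.sub (memLp_const _)).integrable_sq
  · simp only [← Finset.sum_sub_distrib]
    exact sq_sum_le_card_mul_sum_sq

theorem integral_comp_of_measurePreserving {Ω Ω' : Type*} [MeasurableSpace Ω] [MeasurableSpace Ω']
    {μ : Measure Ω} {ν : Measure Ω'} {T : Ω → Ω'} (hT : MeasurePreserving T μ ν) {g : Ω' → ℝ}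
    (hg : AEStronglyMeasurable g ν) : ∫ ω, g (T ω) ∂μ = ∫ x, g x ∂ν := by
  obtain ⟨hm, rfl⟩ := hT
  exact (integral_map hm.aemeasurable hg).symm

theorem variance_comp_of_measurePreserving {Ω Ω' : Type*} [MeasurableSpace Ω] [MeasurableSpace Ω']
    {μ : Measure Ω} {ν : Measure Ω'} {T : Ω → Ω'} (hT : MeasurePreserving T μ ν) {g : Ω' → ℝ}
    (hg : AEMeasurable g ν) : variance (fun ω => g (T ω)) μ = variance g ν := by
  obtain ⟨hm, rfl⟩ := hT
  exact (variance_map hg hm.aemeasurable).symm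

theorem indepFun_comp_eval {ι : Type*} {E : ι → Type*} [∀ i, MeasurableSpace (E i)]
    (P : ∀ i, Measure (E i)) [∀ i, IsProbabilityMeasure (P i)] {i j : ι} (hij : i ≠ j)
    {X : E i → ℝ} {Y : E j → ℝ} (hX : AEMeasurable X (P i)) (hY : AEMeasurable Y (P j)) :
    IndepFun (fun ω : ∀ i, E i => X (ω i)) (fun ω => Y (ω j)) (Measure.infinitePi P) := by
  have h : IndepFun (Function.eval i) (Function.eval j) (Measure.infinitePi P) :=
    (iIndepFun_infinitePi (P := P) (X := fun _ ω => ω) fun _ => measurable_id).indepFun hij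
  have hi := measurePreserving_eval_infinitePi P i
  have hj := measurePreserving_eval_infinitePi P j
  rw [← hi.map_eq] at hX
  rw [← hj.map_eq] at hY
  exact h.comp₀ hi.measurable.aemeasurable hj.measurable.aemeasurable hX hY

/-- Bias–variance decomposition: the cross term has mean zero. -/
theorem lintegral_sq_sub_add {Ω : Type*} [MeasurableSpace Ω] {μ : Measure Ω}
    [IsProbabilityMeasure μ] {Y : Ω → ℝ} (hY : MemLp Y 2 μ) (c d : ℝ) :
    ∫⁻ ω, ENNReal.ofReal ((c - (d + Y ω)) ^ 2) ∂μ
      = ENNReal.ofReal ((c - (d + ∫ ω, Y ω ∂μ)) ^ 2 + variance Y μ) := by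
  have hint : Integrable (fun ω => (c - (d + Y ω)) ^ 2) μ :=
    ((memLp_const c).sub ((memLp_const d).add hY)).integrable_sq
  rw [← ofReal_integral_eq_lintegral_ofReal hint (ae_of_all _ fun ω => sq_nonneg _)]
  congr 1
  rw [variance_eq_integral hY.aemeasurable]
  generalize hy : ∫ ω, Y ω ∂μ = y
  have hYi := hY.integrable one_le_two
  have h2 : Integrable (fun ω => (Y ω - y) ^ 2) μ := (hY.sub (memLp_const y)).integrable_sq
  have h1 : ∀ ω, (c - (d + Y ω)) ^ 2
      = ((c - (d + y)) ^ 2 - 2 * (c - (d + y)) * (Y ω - y)) + (Y ω - y) ^ 2 := fun ω => by ring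
  have h3 : Integrable (fun ω => 2 * (c - (d + y)) * (Y ω - y)) μ :=
    (hYi.sub (integrable_const y)).const_mul _
  have h4 : Integrable (fun ω => (c - (d + y)) ^ 2 - 2 * (c - (d + y)) * (Y ω - y)) μ :=
    (integrable_const _).sub h3
  simp_rw [h1]
  rw [integral_add h4 h2, integral_sub (integrable_const _) h3,
    integral_const_mul, integral_sub hYi (integrable_const _), hy]
  simp

/-- Functions of different coordinates of a product space are independent, so variances add without
loss. -/
theorem lintegral_sq_sub_add_sum {ι : Type*} {E : ι → Type*} [∀ i, MeasurableSpace (E i)]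
    (P : ∀ i, Measure (E i)) [∀ i, IsProbabilityMeasure (P i)] (s : Finset ι) (X : ∀ i, E i → ℝ)
    (hX : ∀ i ∈ s, MemLp (X i) 2 (P i)) (c d : ℝ) :
    MemLp (fun ω : ∀ i, E i => d + ∑ i ∈ s, X i (ω i)) 2 (Measure.infinitePi P) ∧
    ∫⁻ ω, ENNReal.ofReal ((c - (d + ∑ i ∈ s, X i (ω i))) ^ 2) ∂(Measure.infinitePi P)
      = ENNReal.ofReal ((c - (d + ∑ i ∈ s, ∫ x, X i x ∂(P i))) ^ 2
        + ∑ i ∈ s, variance (X i) (P i)) := by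
  have hmp : ∀ u, MeasurePreserving (Function.eval u) (Measure.infinitePi P) (P u) := fun u =>
    measurePreserving_eval_infinitePi P u
  have hXL : ∀ u ∈ s, MemLp (fun ω : ∀ i, E i => X u (ω u)) 2 (Measure.infinitePi P) := fun u hu =>
    (hX u hu).comp_measurePreserving (hmp u)
  have hYL : MemLp (fun ω : ∀ i, E i => ∑ u ∈ s, X u (ω u)) 2 (Measure.infinitePi P) :=
    memLp_finsetSum _ hXL
  refine ⟨(memLp_const d).add hYL, ?_⟩
  have hEY : ∫ ω, ∑ u ∈ s, X u (ω u) ∂(Measure.infinitePi P) = ∑ i ∈ s, ∫ x, X i x ∂(P i) := by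
    rw [integral_finsetSum _ fun u hu => (hXL u hu).integrable one_le_two]
    exact Finset.sum_congr rfl fun u hu =>
      integral_comp_of_measurePreserving (hmp u) (hX u hu).aestronglyMeasurable
  have hVY : variance (fun ω : ∀ i, E i => ∑ u ∈ s, X u (ω u)) (Measure.infinitePi P)
      = ∑ i ∈ s, variance (X i) (P i) := by
    have h2 : (fun ω : ∀ i, E i => ∑ u ∈ s, X u (ω u)) = ∑ u ∈ s, fun ω => X u (ω u) := by
      ext ω; simp
    rw [h2, IndepFun.variance_sum hXL]
    · exact Finset.sum_congr rfl fun u hu =>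
        variance_comp_of_measurePreserving (hmp u) (hX u hu).aemeasurable
    · intro u hu v hv huv
      exact indepFun_comp_eval P huv (hX u hu).aemeasurable (hX v hv).aemeasurable
  rw [lintegral_sq_sub_add hYL, hEY, hVY]

theorem growth_nonneg (α₁ α₂ : ℝ) (w : Finset ℕ) (n : ℕ) : 0 ≤ growth α₁ α₂ w n := by
  rw [growth]
  split_ifs with hcard
  · exact zero_le_one
  · have h1 : (0 : ℝ) ≤ (w.card : ℝ) - 1 := by
      rw [not_le] at hcard
      have : (1 : ℝ) < w.card := by exact_mod_cast hcard
      linarith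
    have h2 : 0 ≤ Real.log ((n : ℝ) + 1) :=
      Real.log_nonneg (by linarith [Nat.cast_nonneg (α := ℝ) n])
    positivity

theorem anchorAt_const {S : Type} (a : S) (v : Finset ℕ) :
    anchorAt a v (fun _ => a) = fun _ => a := by
  ext j; simp [anchorAt]

section Quadrature

variable {S : Type} [MeasurableSpace S] {k : ReproducingKernel S} {γ : Finset ℕ → ℝ≥0}
  {ρ : Measure S} [IsProbabilityMeasure ρ] {a : S}

/-- Each coordinate of the node depends on its own `ω_j` only, so the joint law on `u` is a product;
then pass to the marginal on `v`. -/
theorem UnbiasedQuadrature.measurePreserving_nodePoint {u : Finset ℕ} {n : ℕ+}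
    (Q : UnbiasedQuadrature ρ u n) (i : Fin n) {v : Finset ℕ} (hv : v ⊆ u) :
    MeasurePreserving (fun (ω : u → Q.Ω) (j : v) => Q.nodePoint a i ω j)
      (Measure.pi fun _ : u => Q.P) (Measure.pi fun _ : v => ρ) := by
  have h1 : MeasurePreserving (fun (ω : u → Q.Ω) (j : u) => Q.node i j (ω j))
      (Measure.pi fun _ : u => Q.P) (Measure.pi fun _ : u => ρ) :=
    measurePreserving_pi (fun _ : u => Q.P) (fun _ : u => ρ) fun j => Q.node_law i j
  have h2 : MeasurePreserving (Finset.restrict₂ (π := fun _ => S) hv)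
      (Measure.pi fun _ : u => ρ) (Measure.pi fun _ : v => ρ) :=
    ⟨Finset.measurable_restrict₂ hv, (isProjectiveMeasureFamily_pi (fun _ : ℕ => ρ) u v hv).symm⟩
  have h3 := h2.comp h1
  convert h3 using 1
  ext ω j
  simp [UnbiasedQuadrature.nodePoint, hv j.2, Finset.restrict₂]

variable (hk : Measurable fun p : S × S => k p.1 p.2) (hM : Integrable (fun x => k x x) ρ)

include hk hM

theorem UnbiasedQuadrature.memLp_eval {u : Finset ℕ} {n : ℕ+} (Q : UnbiasedQuadrature ρ u n)
    {v : Finset ℕ} (hv : v ⊆ u) (g : (k.prod v).Space) :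
    MemLp (fun ω => Q.eval a (fun x => g x) ω) 2 (Measure.pi fun _ : u => Q.P) :=
  memLp_finsetSum _ fun i _ =>
    (memLp_two_comp (Q.measurePreserving_nodePoint i hv) hk hM g).const_mul _

/-- The constant case is `∑ t_i = 1`; otherwise every node has mean zero by (A2a). -/
theorem UnbiasedQuadrature.integral_eval (h0 : ∀ y, ∫ x, k x y ∂ρ = 0) {u : Finset ℕ} {n : ℕ+}
    (Q : UnbiasedQuadrature ρ u n) {v : Finset ℕ} (hv : v ⊆ u) (g : (k.prod v).Space) (z : ℕ → S) :
    ∫ ω, Q.eval a (fun x => g x) ω ∂(Measure.pi fun _ : u => Q.P) = if v = ∅ then g z else 0 := by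
  split_ifs with hv0
  · subst hv0
    have : ∀ x, g x = g z := fun x => prod_apply_congr g (by simp)
    simp [UnbiasedQuadrature.eval, this, ← Finset.sum_mul, Q.coeff_sum]
  · have hn : v.Nonempty := Finset.nonempty_iff_ne_empty.2 hv0
    simp only [UnbiasedQuadrature.eval]
    rw [integral_finsetSum _ fun i _ =>
      (integrable_comp (Q.measurePreserving_nodePoint i hv) hk hM g).const_mul _]
    refine Finset.sum_eq_zero fun i _ => ?_
    rw [integral_const_mul,
      integral_comp_eq_zero (Q.measurePreserving_nodePoint i hv) hk hM hn h0 g, mul_zero]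

variable (hκ : 0 < k a a) (ha : Summable fun u : Finset ℕ => (γ u : ℝ) * k a a ^ u.card)

include hκ ha

/-- Mean and variance of a quadrature applied to an anchored component. -/
theorem exists_mean_variance_component (h0 : ∀ y, ∫ x, k x y ∂ρ = 0)
    (hA6 : ∀ u v : Finset ℕ, u ⊆ v → 0 < γ v → 0 < γ u)
    {c C τ α₁ α₂ : ℝ} (hc : 0 < c) (hC : 0 < C)
    {q : (u : Finset ℕ) → (n : ℕ+) → UnbiasedQuadrature ρ u n}
    (hA7 : VarianceBound k γ a q c C τ α₁ α₂)
    {F : (ℕ → S) → ℝ} {e : k.FeatureSpace}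
    (hF : ∀ x ∈ domain k γ, HasSum (fun w => √(γ w) * e w x) (F x))
    {u : Finset ℕ} (hu : u.Nonempty) (hγu : 0 < γ u) (n : ℕ+) {G : ℝ}
    (hG : ∀ w ⊆ u, growth α₁ α₂ w n ≤ G) :
    ∃ b : ℝ, HasSum (fun w => if u ⊆ w then √(γ w) * e w (fun _ => a) else 0) b ∧
      MemLp ((q u n).eval a (anchoredComponent a F u)) 2 (Measure.pi fun _ : u => (q u n).P) ∧
      ∫ ω, (q u n).eval a (anchoredComponent a F u) ω ∂(Measure.pi fun _ : u => (q u n).P)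
        = (-1 : ℝ) ^ u.card * b ∧
      variance ((q u n).eval a (anchoredComponent a F u)) (Measure.pi fun _ : u => (q u n).P)
        ≤ c * (2 * C * (1 + k a a)) ^ u.card * ((n : ℝ) + 1) ^ (-τ) * G * rSq k γ a u u
          * ‖e‖ ^ 2 := by
  have hex : ∀ v : Finset ℕ, ∃ g : (k.prod v).Space, v ⊆ u →
      ‖g‖ ≤ √(k a a ^ (u \ v).card * rSq k γ a u u) * ‖e‖ ∧
      ∀ x, HasSum (fun w => if u ⊆ w then √(γ w) * e w (anchorAt a v x) else 0) (g x) := by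
    intro v
    by_cases hv : v ⊆ u
    · obtain ⟨g, hg⟩ := exists_section (γ := γ) hκ ha e hv
      exact ⟨g, fun _ => hg⟩
    · exact ⟨0, fun h => absurd h hv⟩
  choose g hg using hex
  have hcomp : ∀ ω, (q u n).eval a (anchoredComponent a F u) ω
      = ∑ v ∈ u.powerset, (-1 : ℝ) ^ (u \ v).card * (q u n).eval a (fun x => g v x) ω := by
    intro ω
    simp only [UnbiasedQuadrature.eval, Finset.mul_sum]
    rw [Finset.sum_comm]
    refine Finset.sum_congr rfl fun i _ => ?_
    rw [anchoredComponent_eq_sum hκ ha hF g (fun v hv => (hg v hv).2), Finset.mul_sum]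
    exact Finset.sum_congr rfl fun v _ => by ring
  have hL : ∀ v ∈ u.powerset, MemLp (fun ω => (-1 : ℝ) ^ (u \ v).card *
      (q u n).eval a (fun x => g v x) ω) 2 (Measure.pi fun _ : u => (q u n).P) := fun v hv =>
    ((q u n).memLp_eval hk hM (Finset.mem_powerset.1 hv) (g v)).const_mul _
  rw [funext hcomp]
  refine ⟨g ∅ (fun _ => a), ?_, memLp_finsetSum _ hL, ?_, ?_⟩
  · have := (hg ∅ (Finset.empty_subset _)).2 (fun _ => a)
    simpa only [anchorAt_const, Finset.empty_subset] using this
  · rw [integral_finsetSum _ fun v hv => (hL v hv).integrable one_le_two]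
    -- Only the constant section `v = ∅` has nonzero mean, which gives the sign `(-1)^{|u|}`.
    rw [Finset.sum_eq_single_of_mem ∅ (by simp)]
    · rw [integral_const_mul, (q u n).integral_eval hk hM h0 (Finset.empty_subset _) _ (fun _ => a)]
      simp
    · intro v hv hv0
      rw [integral_const_mul, (q u n).integral_eval hk hM h0 (Finset.mem_powerset.1 hv) _
        (fun _ => a), if_neg hv0, mul_zero]
  · refine (variance_sum_le_card_mul _ _ hL).trans ?_
    -- The factor `1 ^ v.card` prepares the binomial identity `∑_v k(a,a)^{|u∖v|} = (1 +
    -- k(a,a))^{|u|}`. Together with the `2^{|u|}` terms of the sum it yields the base `2C(1 +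
    -- k(a,a))`.
    have hvar : ∀ v ∈ u.powerset, variance (fun ω => (-1 : ℝ) ^ (u \ v).card *
        (q u n).eval a (fun x => g v x) ω) (Measure.pi fun _ : u => (q u n).P)
        ≤ c * C ^ u.card * ((n : ℝ) + 1) ^ (-τ) * G * rSq k γ a u u * ‖e‖ ^ 2
          * (1 ^ v.card * k a a ^ (u.card - v.card)) := by
      intro v hv
      rw [Finset.mem_powerset] at hv
      rw [variance_const_mul, ← pow_mul, mul_comm _ 2, pow_mul]
      have hr := rSq_nonneg (γ := γ) hκ u
      have h1 : ‖g v‖ ^ 2 ≤ k a a ^ (u.card - v.card) * rSq k γ a u u * ‖e‖ ^ 2 := by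
        rw [← Finset.card_sdiff_of_subset hv, ← Real.sq_sqrt (mul_nonneg (by positivity) hr),
          ← mul_pow]
        exact pow_le_pow_left₀ (norm_nonneg _) (hg v hv).1 2
      have h2 := hA7 u hu hγu n v hv (hA6 v u hv hγu) (g v)
      have h3 := hG v hv
      have h4 : 0 ≤ growth α₁ α₂ v n := growth_nonneg _ _ _ _
      simp only [neg_one_sq, one_pow, one_mul]
      refine h2.trans ?_
      have h6 : 0 ≤ c * C ^ u.card * ((n : ℝ) + 1) ^ (-τ) := by positivity
      calc c * C ^ u.card * ((n : ℝ) + 1) ^ (-τ) * growth α₁ α₂ v n * ‖g v‖ ^ 2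
          ≤ c * C ^ u.card * ((n : ℝ) + 1) ^ (-τ) * G *
            (k a a ^ (u.card - v.card) * rSq k γ a u u * ‖e‖ ^ 2) := by
            gcongr
            exact mul_nonneg h6 (h4.trans h3)
        _ = _ := by ring
    calc (u.powerset.card : ℝ) * ∑ v ∈ u.powerset, variance (fun ω => (-1 : ℝ) ^ (u \ v).card *
        (q u n).eval a (fun x => g v x) ω) (Measure.pi fun _ : u => (q u n).P)
        ≤ (u.powerset.card : ℝ) * ∑ v ∈ u.powerset,
          c * C ^ u.card * ((n : ℝ) + 1) ^ (-τ) * G * rSq k γ a u u * ‖e‖ ^ 2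
          * (1 ^ v.card * k a a ^ (u.card - v.card)) := by
          gcongr with v hv
          exact hvar v hv
      _ = _ := by
          rw [← Finset.mul_sum, Finset.sum_pow_mul_eq_add_pow, Finset.card_powerset, mul_pow,
            mul_pow]
          push_cast
          ring

/-- The error of truncated anchored decompositions with randomized quadratures. -/
theorem lintegral_error_sq_le (h0 : ∀ y, ∫ x, k x y ∂ρ = 0) (hγ : γ ∅ = 1)
    (hsum : Summable fun u : Finset ℕ => (γ u : ℝ) * (∫ x, k x x ∂ρ) ^ u.card)
    (hA6 : ∀ u v : Finset ℕ, u ⊆ v → 0 < γ v → 0 < γ u)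
    {c C τ α₁ α₂ : ℝ} (hc : 0 < c) (hC : 0 < C)
    {q : (u : Finset ℕ) → (n : ℕ+) → UnbiasedQuadrature ρ u n}
    (hA7 : VarianceBound k γ a q c C τ α₁ α₂)
    {Q : Finset (Finset ℕ)} (hQ0 : ∅ ∈ Q) (hQ : ∀ w ∈ Q, ∀ u ⊆ w, u ∈ Q)
    (hQγ : ∀ u ∈ Q, 0 < γ u) (m : Finset ℕ → ℕ+) {G : ℝ}
    (hG : ∀ u ∈ Q, ∀ w ⊆ u, growth α₁ α₂ w (m u) ≤ G)
    (hs : Summable fun w => if w ∈ Q then 0 else (γ w : ℝ) * (4 * k a a) ^ w.card)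
    (f : (weightedKernel k γ).Space) :
    MemLp (fun ω : ∀ u : Finset ℕ, u → (q u (m u)).Ω => toFunction k γ f (fun _ => a) +
        ∑ u ∈ Q.erase ∅, (q u (m u)).eval a (anchoredComponent a (toFunction k γ f) u) (ω u)) 2
      (Measure.infinitePi fun u : Finset ℕ => Measure.pi fun _ : u => (q u (m u)).P) ∧
    ∫⁻ ω, ENNReal.ofReal ((integral k γ ρ f - (toFunction k γ f (fun _ => a) +
      ∑ u ∈ Q.erase ∅,
        (q u (m u)).eval a (anchoredComponent a (toFunction k γ f) u) (ω u))) ^ 2)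
      ∂(Measure.infinitePi fun u : Finset ℕ => Measure.pi fun _ : u => (q u (m u)).P)
      ≤ ENNReal.ofReal (‖f‖ ^ 2 * ((∑' w, if w ∈ Q then 0 else (γ w : ℝ) * (4 * k a a) ^ w.card) +
        ∑ u ∈ Q.erase ∅, c * (2 * C * (1 + k a a)) ^ u.card * ((m u : ℝ) + 1) ^ (-τ) * G
          * rSq k γ a u u)) := by
  obtain ⟨e, he, hF⟩ := exists_superposition f
  set F := toFunction k γ f with hFdef
  have hI : integral k γ ρ f = e ∅ (fun _ => a) := integral_toFunction_eq hk hM hsum h0 hγ hF _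
  set P : ∀ u : Finset ℕ, Measure (u → (q u (m u)).Ω) := fun u =>
    Measure.pi fun _ : u => (q u (m u)).P with hP
  set X : ∀ u : Finset ℕ, (u → (q u (m u)).Ω) → ℝ := fun u =>
    (q u (m u)).eval a (anchoredComponent a F u) with hX
  have hdom : (fun _ => a : ℕ → S) ∈ domain k γ := by
    have := anchorAt_mem_domain (γ := γ) hκ ha ∅ (fun _ => a)
    rwa [anchorAt_const] at this
  -- For `u = ∅` the number is `f(𝐚)`, so the deterministic term joins the alternating sum in
  -- `bias_sq_le`; outside `Q` the value is a dummy.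
  have hexb : ∀ u : Finset ℕ, ∃ b : ℝ, (u ∈ Q →
      HasSum (fun w => if u ⊆ w then √(γ w) * e w (fun _ => a) else 0) b) ∧
      (u = ∅ → b = F (fun _ => a)) ∧
      (u ∈ Q.erase ∅ → MemLp (X u) 2 (P u) ∧ ∫ ω, X u ω ∂(P u) = (-1 : ℝ) ^ u.card * b ∧
        variance (X u) (P u) ≤ c * (2 * C * (1 + k a a)) ^ u.card * ((m u : ℝ) + 1) ^ (-τ) * G
          * rSq k γ a u u * ‖e‖ ^ 2) := by
    intro u
    rcases eq_or_ne u ∅ with rfl | h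
    · exact ⟨F (fun _ => a), fun _ => by simpa using hF _ hdom, fun _ => rfl, by simp⟩
    · by_cases huQ : u ∈ Q
      · obtain ⟨b, h1, h2⟩ := exists_mean_variance_component hk hM hκ ha h0 hA6 hc hC
          hA7 hF (Finset.nonempty_iff_ne_empty.2 h) (hQγ u huQ) (m u) (hG u huQ)
        exact ⟨b, fun _ => h1, fun h' => absurd h' h, fun _ => h2⟩
      · exact ⟨0, fun h' => absurd h' huQ, fun h' => absurd h' h,
          fun h' => absurd (Finset.mem_of_mem_erase h') huQ⟩
  choose b hb1 hb2 hb3 using hexb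
  obtain ⟨h1, h2⟩ := lintegral_sq_sub_add_sum P (Q.erase ∅) X (fun u hu => (hb3 u hu).1)
    (integral k γ ρ f) (F fun _ => a)
  refine ⟨h1, h2.le.trans (ENNReal.ofReal_le_ofReal ?_)⟩
  have hbias := bias_sq_le hκ hγ e hQ0 hQ hb1 hs
  have hEY : F (fun _ => a) + ∑ u ∈ Q.erase ∅, ∫ x, X u x ∂(P u)
      = ∑ u ∈ Q, (-1 : ℝ) ^ u.card * b u := by
    rw [← Finset.add_sum_erase _ _ hQ0]
    congr 1
    · simp [hb2]
    · exact Finset.sum_congr rfl fun u hu => (hb3 u hu).2.1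
  have hnn : ∀ u ∈ Q.erase ∅, 0 ≤ c * (2 * C * (1 + k a a)) ^ u.card * ((m u : ℝ) + 1) ^ (-τ) * G
      * rSq k γ a u u := fun u hu => by
    have h3 : 0 ≤ G :=
      (growth_nonneg α₁ α₂ u (m u)).trans (hG u (Finset.mem_of_mem_erase hu) u subset_rfl)
    have h4 := rSq_nonneg (γ := γ) hκ u
    positivity
  rw [hEY, hI]
  calc (e ∅ (fun _ => a) - ∑ u ∈ Q, (-1 : ℝ) ^ u.card * b u) ^ 2
      + ∑ u ∈ Q.erase ∅, variance (X u) (P u)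
      ≤ ‖e‖ ^ 2 * (∑' w, if w ∈ Q then 0 else (γ w : ℝ) * (4 * k a a) ^ w.card)
        + ∑ u ∈ Q.erase ∅, c * (2 * C * (1 + k a a)) ^ u.card * ((m u : ℝ) + 1) ^ (-τ) * G
          * rSq k γ a u u * ‖e‖ ^ 2 :=
        add_le_add hbias (Finset.sum_le_sum fun u hu => (hb3 u hu).2.2)
    _ = ‖e‖ ^ 2 * ((∑' w, if w ∈ Q then 0 else (γ w : ℝ) * (4 * k a a) ^ w.card)
        + ∑ u ∈ Q.erase ∅, c * (2 * C * (1 + k a a)) ^ u.card * ((m u : ℝ) + 1) ^ (-τ) * G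
          * rSq k γ a u u) := by rw [← Finset.sum_mul]; ring
    _ ≤ _ := by
        refine mul_le_mul_of_nonneg_right (pow_le_pow_left₀ (norm_nonneg _) he 2)
          (add_nonneg (tsum_nonneg fun w => ?_) (Finset.sum_nonneg hnn))
        split_ifs <;> positivity

end Quadrature

end

end InfDimInt

namespace InfDimInt

noncomputable section

/-! ### Weights whose order grows slowly -/

/-- The order `|u|` grows slower than every multiple of `ln (1 / γ_u)`. -/
def CardLogBound (γ : Finset ℕ → ℝ≥0) : Prop :=
  ∀ η : ℝ, 0 < η → ∃ K : ℝ, ∀ u : Finset ℕ, 0 < γ u → (u.card : ℝ) ≤ K - η * Real.log (γ u)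

namespace CardLogBound

variable {γ : Finset ℕ → ℝ≥0}

/-- Apply the bound with `η / (|ln B| + 1)` and exponentiate; the `+ 1` covers `B = 1`. -/
theorem pow_card_le (h : CardLogBound γ) {B η : ℝ} (hB : 0 < B) (hη : 0 < η) :
    ∃ K : ℝ, 0 < K ∧ ∀ u : Finset ℕ, 0 < γ u → B ^ u.card ≤ K * (γ u : ℝ) ^ (-η) := by
  have hl : 0 < |Real.log B| + 1 := by positivity
  obtain ⟨K, hK⟩ := h (η / (|Real.log B| + 1)) (by positivity)
  refine ⟨Real.exp (K * (|Real.log B| + 1)), Real.exp_pos _, fun u hu => ?_⟩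
  have hu' : (0 : ℝ) < γ u := hu
  rw [← Real.exp_log (pow_pos hB _), Real.log_pow, Real.rpow_def_of_pos hu', ← Real.exp_add]
  refine Real.exp_le_exp.2 ?_
  calc (u.card : ℝ) * Real.log B ≤ u.card * (|Real.log B| + 1) := by
        gcongr; linarith [le_abs_self (Real.log B)]
    _ ≤ (K - η / (|Real.log B| + 1) * Real.log (γ u)) * (|Real.log B| + 1) := by
        gcongr; exact hK u hu
    _ = _ := by field_simp; ring

theorem exists_pow_card_mul_rpow_le (h : CardLogBound γ) {B s : ℝ} (hB : 0 < B) (hs : 0 < s) :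
    ∃ K : ℝ, 0 < K ∧ ∀ u : Finset ℕ, B ^ u.card * (γ u : ℝ) ^ s ≤ K := by
  obtain ⟨K, hK0, hK⟩ := h.pow_card_le hB hs
  refine ⟨K, hK0, fun u => ?_⟩
  rcases eq_or_lt_of_le (zero_le (a := γ u)) with h0 | h0
  · rw [← h0, NNReal.coe_zero, Real.zero_rpow hs.ne', mul_zero]; exact hK0.le
  · have h1 : (0 : ℝ) < γ u := h0
    calc B ^ u.card * (γ u : ℝ) ^ s ≤ K * (γ u : ℝ) ^ (-s) * (γ u : ℝ) ^ s := by
          gcongr; exact hK u h0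
      _ = K := by rw [mul_assoc, ← Real.rpow_add h1]; simp

/-- The surplus exponent `s - 1/p` absorbs `(B κ^{-1/p})^{|u|}`, leaving the series that defines the
decay. -/
theorem summable_pow_card_mul_rpow (h : CardLogBound γ) {κ p s B : ℝ} (hκ : 0 < κ)
    (hps : 1 / p < s) (hs : 0 < s)
    (hp : Summable fun u : Finset ℕ => ((γ u : ℝ) * κ ^ u.card) ^ (1 / p)) (hB : 0 < B) :
    Summable fun u : Finset ℕ => B ^ u.card * (γ u : ℝ) ^ s := by
  have hB' : 0 < B * κ ^ (-(1 / p)) := by positivity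
  obtain ⟨K, hK0, hK⟩ := h.pow_card_le hB' (sub_pos.2 hps)
  refine Summable.of_nonneg_of_le (fun u => by positivity) (fun u => ?_) (hp.mul_left K)
  rcases eq_or_lt_of_le (zero_le (a := γ u)) with h0 | h0
  · rw [← h0, NNReal.coe_zero, Real.zero_rpow hs.ne', mul_zero]
    positivity
  · have h1 : (0 : ℝ) < γ u := h0
    have h2 := hK u h0
    rw [Real.mul_rpow h1.le (by positivity), ← Real.rpow_natCast κ, ← Real.rpow_mul hκ.le]
    have h3 : B ^ u.card = (B * κ ^ (-(1 / p))) ^ u.card * κ ^ ((u.card : ℝ) * (1 / p)) := by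
      rw [mul_pow, ← Real.rpow_natCast (κ ^ (-(1 / p))), ← Real.rpow_mul hκ.le, mul_assoc,
        ← Real.rpow_add hκ]
      ring_nf
      simp
    rw [h3]
    calc (B * κ ^ (-(1 / p))) ^ u.card * κ ^ ((u.card : ℝ) * (1 / p)) * (γ u : ℝ) ^ s
        ≤ K * (γ u : ℝ) ^ (-(s - 1 / p)) * κ ^ ((u.card : ℝ) * (1 / p)) * (γ u : ℝ) ^ s := by gcongr
      _ = K * ((γ u : ℝ) ^ (-(s - 1 / p)) * (γ u : ℝ) ^ s) * κ ^ ((u.card : ℝ) * (1 / p)) := by ring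
      _ = _ := by
        rw [← Real.rpow_add h1]
        ring_nf

end CardLogBound

/-! ### The exponents of admissible parameters -/

section Decay

variable {S : Type} {k : ReproducingKernel S} {γ : Finset ℕ → ℝ≥0} {a : S}

theorem exists_summable_of_lt_decay {s : ℝ} (hs : 0 < s) (h : ((1 / s : ℝ) : EReal) < decay k γ a) :
    ∃ p : ℝ, 0 < p ∧ 1 / p < s ∧
      Summable fun u : Finset ℕ => ((γ u : ℝ) * k a a ^ u.card) ^ (1 / p) := by
  obtain ⟨_, ⟨p, hp, rfl, hsum⟩, hlt⟩ := lt_sSup_iff.1 h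
  refine ⟨p, hp, ?_, hsum⟩
  rw [EReal.coe_lt_coe_iff] at hlt
  rwa [one_div_lt hp hs]

theorem CardLogBound.summable_of_lt_decay (h : CardLogBound γ) (hκ : 0 < k a a) {s B : ℝ}
    (hs : 0 < s) (hd : ((1 / s : ℝ) : EReal) < decay k γ a) (hB : 0 < B) :
    Summable fun u : Finset ℕ => B ^ u.card * (γ u : ℝ) ^ s := by
  obtain ⟨p, -, hps, hp⟩ := exists_summable_of_lt_decay hs hd
  exact h.summable_pow_card_mul_rpow hκ hps hs hp hB

/-- The last two inequalities are the form in which admissibility is used: they make the series in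
`γ_u^{1-α}` (error) and in `γ_u^{α/τ'}` (cost) converge. -/
theorem Admissible.exponents {τ τ' α : ℝ} (h : Admissible k γ a τ τ' α) :
    0 < τ' ∧ τ' ≤ τ ∧ 0 < α ∧ α < 1 ∧ ((1 / (1 - α) : ℝ) : EReal) < decay k γ a ∧
      ((1 / (α / τ') : ℝ) : EReal) < decay k γ a := by
  obtain ⟨h1, h2, h3, -, h5, h6⟩ := h
  refine ⟨h1, h2, ?_⟩
  generalize decay k γ a = d at *
  induction d with
  | bot => simp at h3
  | top =>
    simp only [EReal.div_top, sub_zero] at h5 h6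
    have h5' : 0 < α := by exact_mod_cast h5
    have h6' : α < 1 := by exact_mod_cast h6
    exact ⟨h5', h6', EReal.coe_lt_top _, EReal.coe_lt_top _⟩
  | coe d =>
    have h3' : τ' < d - 1 := by exact_mod_cast h3
    have hd : 0 < d := by linarith
    have h5' : τ' / d < α := by
      rw [← EReal.coe_div] at h5; exact_mod_cast h5
    have h6' : α < 1 - 1 / d := by
      rw [← EReal.coe_one, ← EReal.coe_div] at h6; exact_mod_cast h6
    have hα : 0 < α := lt_trans (by positivity) h5'
    have hd1 : 0 < 1 / d := by positivity
    refine ⟨hα, by linarith, ?_, ?_⟩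
    · rw [EReal.coe_lt_coe_iff, one_div_lt (by linarith) hd]; linarith
    · rw [EReal.coe_lt_coe_iff, one_div_div, div_lt_iff₀ hα]
      rwa [div_lt_iff₀ hd, mul_comm] at h5'

/-- Take `τ' = τ` if this is permitted, and otherwise a number between `max {m, 0}` and `decay_γ -
1`. The interval for `α` is nonempty because `τ' < decay_γ - 1`. -/
theorem exists_admissible {τ m : ℝ} (hτ : 0 < τ) (hm : (m : EReal) < min (τ : EReal) (decay k γ a - 1))
    (hd : 1 < decay k γ a) : ∃ τ' α : ℝ, Admissible k γ a τ τ' α ∧ m ≤ τ' := by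
  generalize hdd : decay k γ a = d at *
  have key : ∃ τ' : ℝ, 0 < τ' ∧ τ' ≤ τ ∧ (τ' : EReal) < d - 1 ∧
      ((τ : EReal) < d - 1 → τ' = τ) ∧ m ≤ τ' := by
    have hm1 : m < τ := by exact_mod_cast (lt_min_iff.1 hm).1
    by_cases hτd : (τ : EReal) < d - 1
    · exact ⟨τ, hτ, le_rfl, hτd, fun _ => rfl, hm1.le⟩
    · have h0 : (0 : EReal) < d - 1 := by
        induction d with
        | bot => simp at hd
        | top => rw [← EReal.coe_one, EReal.top_sub_coe]; exact EReal.coe_lt_top 0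
        | coe d =>
          have : 1 < d := by exact_mod_cast hd
          have : 0 < d - 1 := by linarith
          exact_mod_cast this
      obtain ⟨t, ht1, ht2⟩ := EReal.exists_between_coe_real (max_lt (lt_min_iff.1 hm).2 h0)
      refine ⟨t, ?_, ?_, ht2, fun h => absurd h hτd, ?_⟩
      · exact_mod_cast (max_lt_iff.1 ht1).2
      · have := ht2.trans_le (not_lt.1 hτd)
        exact_mod_cast this.le
      · exact_mod_cast (max_lt_iff.1 ht1).1.le
  obtain ⟨τ', h1, h2, h3, h4, h5⟩ := key
  have hα : (τ' : EReal) / d < 1 - 1 / d := by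
    induction d with
    | bot => simp at hd
    | top => simp
    | coe d =>
      have h3' : τ' < d - 1 := by exact_mod_cast h3
      have hd0 : 0 < d := by linarith
      rw [← EReal.coe_one, ← EReal.coe_div, ← EReal.coe_div, ← EReal.coe_sub, EReal.coe_lt_coe_iff,
        div_lt_iff₀ hd0, sub_mul, div_mul_cancel₀ _ hd0.ne']
      linarith
  obtain ⟨α, hα1, hα2⟩ := EReal.exists_between_coe_real hα
  exact ⟨τ', α, ⟨h1, h2, hdd ▸ h3, hdd ▸ h4, hdd ▸ hα1, hdd ▸ hα2⟩, h5⟩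

end Decay

end

end InfDimInt

namespace InfDimInt

noncomputable section

/-! ### The numbers of sample points of the changing dimension algorithms -/

section Points

variable {S : Type} {k : ReproducingKernel S} {γ : Finset ℕ → ℝ≥0} {a : S} {c C τ' α ε : ℝ}

theorem cHat_pos (hκ : 0 < k a a) : 0 < cHat k a C :=
  lt_max_of_lt_right (by positivity)

/-- The real number `c L_{1-α} Ĉ^{|u|} γ_u^α`. -/
def realImportance (k : ReproducingKernel S) (γ : Finset ℕ → ℝ≥0) (a : S) (c C α : ℝ)
    (u : Finset ℕ) : ℝ :=
  c * (weightSum γ α).toReal * (cHat k a C ^ u.card * (γ u : ℝ) ^ α)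

theorem realImportance_nonneg (hκ : 0 < k a a) (hc : 0 < c) (u : Finset ℕ) :
    0 ≤ realImportance k γ a c C α u := by
  have := cHat_pos (C := C) hκ
  unfold realImportance
  positivity

theorem importance_eq_ofReal (hκ : 0 < k a a) (hc : 0 < c) (hα : 0 ≤ α)
    (hW : weightSum γ α ≠ ∞) (u : Finset ℕ) :
    importance k γ a c C α u = ENNReal.ofReal (realImportance k γ a c C α u) := by
  have h1 := cHat_pos (C := C) hκ
  rw [importance, realImportance, ENNReal.ofReal_mul (by positivity), ENNReal.ofReal_mul hc.le,
    ENNReal.ofReal_toReal hW, ENNReal.ofReal_mul (by positivity), ENNReal.ofReal_pow h1.le,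
    ← ENNReal.ofReal_rpow_of_nonneg (NNReal.coe_nonneg _) hα, ENNReal.ofReal_coe_nnreal, mul_assoc]

theorem one_le_prePoints_iff (hε : 0 < ε) (hτ' : 0 < τ') (u : Finset ℕ) :
    1 ≤ prePoints k γ a c C τ' α ε u ↔ ENNReal.ofReal (ε ^ 2) ≤ importance k γ a c C α u := by
  have h0 : ENNReal.ofReal (ε ^ 2) ≠ 0 := by
    rw [Ne, ENNReal.ofReal_eq_zero, not_le]; positivity
  rw [prePoints]
  split_ifs with h
  · simpa using h
  · rw [not_lt] at h
    refine iff_of_true ?_ h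
    rw [ENat.le_floor, ENat.toENNReal_one]
    refine ENNReal.one_le_rpow ?_ (by positivity)
    rwa [ENNReal.le_div_iff_mul_le (Or.inl h0) (Or.inl ENNReal.ofReal_ne_top), one_mul]

theorem mem_activeSets_iff (hε : 0 < ε) (hτ' : 0 < τ') {u : Finset ℕ} :
    u ∈ activeSets k γ a c C τ' α ε ↔
      u = ∅ ∨ ∃ v, u ⊆ v ∧ ENNReal.ofReal (ε ^ 2) ≤ importance k γ a c C α v := by
  simp only [activeSets, Set.mem_ofPred_eq, numPoints]
  split_ifs with h1 h2
  · simp [h1]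
  all_goals
    simp only [one_le_prePoints_iff hε hτ'] at h2
    simpa [h1] using h2

theorem mem_activeSets_iff_real (hκ : 0 < k a a) (hc : 0 < c) (hα : 0 ≤ α)
    (hW : weightSum γ α ≠ ∞) (hε : 0 < ε) (hτ' : 0 < τ') {u : Finset ℕ} :
    u ∈ activeSets k γ a c C τ' α ε ↔
      u = ∅ ∨ ∃ v, u ⊆ v ∧ ε ^ 2 ≤ realImportance k γ a c C α v := by
  rw [mem_activeSets_iff hε hτ']
  simp only [importance_eq_ofReal hκ hc hα hW,
    ENNReal.ofReal_le_ofReal_iff (realImportance_nonneg hκ hc _)]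

theorem prePoints_le (hκ : 0 < k a a) (hc : 0 < c) (hα : 0 ≤ α)
    (hW : weightSum γ α ≠ ∞) (hε : 0 < ε) (hτ' : 0 < τ') (u : Finset ℕ) :
    (prePoints k γ a c C τ' α ε u : ℝ≥0∞) ≤
      ENNReal.ofReal ((realImportance k γ a c C α u / ε ^ 2) ^ (1 / τ')) := by
  have h1 := realImportance_nonneg (γ := γ) (C := C) (α := α) hκ hc u
  rw [prePoints]
  split_ifs with h
  · simp
  · refine ENat.floor_le_self.trans (le_of_eq ?_)
    rw [importance_eq_ofReal hκ hc hα hW, ← ENNReal.ofReal_div_of_pos (by positivity),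
      ENNReal.ofReal_rpow_of_nonneg (by positivity) (by positivity)]

/-- Below the threshold the left side is at most 1, and above it rounding down loses at most 1. This
matches the `n + 1` in (A7). -/
theorem le_prePoints_add_one (hκ : 0 < k a a) (hc : 0 < c) (hα : 0 ≤ α)
    (hW : weightSum γ α ≠ ∞) (hε : 0 < ε) (hτ' : 0 < τ') (u : Finset ℕ) :
    ENNReal.ofReal ((realImportance k γ a c C α u / ε ^ 2) ^ (1 / τ')) ≤
      prePoints k γ a c C τ' α ε u + 1 := by
  have h1 := realImportance_nonneg (γ := γ) (C := C) (α := α) hκ hc u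
  rw [prePoints]
  split_ifs with h
  · rw [importance_eq_ofReal hκ hc hα hW, ENNReal.ofReal_lt_ofReal_iff (by positivity)] at h
    rw [ENat.toENNReal_zero, zero_add, ENNReal.ofReal_le_one]
    exact Real.rpow_le_one (by positivity) ((div_le_one (by positivity)).2 h.le) (by positivity)
  · rw [importance_eq_ofReal hκ hc hα hW, ← ENNReal.ofReal_div_of_pos (by positivity),
      ENNReal.ofReal_rpow_of_nonneg (by positivity) (by positivity)]
    generalize hx : ENNReal.ofReal ((realImportance k γ a c C α u / ε ^ 2) ^ (1 / τ')) = x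
    have hx' : ⌊x⌋ₑ ≠ ⊤ := by rw [Ne, ENat.floor_eq_top, ← hx]; exact ENNReal.ofReal_ne_top
    have := ENat.floor_lt.1 (ENat.lt_add_one_iff hx' |>.2 le_rfl)
    simpa using this.le

/-- The number of sample points, as a natural number. -/
def natPoints (k : ReproducingKernel S) (γ : Finset ℕ → ℝ≥0) (a : S) (c C τ' α ε : ℝ)
    (u : Finset ℕ) : ℕ :=
  (numPoints k γ a c C τ' α ε u).toNat

theorem numPoints_le (u : Finset ℕ) :
    numPoints k γ a c C τ' α ε u ≤ max 1 (prePoints k γ a c C τ' α ε u) := by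
  rw [numPoints]
  split_ifs <;> simp

theorem numPoints_eq_natPoints (hκ : 0 < k a a) (hc : 0 < c) (hα : 0 ≤ α)
    (hW : weightSum γ α ≠ ∞) (hε : 0 < ε) (hτ' : 0 < τ') (u : Finset ℕ) :
    numPoints k γ a c C τ' α ε u = natPoints k γ a c C τ' α ε u := by
  have h : prePoints k γ a c C τ' α ε u ≠ ⊤ := by
    intro h
    have := prePoints_le (C := C) hκ hc hα hW hε hτ' u
    rw [h, ENat.toENNReal_top, top_le_iff] at this
    exact ENNReal.ofReal_ne_top this
  refine (ENat.natCast_toNat (ne_top_of_le_ne_top ?_ (numPoints_le u))).symm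
  exact max_ne_top (by simp) h

theorem natPoints_le (hκ : 0 < k a a) (hc : 0 < c) (hα : 0 ≤ α)
    (hW : weightSum γ α ≠ ∞) (hε : 0 < ε) (hτ' : 0 < τ') (u : Finset ℕ) :
    (natPoints k γ a c C τ' α ε u : ℝ) ≤
      1 + (realImportance k γ a c C α u / ε ^ 2) ^ (1 / τ') := by
  have h0 := realImportance_nonneg (γ := γ) (C := C) (α := α) hκ hc u
  have h0' : 0 ≤ (realImportance k γ a c C α u / ε ^ 2) ^ (1 / τ') := by positivity
  have h1 := numPoints_le (k := k) (γ := γ) (a := a) (c := c) (C := C) (τ' := τ') (α := α)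
    (ε := ε) u
  rw [numPoints_eq_natPoints hκ hc hα hW hε hτ'] at h1
  have h2 : ((natPoints k γ a c C τ' α ε u : ℕ∞) : ℝ≥0∞) ≤
      ENNReal.ofReal (1 + (realImportance k γ a c C α u / ε ^ 2) ^ (1 / τ')) := by
    refine (ENat.toENNReal_mono h1).trans ?_
    rcases max_choice 1 (prePoints k γ a c C τ' α ε u) with h | h
    · rw [h, ENat.toENNReal_one, ENNReal.one_le_ofReal]; linarith
    · rw [h]
      exact (prePoints_le hκ hc hα hW hε hτ' u).trans (ENNReal.ofReal_le_ofReal (by linarith))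
  rw [ENat.toENNReal_coe, ENNReal.le_ofReal_iff_toReal_le (by simp) (by positivity)] at h2
  simpa using h2

theorem natPoints_pos {u : Finset ℕ} (hκ : 0 < k a a) (hc : 0 < c) (hα : 0 ≤ α)
    (hW : weightSum γ α ≠ ∞) (hε : 0 < ε) (hτ' : 0 < τ')
    (hu : u ∈ activeSets k γ a c C τ' α ε) : 0 < natPoints k γ a c C τ' α ε u := by
  rw [activeSets, Set.mem_ofPred_eq, numPoints_eq_natPoints hκ hc hα hW hε hτ'] at hu
  exact_mod_cast hu

theorem le_natPoints_add_one {u : Finset ℕ} (hκ : 0 < k a a) (hc : 0 < c) (hα : 0 ≤ α)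
    (hW : weightSum γ α ≠ ∞) (hε : 0 < ε) (hτ' : 0 < τ')
    (hu : u ∈ activeSets k γ a c C τ' α ε) (hu0 : u ≠ ∅) :
    (realImportance k γ a c C α u / ε ^ 2) ^ (1 / τ') ≤ natPoints k γ a c C τ' α ε u + 1 := by
  have h1 : prePoints k γ a c C τ' α ε u ≤ natPoints k γ a c C τ' α ε u := by
    rw [← numPoints_eq_natPoints hκ hc hα hW hε hτ']
    rw [activeSets, Set.mem_ofPred_eq] at hu
    revert hu
    rw [numPoints, if_neg hu0]
    split_ifs <;> simp
  have h2 := (le_prePoints_add_one (C := C) hκ hc hα hW hε hτ' u).trans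
    (add_le_add_left (ENat.toENNReal_mono h1) 1)
  rw [ENat.toENNReal_coe, ENNReal.ofReal_le_iff_le_toReal (by simp)] at h2
  simpa [ENNReal.toReal_add] using h2

end Points

end

end InfDimInt

namespace InfDimInt

noncomputable section

/-! ### From the growth of `d(ε)` to the order of the weights. -/

section Weights

variable {S : Type} {k : ReproducingKernel S} {γ : Finset ℕ → ℝ≥0} {a : S} {c C τ' α : ℝ}

theorem weightSum_ne_top_of_summable (hα1 : α ≤ 1)
    (h : Summable fun u : Finset ℕ => (γ u : ℝ) ^ (1 - α)) : weightSum γ α ≠ ∞ := by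
  have h1 : weightSum γ α = ∑' u : {u : Finset ℕ // u.Nonempty},
      ENNReal.ofReal ((γ u.1 : ℝ) ^ (1 - α)) := by
    refine tsum_congr fun u => ?_
    rw [← ENNReal.ofReal_rpow_of_nonneg (NNReal.coe_nonneg _) (by linarith),
      ENNReal.ofReal_coe_nnreal]
  rw [h1]
  exact (h.subtype _).tsum_ofReal_ne_top

theorem rpow_le_weightSum (hα1 : α ≤ 1) (hW : weightSum γ α ≠ ∞) {u : Finset ℕ}
    (hu : u.Nonempty) : (γ u : ℝ) ^ (1 - α) ≤ (weightSum γ α).toReal := by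
  have h1 : ENNReal.ofReal ((γ u : ℝ) ^ (1 - α)) ≤ weightSum γ α := by
    rw [← ENNReal.ofReal_rpow_of_nonneg (NNReal.coe_nonneg _) (by linarith),
      ENNReal.ofReal_coe_nnreal]
    exact ENNReal.le_tsum (f := fun u : {u : Finset ℕ // u.Nonempty} =>
      (γ u.1 : ℝ≥0∞) ^ (1 - α)) ⟨u, hu⟩
  exact (ENNReal.ofReal_le_iff_le_toReal hW).1 h1

theorem card_le_of_epsDim_le {ε x : ℝ} (hx : 0 ≤ x)
    (h : (epsDim k γ a c C τ' α ε : ℝ≥0∞) ≤ ENNReal.ofReal x) {u : Finset ℕ}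
    (hu : u ∈ activeSets k γ a c C τ' α ε) : (u.card : ℝ) ≤ x := by
  have h1 : (u.card : ℕ∞) ≤ epsDim k γ a c C τ' α ε :=
    le_iSup₂ (f := fun u (_ : u ∈ activeSets k γ a c C τ' α ε) => (u.card : ℕ∞)) u hu
  have h2 := (ENat.toENNReal_mono h1).trans h
  rw [ENat.toENNReal_coe, ENNReal.le_ofReal_iff_toReal_le (by simp) hx] at h2
  simpa using h2

/-- If the dimensions `d(ε)` of the changing dimension algorithms grow slower than every multiple
of `ln (1 / ε)`, then the order of the weights grows slower than every multiple of
`ln (1 / γ_u)`. -/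
theorem cardLogBound_of_epsDim (hκ : 0 < k a a)
    (ha : Summable fun u : Finset ℕ => (γ u : ℝ) * k a a ^ u.card) (hc : 0 < c) (hτ' : 0 < τ')
    (hα0 : 0 < α) (hα1 : α < 1)
    (hd : ∀ η : ℝ, 0 < η → ∀ᶠ ε in 𝓝[>] (0 : ℝ),
      (epsDim k γ a c C τ' α ε : ℝ≥0∞) ≤ ENNReal.ofReal (η * Real.log (1 / ε))) :
    CardLogBound γ := by
  have hĈ := cHat_pos (C := C) hκ
  have hd' : ∀ η : ℝ, 0 < η → ∃ ε₀ : ℝ, 0 < ε₀ ∧ ε₀ < 1 ∧ ∀ ε, 0 < ε → ε ≤ ε₀ →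
      ∀ u ∈ activeSets k γ a c C τ' α ε, (u.card : ℝ) ≤ η * -Real.log ε := by
    intro η hη
    obtain ⟨ε₁, hε₁, hsub⟩ := mem_nhdsGT_iff_exists_Ioo_subset.1 (hd η hη)
    rw [Set.mem_Ioi] at hε₁
    refine ⟨min ε₁ 1 / 2, by positivity, ?_, fun ε hε hle u hu => ?_⟩
    · linarith [min_le_right ε₁ 1]
    · have h1 : ε < min ε₁ 1 := by
        have : 0 < min ε₁ 1 := by positivity
        linarith
      have h2 : 0 ≤ -Real.log ε := by
        have := Real.log_nonpos hε.le (h1.le.trans (min_le_right _ _))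
        linarith
      have h3 := hsub ⟨hε, h1.trans_le (min_le_left _ _)⟩
      simp only [Set.mem_ofPred_eq, one_div, Real.log_inv] at h3
      exact card_le_of_epsDim_le (by positivity) h3 hu
  by_cases hW : weightSum γ α = ∞
  -- If `L = ∞`, every `u` with `γ_u > 0` is active at a fixed `ε`, so the orders are bounded by
  -- some `D`. The summability at the anchor then bounds the weights by some `Γ`, and `D + η ln Γ`
  -- serves as the constant.
  · obtain ⟨ε, hε, -, h⟩ := hd' 1 one_pos
    have h1 : ∀ u, 0 < γ u → (u.card : ℝ) ≤ 1 * -Real.log ε := by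
      intro u hu
      refine h ε hε le_rfl u ((mem_activeSets_iff hε hτ').2 (Or.inr ⟨u, subset_rfl, ?_⟩))
      have h2 : importance k γ a c C α u = ∞ := by
        have h3 : ENNReal.ofReal c ≠ 0 := by simpa using hc
        have h4 : ENNReal.ofReal (cHat k a C) ^ u.card ≠ 0 := pow_ne_zero _ (by simpa using hĈ)
        have h5 : (γ u : ℝ≥0∞) ^ α ≠ 0 := by
          rw [Ne, ENNReal.rpow_eq_zero_iff]
          simp [hu.ne']
        rw [importance, hW, ENNReal.mul_top h3, ENNReal.top_mul h4, ENNReal.top_mul h5]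
      rw [h2]; exact le_top
    set D := 1 * -Real.log ε
    set Γ := (∑' u : Finset ℕ, (γ u : ℝ) * k a a ^ u.card) * (max 1 (k a a)⁻¹) ^ D with hΓ
    have hΓu : ∀ u, 0 < γ u → (γ u : ℝ) ≤ Γ := by
      intro u hu
      have h2 : (γ u : ℝ) * k a a ^ u.card ≤ ∑' u : Finset ℕ, (γ u : ℝ) * k a a ^ u.card :=
        ha.le_tsum u fun v _ => by positivity
      have h3 : ((k a a)⁻¹) ^ u.card ≤ (max 1 (k a a)⁻¹) ^ D := by
        calc ((k a a)⁻¹) ^ u.card ≤ (max 1 (k a a)⁻¹) ^ u.card := by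
              gcongr; exact le_max_right _ _
          _ = (max 1 (k a a)⁻¹) ^ (u.card : ℝ) := (Real.rpow_natCast _ _).symm
          _ ≤ _ := Real.rpow_le_rpow_of_exponent_le (le_max_left _ _) (h1 u hu)
      calc (γ u : ℝ) = (γ u : ℝ) * k a a ^ u.card * ((k a a)⁻¹) ^ u.card := by
            rw [mul_assoc, ← mul_pow, mul_inv_cancel₀ hκ.ne', one_pow, mul_one]
        _ ≤ Γ := by
            rw [hΓ]
            gcongr
    intro η hη
    refine ⟨D + η * Real.log Γ, fun u hu => ?_⟩
    have hu' : (0 : ℝ) < γ u := hu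
    have h4 := Real.log_le_log hu' (hΓu u hu)
    have h5 := h1 u hu
    nlinarith
  · set W := (weightSum γ α).toReal with hWdef
    have hΛ : ∃ Λ : ℝ, ∀ u, 0 < γ u → Real.log (γ u) ≤ Λ := by
      refine ⟨max (Real.log (γ ∅)) (Real.log W / (1 - α)), fun u hu => ?_⟩
      rcases u.eq_empty_or_nonempty with rfl | hne
      · exact le_max_left _ _
      · refine le_trans ?_ (le_max_right _ _)
        have hu' : (0 : ℝ) < γ u := hu
        rw [le_div_iff₀ (by linarith), mul_comm, ← Real.log_rpow hu']
        exact Real.log_le_log (by positivity) (rpow_le_weightSum hα1.le hW hne)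
    obtain ⟨Λ₀, hΛ₀⟩ := hΛ
    obtain ⟨Λ, hΛ0, hΛ⟩ : ∃ Λ : ℝ, 0 ≤ Λ ∧ ∀ u, 0 < γ u → Real.log (γ u) ≤ Λ :=
      ⟨max Λ₀ 0, le_max_right _ _, fun u hu => (hΛ₀ u hu).trans (le_max_left _ _)⟩
    intro η hη
    set l := |Real.log (cHat k a C)| with hl
    -- The first bound gives the slope `η` in front of `-ln γ_u`. The second gives `η' l ≤ 1`, so
    -- that half of `|u|` can be moved from the right side to the left at the end.
    set η' := min (η / α) (1 / (l + 1)) with hη'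
    have hl0 : 0 ≤ l := abs_nonneg _
    have hη'0 : 0 < η' := by positivity
    obtain ⟨ε₀, hε₀, hε₀1, h⟩ := hd' η' hη'0
    set A := -Real.log ε₀ with hA
    have hA0 : 0 ≤ A := by have := Real.log_nonpos hε₀.le hε₀1.le; linarith
    set B := |Real.log (c * W)| with hB
    refine ⟨η' * (2 * A + B + 2 * α * Λ) + η * Λ, fun u hu => ?_⟩
    have hu' : (0 : ℝ) < γ u := hu
    have hΛu := hΛ u hu
    have h0 : 0 ≤ η' * (2 * A + B + 2 * α * Λ) := by positivity
    have hη'α : η' * α ≤ η := by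
      calc η' * α ≤ η / α * α := by gcongr; exact min_le_left _ _
        _ = η := by field_simp
    have hη'l : η' * l ≤ 1 := by
      calc η' * l ≤ 1 / (l + 1) * (l + 1) := by
            gcongr
            · exact min_le_right _ _
            · linarith
        _ = 1 := by field_simp
    rcases u.eq_empty_or_nonempty with rfl | hne
    · simp only [Finset.card_empty, Nat.cast_zero]
      nlinarith
    have hWpos : 0 < W := lt_of_lt_of_le (by positivity) (rpow_le_weightSum hα1.le hW hne)
    set r := realImportance k γ a c C α u with hr
    have hrpos : 0 < r := by rw [hr, realImportance]; positivity
    have hlogr : |Real.log r| ≤ B + u.card * l + α * (2 * Λ - Real.log (γ u)) := by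
      have h1 : Real.log r = Real.log (c * W) + (u.card * Real.log (cHat k a C)
          + α * Real.log (γ u)) := by
        rw [hr, realImportance, Real.log_mul (by positivity) (by positivity),
          Real.log_mul (pow_pos hĈ _).ne' (Real.rpow_pos_of_pos hu' α).ne', Real.log_pow,
          Real.log_rpow hu']
      have h2 : |Real.log (γ u)| ≤ 2 * Λ - Real.log (γ u) := by
        rw [abs_le]; constructor <;> linarith
      rw [h1]
      calc |Real.log (c * W) + (u.card * Real.log (cHat k a C) + α * Real.log (γ u))|
          ≤ |Real.log (c * W)| + (|u.card * Real.log (cHat k a C)| + |α * Real.log (γ u)|) :=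
            (abs_add_le _ _).trans (by gcongr; exact abs_add_le _ _)
        _ = B + (u.card * l + α * |Real.log (γ u)|) := by
            rw [abs_mul, abs_mul, abs_of_pos hα0, Nat.abs_cast]
        _ ≤ _ := by
            rw [add_assoc]
            gcongr
    -- Evaluate the bound on `d` at `ε = √r`, the largest `ε` at which `u` itself is important, or
    -- at `ε₀` if `√r` exceeds it.
    have hmain : (u.card : ℝ) ≤ η' * (A + 1 / 2 * |Real.log r|) := by
      have hact : ∀ ε, 0 < ε → ε ^ 2 ≤ r → u ∈ activeSets k γ a c C τ' α ε := fun ε hε hle =>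
        (mem_activeSets_iff_real hκ hc hα0.le hW hε hτ').2 (Or.inr ⟨u, subset_rfl, hle⟩)
      rcases le_total ε₀ (√r) with hle | hle
      · have h1 := h ε₀ hε₀ le_rfl u (hact ε₀ hε₀ ((Real.le_sqrt' hε₀).1 hle))
        refine h1.trans ?_
        gcongr
        linarith [abs_nonneg (Real.log r)]
      · have h1 := h (√r) (Real.sqrt_pos.2 hrpos) hle u
          (hact _ (Real.sqrt_pos.2 hrpos) (Real.sq_sqrt hrpos.le).le)
        refine h1.trans ?_
        gcongr
        rw [Real.log_sqrt hrpos.le]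
        linarith [neg_abs_le (Real.log r)]
    have h2 : (u.card : ℝ) ≤
        η' * (A + 1 / 2 * (B + u.card * l + α * (2 * Λ - Real.log (γ u)))) :=
      hmain.trans (by gcongr)
    have h3 : η' * l * u.card ≤ 1 * u.card := by gcongr
    have h4 : η' * α * (Λ - Real.log (γ u)) ≤ η * (Λ - Real.log (γ u)) := by
      gcongr
    have h5 : 0 ≤ η' * α * Λ := by positivity
    nlinarith

end Weights

/-! ### Bounds for the important sets and the numbers of points -/

/-- From `ln y ≤ θy - 1 - ln θ` with `y = 1 + x/m`, `x = ln(n+1)`, `m = (|w|-1)^{α₂}`: after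
multiplication by `α₁ m` the `x` term no longer contains `m`, and `m ≤ |w|` since `α₂ ≤ 1`. Thus
`F_w(n)` is a small power of `n + 1` times an exponential in `|w|`. -/
theorem growth_le {α₁ α₂ θ : ℝ} (hα₁ : 0 ≤ α₁) (hα₂ : α₂ ∈ Set.Icc (0 : ℝ) 1) (hθ0 : 0 < θ)
    (hθ1 : θ ≤ 1) (w : Finset ℕ) (n : ℕ) :
    growth α₁ α₂ w n ≤ ((n : ℝ) + 1) ^ (α₁ * θ) * (θ ^ (-α₁)) ^ w.card := by
  have hB : 1 ≤ θ ^ (-α₁) := Real.one_le_rpow_of_pos_of_le_one_of_nonpos hθ0 hθ1 (by linarith)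
  have hn : (1 : ℝ) ≤ (n : ℝ) + 1 := by linarith [Nat.cast_nonneg (α := ℝ) n]
  rw [growth]
  split_ifs with hcard
  · exact one_le_mul_of_one_le_of_one_le (Real.one_le_rpow hn (by positivity)) (one_le_pow₀ hB)
  · have h1 : (1 : ℝ) ≤ (w.card : ℝ) - 1 := by
      have : (2 : ℝ) ≤ w.card := by exact_mod_cast not_le.1 hcard
      linarith
    set m := ((w.card : ℝ) - 1) ^ α₂ with hm
    have hm1 : 1 ≤ m := Real.one_le_rpow h1 hα₂.1
    have hmw : m ≤ w.card := by
      calc m ≤ ((w.card : ℝ) - 1) ^ (1 : ℝ) := Real.rpow_le_rpow_of_exponent_le h1 hα₂.2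
        _ ≤ w.card := by rw [Real.rpow_one]; linarith
    set x := Real.log ((n : ℝ) + 1) with hx
    have hx0 : 0 ≤ x := Real.log_nonneg hn
    have hlog : Real.log (1 + x / m) ≤ θ * (x / m) - Real.log θ := by
      have h2 : 0 < 1 + x / m := by positivity
      have h3 := Real.log_le_sub_one_of_pos (mul_pos hθ0 h2)
      rw [Real.log_mul hθ0.ne' h2.ne'] at h3
      linarith
    have hθlog : Real.log θ ≤ 0 := Real.log_nonpos hθ0.le hθ1
    rw [Real.rpow_def_of_pos (by positivity), Real.rpow_def_of_pos (by positivity),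
      ← Real.rpow_natCast, ← Real.rpow_mul hθ0.le, Real.rpow_def_of_pos hθ0, ← Real.exp_add]
    refine Real.exp_le_exp.2 ?_
    calc Real.log (1 + x / m) * (α₁ * m) ≤ (θ * (x / m) - Real.log θ) * (α₁ * m) := by gcongr
      _ = x * (α₁ * θ) + α₁ * (-Real.log θ) * m := by field_simp; ring
      _ ≤ x * (α₁ * θ) + α₁ * (-Real.log θ) * w.card := by
          have : 0 ≤ α₁ * (-Real.log θ) := mul_nonneg hα₁ (by linarith)
          gcongr
      _ = _ := by ring

end

end InfDimInt

namespace InfDimInt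

noncomputable section

section Bounds

variable {S : Type} {k : ReproducingKernel S} {γ : Finset ℕ → ℝ≥0} {a : S} {c C τ τ' α : ℝ}

theorem CardLogBound.weightSum_ne_top (h : CardLogBound γ) (hκ : 0 < k a a)
    (hadm : Admissible k γ a τ τ' α) : weightSum γ α ≠ ∞ := by
  obtain ⟨-, -, -, hα1, hd1, -⟩ := hadm.exponents
  refine weightSum_ne_top_of_summable hα1.le ?_
  simpa using h.summable_of_lt_decay hκ (sub_pos.2 hα1) hd1 one_pos

theorem CardLogBound.summable_pow_card_mul_importance (h : CardLogBound γ) (hκ : 0 < k a a)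
    (hc : 0 < c) (hadm : Admissible k γ a τ τ' α) {B : ℝ} (hB : 0 < B) :
    Summable fun u => B ^ u.card * realImportance k γ a c C α u ^ (1 / τ') := by
  obtain ⟨hτ', -, hα0, -, -, hd2⟩ := hadm.exponents
  have hĈ := cHat_pos (C := C) hκ
  have h1 := (h.summable_of_lt_decay hκ (div_pos hα0 hτ') hd2
    (B := B * cHat k a C ^ (1 / τ')) (by positivity)).mul_left
    ((c * (weightSum γ α).toReal) ^ (1 / τ'))
  refine h1.congr fun u => ?_
  have hw : 0 ≤ c * (weightSum γ α).toReal := by positivity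
  rw [realImportance]
  generalize c * (weightSum γ α).toReal = w at hw
  rw [Real.mul_rpow hw (by positivity),
    Real.mul_rpow (pow_nonneg hĈ.le _) (by positivity), ← Real.rpow_mul (NNReal.coe_nonneg _), mul_pow,
    ← Real.rpow_natCast (cHat k a C), ← Real.rpow_mul hĈ.le,
    ← Real.rpow_natCast (cHat k a C ^ (1 / τ')), ← Real.rpow_mul hĈ.le]
  ring_nf

/-- The terms of the convergent series of `r_v^{1/τ'}` tend to zero. -/
theorem CardLogBound.finite_important (h : CardLogBound γ) (hκ : 0 < k a a)
    (hc : 0 < c) (hadm : Admissible k γ a τ τ' α) {ε : ℝ} (hε : 0 < ε) :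
    {v | ε ^ 2 ≤ realImportance k γ a c C α v}.Finite := by
  obtain ⟨hτ', -, hα0, -, -, hd2⟩ := hadm.exponents
  have h1 := (h.summable_pow_card_mul_importance (C := C) hκ hc hadm one_pos).tendsto_cofinite_zero
  have h2 := h1.eventually (gt_mem_nhds (show (0 : ℝ) < (ε ^ 2) ^ (1 / τ') by positivity))
  rw [Filter.eventually_cofinite] at h2
  refine h2.subset fun v hv => ?_
  simp only [one_pow, one_mul, not_lt, Set.mem_ofPred_eq] at hv ⊢
  exact Real.rpow_le_rpow (by positivity) hv (by positivity)

theorem CardLogBound.finite_activeSets (h : CardLogBound γ) (hκ : 0 < k a a)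
    (hc : 0 < c) (hadm : Admissible k γ a τ τ' α) {ε : ℝ} (hε : 0 < ε) :
    (activeSets k γ a c C τ' α ε).Finite := by
  obtain ⟨hτ', -, hα0, -, -, -⟩ := hadm.exponents
  have h1 := (h.finite_important (C := C) hκ hc hadm hε).biUnion
    fun v _ => (v.powerset.finite_toSet)
  refine (h1.union (Set.finite_singleton ∅)).subset fun u hu => ?_
  rcases (mem_activeSets_iff_real hκ hc hα0.le (h.weightSum_ne_top hκ hadm) hε hτ').1 hu with
    rfl | ⟨v, huv, hv⟩
  · simp
  · exact Or.inl (Set.mem_biUnion (show v ∈ {v | ε ^ 2 ≤ realImportance k γ a c C α v} from hv)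
      (by simpa using huv))

theorem pos_of_le_realImportance (hα0 : 0 < α) {ε : ℝ} (hε : 0 < ε) {v : Finset ℕ}
    (hv : ε ^ 2 ≤ realImportance k γ a c C α v) : 0 < γ v := by
  refine pos_iff_ne_zero.2 fun h0 => ?_
  rw [realImportance, h0, NNReal.coe_zero, Real.zero_rpow hα0.ne', mul_zero, mul_zero] at hv
  exact absurd hv (not_le.2 (by positivity))

/-- Importance at level `ε²` bounds `γ_v` below by a power of `ε`: half of the exponent `α` absorbs
`Ĉ^{|v|}`, leaving `ε² ≤ const · γ_v^{α/2}`. Raising this to the power `η/2` explains the exponent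
`ηα/4`. -/
theorem CardLogBound.pow_card_le_of_important (h : CardLogBound γ) (hκ : 0 < k a a)
    (hc : 0 < c) (hα0 : 0 < α) {B η : ℝ} (hB : 0 < B) (hη : 0 < η) :
    ∃ K : ℝ, 0 < K ∧ ∀ ε : ℝ, 0 < ε → ∀ v, ε ^ 2 ≤ realImportance k γ a c C α v →
      B ^ v.card ≤ K * ε ^ (-η) := by
  have hĈ := cHat_pos (C := C) hκ
  obtain ⟨K₁, hK₁, h1⟩ := h.pow_card_le hB (show 0 < η * α / 4 by positivity)
  obtain ⟨K₂, hK₂, h2⟩ := h.pow_card_le hĈ (show 0 < α / 2 by positivity)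
  set w := c * (weightSum γ α).toReal + 1 with hw
  have hw0 : 0 < w := by positivity
  refine ⟨K₁ * (w * K₂) ^ (η / 2), by positivity, fun ε hε v hv => ?_⟩
  have hγv := pos_of_le_realImportance hα0 hε hv
  have hγv' : (0 : ℝ) < γ v := hγv
  have h3 : ε ^ 2 ≤ w * K₂ * (γ v : ℝ) ^ (α / 2) := by
    calc ε ^ 2 ≤ c * (weightSum γ α).toReal * (cHat k a C ^ v.card * (γ v : ℝ) ^ α) := hv
      _ ≤ w * (K₂ * (γ v : ℝ) ^ (-(α / 2)) * (γ v : ℝ) ^ α) := by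
          gcongr
          · linarith
          · exact h2 v hγv
      _ = _ := by rw [mul_assoc K₂, ← Real.rpow_add hγv']; ring_nf
  have h4 : (γ v : ℝ) ^ (-(η * α / 4)) ≤ (w * K₂) ^ (η / 2) * ε ^ (-η) := by
    have h5 : (ε ^ 2) ^ (η / 2) ≤ (w * K₂ * (γ v : ℝ) ^ (α / 2)) ^ (η / 2) :=
      Real.rpow_le_rpow (by positivity) h3 (by positivity)
    rw [Real.mul_rpow (by positivity) (by positivity), ← Real.rpow_mul hγv'.le,
      ← Real.rpow_natCast ε, ← Real.rpow_mul hε.le] at h5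
    rw [Real.rpow_neg hγv'.le, Real.rpow_neg hε.le, ← div_eq_mul_inv, le_div_iff₀ (by positivity),
      inv_mul_le_iff₀ (by positivity)]
    refine le_trans (le_of_eq ?_) (h5.trans (le_of_eq ?_))
    · congr 1; push_cast; ring
    · rw [mul_comm]; congr 2; ring
  calc B ^ v.card ≤ K₁ * (γ v : ℝ) ^ (-(η * α / 4)) := h1 v hγv
    _ ≤ K₁ * ((w * K₂) ^ (η / 2) * ε ^ (-η)) := by gcongr
    _ = _ := by ring

theorem div_sq_rpow {x ε : ℝ} (hx : 0 ≤ x) (hε : 0 < ε) (τ' : ℝ) :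
    (x / ε ^ 2) ^ (1 / τ') = x ^ (1 / τ') * ε ^ (-(2 / τ')) := by
  rw [Real.div_rpow hx (by positivity), ← Real.rpow_natCast, ← Real.rpow_mul hε.le,
    Real.rpow_neg hε.le, div_eq_mul_inv]
  congr 3
  push_cast
  ring

/-- The number of points, counted with factors that are exponential in the order. -/
theorem CardLogBound.sum_natPoints_le (h : CardLogBound γ) (hκ : 0 < k a a) (hc : 0 < c)
    (hadm : Admissible k γ a τ τ' α) {B : ℝ} (hB : 0 < B) :
    ∃ K : ℝ, 0 < K ∧ ∀ ε : ℝ, 0 < ε → ε < 1 → ∀ Q : Finset (Finset ℕ),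
      (∀ u ∈ Q, u ∈ activeSets k γ a c C τ' α ε) →
      ∑ u ∈ Q, natPoints k γ a c C τ' α ε u * B ^ u.card ≤ K * ε ^ (-(2 / τ')) := by
  obtain ⟨hτ', -, hα0, -, -, -⟩ := hadm.exponents
  have hW := h.weightSum_ne_top hκ hadm
  have hr := fun u => realImportance_nonneg (γ := γ) (C := C) (α := α) hκ hc u
  have hs1 := h.summable_pow_card_mul_importance (C := C) hκ hc hadm hB
  have hs2 := h.summable_pow_card_mul_importance (C := C) hκ hc hadm (B := 1 + B) (by positivity)
  set S₁ := ∑' u, B ^ u.card * realImportance k γ a c C α u ^ (1 / τ') with hS₁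
  set S₂ := ∑' u, (1 + B) ^ u.card * realImportance k γ a c C α u ^ (1 / τ') with hS₂
  have hS₁0 : 0 ≤ S₁ := tsum_nonneg fun u => by have := hr u; positivity
  have hS₂0 : 0 ≤ S₂ := tsum_nonneg fun u => by have := hr u; positivity
  refine ⟨S₁ + S₂ + 1, by positivity, fun ε hε hε1 Q hQ => ?_⟩
  have hE : 1 ≤ ε ^ (-(2 / τ')) :=
    Real.one_le_rpow_of_pos_of_le_one_of_nonpos hε hε1.le (by
      have : 0 < 2 / τ' := by positivity
      linarith)
  -- Split `n_u ≤ 1 + (r_u/ε²)^{1/τ'}`; the summand 1 is present because unimportant subsets of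
  -- important sets still receive a point.
  have h1 : ∑ u ∈ Q, natPoints k γ a c C τ' α ε u * B ^ u.card ≤
      ∑ u ∈ Q, B ^ u.card * realImportance k γ a c C α u ^ (1 / τ') * ε ^ (-(2 / τ'))
        + ∑ u ∈ Q, B ^ u.card := by
    rw [← Finset.sum_add_distrib]
    refine Finset.sum_le_sum fun u _ => ?_
    have := natPoints_le (C := C) hκ hc hα0.le hW hε hτ' u
    rw [div_sq_rpow (hr u) hε] at this
    calc (natPoints k γ a c C τ' α ε u : ℝ) * B ^ u.card
        ≤ (1 + realImportance k γ a c C α u ^ (1 / τ') * ε ^ (-(2 / τ'))) * B ^ u.card := by gcongr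
      _ = _ := by ring
  have h2 : ∑ u ∈ Q, B ^ u.card * realImportance k γ a c C α u ^ (1 / τ') * ε ^ (-(2 / τ'))
      ≤ S₁ * ε ^ (-(2 / τ')) := by
    rw [← Finset.sum_mul]
    gcongr
    exact hs1.sum_le_tsum Q fun u _ => by have := hr u; positivity
  -- Charge each nonempty active `u` to the important sets above it. The subsets of `v` contribute
  -- at most `(1 + B)^{|v|}`, and `1 ≤ (r_v/ε²)^{1/τ'}` for important `v`.
  have h3 : ∑ u ∈ Q, B ^ u.card ≤ 1 + S₂ * ε ^ (-(2 / τ')) := by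
    set V := (h.finite_important (C := C) hκ hc hadm hε).toFinset with hV
    have h4 : ∀ u ∈ Q, B ^ u.card ≤ (if u = ∅ then 1 else 0)
        + ∑ v ∈ V, if u ⊆ v then B ^ u.card else 0 := by
      intro u hu
      have hnn : 0 ≤ ∑ v ∈ V, if u ⊆ v then B ^ u.card else 0 :=
        Finset.sum_nonneg fun v _ => by split_ifs <;> positivity
      rcases (mem_activeSets_iff_real hκ hc hα0.le hW hε hτ').1 (hQ u hu) with rfl | ⟨v, huv, hv⟩
      · simp
      · have h5 : (if u ⊆ v then B ^ u.card else 0) ≤ ∑ v ∈ V, if u ⊆ v then B ^ u.card else 0 :=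
          Finset.single_le_sum (f := fun v => if u ⊆ v then B ^ u.card else 0)
            (fun v _ => by split_ifs <;> positivity) (by simpa [hV] using hv)
        rw [if_pos huv] at h5
        have h6 : (0 : ℝ) ≤ if u = ∅ then 1 else 0 := by split_ifs <;> norm_num
        linarith
    have h5 : ∑ v ∈ V, ∑ u ∈ Q, (if u ⊆ v then B ^ u.card else 0) ≤ ∑ v ∈ V, (1 + B) ^ v.card := by
      refine Finset.sum_le_sum fun v _ => ?_
      rw [← Finset.sum_filter]
      calc ∑ u ∈ Q with u ⊆ v, B ^ u.card ≤ ∑ u ∈ v.powerset, B ^ u.card :=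
            Finset.sum_le_sum_of_subset_of_nonneg
              (fun u hu => Finset.mem_powerset.2 (Finset.mem_filter.1 hu).2)
              fun _ _ _ => by positivity
        _ = (1 + B) ^ v.card := by
            have := Finset.sum_pow_mul_eq_add_pow B 1 v
            simpa [add_comm] using this
    have h6 : ∑ v ∈ V, (1 + B) ^ v.card ≤ S₂ * ε ^ (-(2 / τ')) := by
      calc ∑ v ∈ V, (1 + B) ^ v.card
          ≤ ∑ v ∈ V, (1 + B) ^ v.card * realImportance k γ a c C α v ^ (1 / τ')
            * ε ^ (-(2 / τ')) := by
            refine Finset.sum_le_sum fun v hv => ?_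
            have hv' : ε ^ 2 ≤ realImportance k γ a c C α v := by simpa [hV] using hv
            rw [mul_assoc, ← div_sq_rpow (hr v) hε]
            refine le_mul_of_one_le_right (by positivity) (Real.one_le_rpow ?_ (by positivity))
            rwa [one_le_div (by positivity)]
        _ ≤ _ := by
            rw [← Finset.sum_mul]
            gcongr
            exact hs2.sum_le_tsum V fun u _ => by have := hr u; positivity
    calc ∑ u ∈ Q, B ^ u.card ≤ ∑ u ∈ Q, ((if u = ∅ then 1 else 0)
        + ∑ v ∈ V, if u ⊆ v then B ^ u.card else 0) := Finset.sum_le_sum h4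
      _ ≤ 1 + S₂ * ε ^ (-(2 / τ')) := by
          rw [Finset.sum_add_distrib, Finset.sum_comm (s := Q)]
          refine add_le_add ?_ (h5.trans h6)
          rw [Finset.sum_ite_eq' Q ∅]
          split_ifs <;> norm_num
  nlinarith

theorem CardLogBound.exists_growth_le (h : CardLogBound γ) (hκ : 0 < k a a) (hc : 0 < c)
    (hadm : Admissible k γ a τ τ' α) {α₁ α₂ : ℝ} (hα₁ : 0 ≤ α₁) (hα₂ : α₂ ∈ Set.Icc (0 : ℝ) 1)
    {η : ℝ} (hη : 0 < η) :
    ∃ K : ℝ, 0 < K ∧ ∀ ε : ℝ, 0 < ε → ε < 1 → ∀ u ∈ activeSets k γ a c C τ' α ε, ∀ w ⊆ u,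
      growth α₁ α₂ w (natPoints k γ a c C τ' α ε u) ≤ K * ε ^ (-η) := by
  obtain ⟨hτ', -, hα0, -, -, -⟩ := hadm.exponents
  have hW := h.weightSum_ne_top hκ hadm
  have hr := fun u => realImportance_nonneg (γ := γ) (C := C) (α := α) hκ hc u
  obtain ⟨R, hR0, hR⟩ := h.exists_pow_card_mul_rpow_le (cHat_pos (C := C) hκ) hα0
  set R' := c * (weightSum γ α).toReal * R with hR'
  have hR'0 : 0 ≤ R' := by positivity
  have hrR : ∀ u, realImportance k γ a c C α u ≤ R' := fun u => by
    rw [realImportance, hR']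
    gcongr
    exact hR u
  -- Since `n_u + 1 = O(ε^{-2/τ'})`, this makes `(n_u + 1)^{α₁θ}` cost at most `ε^{-η/2}`; the other
  -- half of `η` pays for the exponential in `|w|`.
  set θ := min 1 (η * τ' / (4 * (α₁ + 1))) with hθ
  have hθ0 : 0 < θ := by positivity
  have hθ1 : θ ≤ 1 := min_le_left _ _
  have hB : 1 ≤ θ ^ (-α₁) := Real.one_le_rpow_of_pos_of_le_one_of_nonpos hθ0 hθ1 (by linarith)
  obtain ⟨K₂, hK₂0, hK₂⟩ := h.pow_card_le_of_important (C := C) hκ hc hα0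
    (show 0 < θ ^ (-α₁) by positivity) (half_pos hη)
  set K₁ := 2 + R' ^ (1 / τ') with hK₁
  have hK₁0 : 0 < K₁ := by positivity
  refine ⟨K₁ ^ (α₁ * θ) * (K₂ + 1), by positivity, fun ε hε hε1 u hu w hw => ?_⟩
  have hone : ∀ s : ℝ, 0 ≤ s → 1 ≤ ε ^ (-s) := fun s hs =>
    Real.one_le_rpow_of_pos_of_le_one_of_nonpos hε hε1.le (by linarith)
  have h1 : (natPoints k γ a c C τ' α ε u : ℝ) + 1 ≤ K₁ * ε ^ (-(2 / τ')) := by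
    have h2 := natPoints_le (C := C) hκ hc hα0.le hW hε hτ' u
    rw [div_sq_rpow (hr u) hε] at h2
    have h3 : realImportance k γ a c C α u ^ (1 / τ') ≤ R' ^ (1 / τ') :=
      Real.rpow_le_rpow (hr u) (hrR u) (by positivity)
    have h4 := hone (2 / τ') (by positivity)
    have h5 : realImportance k γ a c C α u ^ (1 / τ') * ε ^ (-(2 / τ'))
        ≤ R' ^ (1 / τ') * ε ^ (-(2 / τ')) := by gcongr
    rw [hK₁, add_mul]
    linarith
  have h2 : (θ ^ (-α₁)) ^ w.card ≤ (K₂ + 1) * ε ^ (-(η / 2)) := by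
    have h3 := hone (η / 2) (by positivity)
    rcases (mem_activeSets_iff_real hκ hc hα0.le hW hε hτ').1 hu with rfl | ⟨v, huv, hv⟩
    · rw [Finset.subset_empty.1 hw, Finset.card_empty, pow_zero]
      nlinarith
    · calc (θ ^ (-α₁)) ^ w.card ≤ (θ ^ (-α₁)) ^ v.card :=
            pow_le_pow_right₀ hB (Finset.card_le_card (hw.trans huv))
        _ ≤ K₂ * ε ^ (-(η / 2)) := hK₂ ε hε v hv
        _ ≤ _ := by gcongr; linarith
  have h3 : (ε ^ (-(2 / τ'))) ^ (α₁ * θ) ≤ ε ^ (-(η / 2)) := by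
    rw [← Real.rpow_mul hε.le]
    refine Real.rpow_le_rpow_of_exponent_ge hε hε1.le ?_
    have h4 : α₁ * θ ≤ η * τ' / 4 := by
      calc α₁ * θ ≤ (α₁ + 1) * (η * τ' / (4 * (α₁ + 1))) := by
            gcongr
            · linarith
            · exact min_le_right _ _
        _ = _ := by field_simp
    have h5 : 2 / τ' * (α₁ * θ) ≤ 2 / τ' * (η * τ' / 4) := by gcongr
    have h6 : 2 / τ' * (η * τ' / 4) = η / 2 := by field_simp; norm_num
    linarith
  calc growth α₁ α₂ w (natPoints k γ a c C τ' α ε u)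
      ≤ ((natPoints k γ a c C τ' α ε u : ℝ) + 1) ^ (α₁ * θ) * (θ ^ (-α₁)) ^ w.card :=
        growth_le hα₁ hα₂ hθ0 hθ1 w _
    _ ≤ (K₁ * ε ^ (-(2 / τ'))) ^ (α₁ * θ) * ((K₂ + 1) * ε ^ (-(η / 2))) := by
        gcongr
    _ = K₁ ^ (α₁ * θ) * (ε ^ (-(2 / τ'))) ^ (α₁ * θ) * ((K₂ + 1) * ε ^ (-(η / 2))) := by
        rw [Real.mul_rpow hK₁0.le (by positivity)]
    _ ≤ K₁ ^ (α₁ * θ) * ε ^ (-(η / 2)) * ((K₂ + 1) * ε ^ (-(η / 2))) := by gcongr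
    _ = K₁ ^ (α₁ * θ) * (K₂ + 1) * (ε ^ (-(η / 2)) * ε ^ (-(η / 2))) := by ring
    _ = _ := by rw [← Real.rpow_add hε]; ring_nf

/-- The error bounds of the changing dimension algorithms in terms of `ε`. -/
theorem CardLogBound.error_terms_le (h : CardLogBound γ) (hκ : 0 < k a a) (hc : 0 < c)
    (hC : 0 < C) (hadm : Admissible k γ a τ τ' α) {α₁ α₂ : ℝ} (hα₁ : 0 ≤ α₁)
    (hα₂ : α₂ ∈ Set.Icc (0 : ℝ) 1) {R : ℝ} (hR : ∀ u : Finset ℕ, rSq k γ a u u ≤ R * γ u)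
    {η : ℝ} (hη : 0 < η) :
    ∃ K : ℝ, 0 < K ∧ ∀ ε : ℝ, 0 < ε → ε < 1 → ∀ Q : Finset (Finset ℕ),
      (∀ u, u ∈ Q ↔ u ∈ activeSets k γ a c C τ' α ε) → ∃ G : ℝ,
      (∀ u ∈ Q, ∀ w ⊆ u, growth α₁ α₂ w (natPoints k γ a c C τ' α ε u) ≤ G) ∧
      (Summable fun w => if w ∈ Q then 0 else (γ w : ℝ) * (4 * k a a) ^ w.card) ∧
      (∑' w, if w ∈ Q then 0 else (γ w : ℝ) * (4 * k a a) ^ w.card) +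
        ∑ u ∈ Q.erase ∅, c * (2 * C * (1 + k a a)) ^ u.card *
          ((natPoints k γ a c C τ' α ε u : ℝ) + 1) ^ (-τ) * G * rSq k γ a u u
        ≤ K * ε ^ (2 - η) := by
  obtain ⟨hτ', hττ', hα0, hα1, hd1, -⟩ := hadm.exponents
  have hW := h.weightSum_ne_top hκ hadm
  have hĈ := cHat_pos (C := C) hκ
  have hr := fun u => realImportance_nonneg (γ := γ) (C := C) (α := α) hκ hc u
  obtain ⟨K₁, hK₁0, hK₁⟩ := h.exists_growth_le (C := C) hκ hc hadm hα₁ hα₂ hη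
  have hs1 : Summable fun u : Finset ℕ => (γ u : ℝ) ^ (1 - α) := by
    simpa using h.summable_of_lt_decay hκ (sub_pos.2 hα1) hd1 one_pos
  have hs2 := h.summable_of_lt_decay hκ (sub_pos.2 hα1) hd1 (B := 2) two_pos
  set w₀ := c * (weightSum γ α).toReal with hw₀
  have hw₀0 : 0 ≤ w₀ := by positivity
  -- The number `w₀` can vanish only if all nonempty sets have weight zero, and then their terms
  -- vanish too.
  have hw₀pos : ∀ u : Finset ℕ, u.Nonempty → 0 < γ u → 0 < w₀ := fun u hu hγu => by
    have h1 : (0 : ℝ) < γ u := hγu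
    have h2 := rpow_le_weightSum hα1.le hW hu
    have h3 : 0 < (γ u : ℝ) ^ (1 - α) := by positivity
    exact mul_pos hc (h3.trans_le h2)
  set S₁ := ∑' u : Finset ℕ, (γ u : ℝ) ^ (1 - α) with hS₁
  set S₂ := ∑' u : Finset ℕ, (2 : ℝ) ^ u.card * (γ u : ℝ) ^ (1 - α) with hS₂
  have hS₁0 : 0 ≤ S₁ := tsum_nonneg fun u => by positivity
  have hS₂0 : 0 ≤ S₂ := tsum_nonneg fun u => by positivity
  set R' := max R 0 with hR'
  have hR'0 : 0 ≤ R' := le_max_right _ _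
  have hRu : ∀ u : Finset ℕ, rSq k γ a u u ≤ R' * γ u := fun u =>
    (hR u).trans (mul_le_mul_of_nonneg_right (le_max_left _ _) (NNReal.coe_nonneg _))
  refine ⟨w₀⁻¹ * S₁ + c * R' * w₀⁻¹ * S₂ * K₁ + 1, by positivity, fun ε hε hε1 Q hQ => ?_⟩
  have hE : 1 ≤ ε ^ (-η) :=
    Real.one_le_rpow_of_pos_of_le_one_of_nonpos hε hε1.le (by linarith)
  have hE2 : ε ^ (2 - η) = ε ^ 2 * ε ^ (-η) := by
    rw [sub_eq_add_neg, Real.rpow_add hε, Real.rpow_two]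
  have hQ0 : ∅ ∈ Q := (hQ ∅).2 ((mem_activeSets_iff hε hτ').2 (Or.inl rfl))
  -- Split `γ_w = γ_w^α γ_w^{1-α}`: since `w` is not important, the first factor times `Ĉ^{|w|}` is
  -- below `ε² / w₀`.
  have hle1 : ∀ w, (if w ∈ Q then 0 else (γ w : ℝ) * (4 * k a a) ^ w.card)
      ≤ ε ^ 2 * w₀⁻¹ * (γ w : ℝ) ^ (1 - α) := by
    intro w
    split_ifs with hwQ
    · positivity
    · rcases eq_or_lt_of_le (zero_le (a := γ w)) with h0 | h0
      · rw [← h0, NNReal.coe_zero, zero_mul]; positivity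
      · have hγw : (0 : ℝ) < γ w := h0
        have hwne : w.Nonempty := Finset.nonempty_iff_ne_empty.2 fun h1 => hwQ (h1 ▸ hQ0)
        have hwp := hw₀pos w hwne h0
        have h1 : realImportance k γ a c C α w < ε ^ 2 := by
          by_contra hcon
          exact hwQ ((hQ w).2 ((mem_activeSets_iff_real hκ hc hα0.le hW hε hτ').2
            (Or.inr ⟨w, subset_rfl, not_lt.1 hcon⟩)))
        have h2 : cHat k a C ^ w.card * (γ w : ℝ) ^ α ≤ ε ^ 2 * w₀⁻¹ := by
          rw [← div_eq_mul_inv, le_div_iff₀ hwp, mul_comm]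
          exact h1.le
        calc (γ w : ℝ) * (4 * k a a) ^ w.card
            ≤ (γ w : ℝ) * cHat k a C ^ w.card := by
              gcongr; exact le_max_right _ _
          _ = cHat k a C ^ w.card * (γ w : ℝ) ^ α * (γ w : ℝ) ^ (1 - α) := by
              rw [mul_assoc, ← Real.rpow_add hγw]; simp [mul_comm]
          _ ≤ _ := by gcongr
  have hs : Summable fun w => if w ∈ Q then 0 else (γ w : ℝ) * (4 * k a a) ^ w.card :=
    Summable.of_nonneg_of_le (fun w => by split_ifs <;> positivity) hle1 (hs1.mul_left _)
  refine ⟨K₁ * ε ^ (-η), fun u hu => hK₁ ε hε hε1 u ((hQ u).1 hu), hs, ?_⟩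
  have hT : (∑' w, if w ∈ Q then 0 else (γ w : ℝ) * (4 * k a a) ^ w.card) ≤ ε ^ 2 * w₀⁻¹ * S₁ := by
    rw [hS₁, ← tsum_mul_left]
    exact hs.tsum_le_tsum hle1 (hs1.mul_left _)
  -- The `Ĉ^{|u|}` in `r_u` cancels `(C(1 + k(a,a)))^{|u|}`. What remains is `2^{|u|} γ_u^{1-α}`,
  -- which is summable.
  have hV : ∀ u ∈ Q.erase ∅, c * (2 * C * (1 + k a a)) ^ u.card *
      ((natPoints k γ a c C τ' α ε u : ℝ) + 1) ^ (-τ) * (K₁ * ε ^ (-η)) * rSq k γ a u u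
      ≤ ε ^ 2 * ε ^ (-η) * (c * R' * w₀⁻¹ * K₁) * (2 ^ u.card * (γ u : ℝ) ^ (1 - α)) := by
    intro u hu
    obtain ⟨hu0, huQ⟩ := Finset.mem_erase.1 hu
    rcases eq_or_lt_of_le (zero_le (a := γ u)) with h0 | h0
    · have h1 : rSq k γ a u u = 0 :=
        le_antisymm (by simpa [← h0] using hRu u) (rSq_nonneg hκ u)
      rw [h1, mul_zero]
      positivity
    · have hγu : (0 : ℝ) < γ u := h0
      have hwp := hw₀pos u (Finset.nonempty_iff_ne_empty.2 hu0) h0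
      have hrpos : 0 < realImportance k γ a c C α u := by
        rw [realImportance]; positivity
      have h1 := le_natPoints_add_one (C := C) hκ hc hα0.le hW hε hτ' ((hQ u).1 huQ) hu0
      have h2 : ((natPoints k γ a c C τ' α ε u : ℝ) + 1) ^ (-τ) ≤
          ε ^ 2 / realImportance k γ a c C α u := by
        have h3 : (1 : ℝ) ≤ (natPoints k γ a c C τ' α ε u : ℝ) + 1 := by
          linarith [Nat.cast_nonneg (α := ℝ) (natPoints k γ a c C τ' α ε u)]
        calc ((natPoints k γ a c C τ' α ε u : ℝ) + 1) ^ (-τ)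
            ≤ ((natPoints k γ a c C τ' α ε u : ℝ) + 1) ^ (-τ') :=
              Real.rpow_le_rpow_of_exponent_le h3 (by linarith)
          _ ≤ ((realImportance k γ a c C α u / ε ^ 2) ^ (1 / τ')) ^ (-τ') :=
              Real.rpow_le_rpow_of_nonpos (by positivity) h1 (by linarith)
          _ = _ := by
              rw [← Real.rpow_mul (by positivity), one_div, mul_neg, inv_mul_cancel₀ hτ'.ne',
                Real.rpow_neg_one, inv_div]
      have h4 : (2 * C * (1 + k a a)) ^ u.card ≤ 2 ^ u.card * cHat k a C ^ u.card := by
        rw [mul_assoc, mul_pow]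
        gcongr
        exact le_max_left _ _
      calc c * (2 * C * (1 + k a a)) ^ u.card *
            ((natPoints k γ a c C τ' α ε u : ℝ) + 1) ^ (-τ) * (K₁ * ε ^ (-η)) * rSq k γ a u u
          ≤ c * (2 ^ u.card * cHat k a C ^ u.card) * (ε ^ 2 / realImportance k γ a c C α u)
            * (K₁ * ε ^ (-η)) * (R' * γ u) := by
            have := rSq_nonneg (γ := γ) hκ u
            gcongr
            exact hRu u
        _ = ε ^ 2 * ε ^ (-η) * (c * R' * w₀⁻¹ * K₁) * (2 ^ u.card * (γ u : ℝ) ^ (1 - α)) := by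
            rw [realImportance, ← hw₀, Real.rpow_sub hγu, Real.rpow_one]
            field_simp
  have hVs : ∑ u ∈ Q.erase ∅, c * (2 * C * (1 + k a a)) ^ u.card *
      ((natPoints k γ a c C τ' α ε u : ℝ) + 1) ^ (-τ) * (K₁ * ε ^ (-η)) * rSq k γ a u u
      ≤ ε ^ 2 * ε ^ (-η) * (c * R' * w₀⁻¹ * K₁) * S₂ := by
    refine (Finset.sum_le_sum hV).trans ?_
    rw [← Finset.mul_sum]
    gcongr
    exact hs2.sum_le_tsum _ fun u _ => by positivity
  rw [hE2]
  have h5 : ε ^ 2 * w₀⁻¹ * S₁ * 1 ≤ ε ^ 2 * w₀⁻¹ * S₁ * ε ^ (-η) := by gcongr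
  have h6 : 0 ≤ ε ^ 2 * ε ^ (-η) := by positivity
  calc _ ≤ ε ^ 2 * w₀⁻¹ * S₁ + ε ^ 2 * ε ^ (-η) * (c * R' * w₀⁻¹ * K₁) * S₂ := add_le_add hT hVs
    _ ≤ ε ^ 2 * w₀⁻¹ * S₁ * ε ^ (-η) + ε ^ 2 * ε ^ (-η) * (c * R' * w₀⁻¹ * K₁) * S₂
        + ε ^ 2 * ε ^ (-η) := by linarith
    _ = _ := by ring

end Bounds

end

end InfDimInt

namespace InfDimInt

noncomputable section

/-! ### Cost and error of the changing dimension algorithms -/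

/-- Monotonicity allows evaluation at `ν + ν₀`, at the expense of a larger constant. -/
theorem exists_price_le {price : ℕ → ℝ≥0∞} (hmono : Monotone price) {σ : ℝ}
    (hprice : ∃ A : ℝ, ∀ᶠ ν : ℕ in atTop, price ν ≤ ENNReal.ofReal (A * Real.exp (σ * ν))) :
    ∃ A : ℝ, 0 < A ∧ ∀ ν : ℕ, price ν ≤ ENNReal.ofReal (A * Real.exp σ ^ ν) := by
  obtain ⟨A, hA⟩ := hprice
  obtain ⟨ν₀, hν₀⟩ := eventually_atTop.1 hA
  refine ⟨(|A| + 1) * Real.exp (σ * ν₀), by positivity, fun ν => ?_⟩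
  calc price ν ≤ price (ν + ν₀) := hmono (Nat.le_add_right _ _)
    _ ≤ ENNReal.ofReal (A * Real.exp (σ * (ν + ν₀ : ℕ))) := hν₀ _ (Nat.le_add_left _ _)
    _ ≤ _ := by
        refine ENNReal.ofReal_le_ofReal ?_
        rw [← Real.exp_nat_mul, mul_assoc, ← Real.exp_add]
        have h1 : σ * ((ν + ν₀ : ℕ) : ℝ) = σ * ν₀ + ν * σ := by push_cast; ring
        rw [h1]
        gcongr
        linarith [le_abs_self A]

section Cost

variable {S : Type} {k : ReproducingKernel S} {γ : Finset ℕ → ℝ≥0} {a : S} {c C τ τ' α : ℝ}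

theorem cdCost_eq_sum (price : ℕ → ℝ≥0∞) {ε : ℝ} {Q : Finset (Finset ℕ)}
    (hQ : ∀ u, u ∈ Q ↔ u ∈ activeSets k γ a c C τ' α ε) :
    cdCost k γ a price c C τ' α ε = ∑ u ∈ Q,
      (numPoints k γ a c C τ' α ε u : ℝ≥0∞) * ∑ v ∈ u.powerset, price v.card := by
  rw [cdCost, ← Finset.tsum_subtype Q fun u =>
    (numPoints k γ a c C τ' α ε u : ℝ≥0∞) * ∑ v ∈ u.powerset, price v.card]
  have h : activeSets k γ a c C τ' α ε = {u | u ∈ Q} := by ext u; simp [hQ]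
  rw [h]
  rfl

theorem CardLogBound.exists_cdCost_le (h : CardLogBound γ) (hκ : 0 < k a a) (hc : 0 < c)
    (hadm : Admissible k γ a τ τ' α) {price : ℕ → ℝ≥0∞} (hmono : Monotone price) {σ : ℝ}
    (hprice : ∃ A : ℝ, ∀ᶠ ν : ℕ in atTop, price ν ≤ ENNReal.ofReal (A * Real.exp (σ * ν))) :
    ∃ K : ℝ, 0 < K ∧ ∀ ε : ℝ, 0 < ε → ε < 1 →
      cdCost k γ a price c C τ' α ε ≤ ENNReal.ofReal (K * ε ^ (-(2 / τ'))) := by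
  obtain ⟨hτ', -, hα0, -, -, -⟩ := hadm.exponents
  have hW := h.weightSum_ne_top hκ hadm
  obtain ⟨A, hA0, hA⟩ := exists_price_le hmono hprice
  -- There are `2^{|u|}` subsets `v ⊆ u`, each priced at most `A e^{σ|u|}`.
  obtain ⟨K, hK0, hK⟩ := h.sum_natPoints_le (C := C) hκ hc hadm (B := 2 * Real.exp σ)
    (by positivity)
  refine ⟨A * K, by positivity, fun ε hε hε1 => ?_⟩
  have hfin := h.finite_activeSets (C := C) hκ hc hadm hε
  set Q := hfin.toFinset with hQ
  have hmem : ∀ u, u ∈ Q ↔ u ∈ activeSets k γ a c C τ' α ε := fun u => by simp [hQ]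
  have h1 := cdCost_eq_sum price hmem
  have h2 : ∀ u ∈ Q, (numPoints k γ a c C τ' α ε u : ℝ≥0∞) * ∑ v ∈ u.powerset, price v.card
      ≤ ENNReal.ofReal (A * (natPoints k γ a c C τ' α ε u * (2 * Real.exp σ) ^ u.card)) := by
    intro u _
    rw [numPoints_eq_natPoints hκ hc hα0.le hW hε hτ', ENat.toENNReal_coe]
    have h3 : ∑ v ∈ u.powerset, price v.card
        ≤ 2 ^ u.card * ENNReal.ofReal (A * Real.exp σ ^ u.card) := by
      calc ∑ v ∈ u.powerset, price v.card
          ≤ ∑ v ∈ u.powerset, ENNReal.ofReal (A * Real.exp σ ^ u.card) :=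
            Finset.sum_le_sum fun v hv =>
              (hmono (Finset.card_le_card (Finset.mem_powerset.1 hv))).trans (hA _)
        _ = _ := by simp
    calc (natPoints k γ a c C τ' α ε u : ℝ≥0∞) * ∑ v ∈ u.powerset, price v.card
        ≤ (natPoints k γ a c C τ' α ε u : ℝ≥0∞) *
          (2 ^ u.card * ENNReal.ofReal (A * Real.exp σ ^ u.card)) := by gcongr
      _ = ENNReal.ofReal (natPoints k γ a c C τ' α ε u) *
          (ENNReal.ofReal (2 ^ u.card) * ENNReal.ofReal (A * Real.exp σ ^ u.card)) := by
          rw [ENNReal.ofReal_natCast, ENNReal.ofReal_pow two_pos.le, ENNReal.ofReal_ofNat]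
      _ = _ := by
          rw [← ENNReal.ofReal_mul (by positivity), ← ENNReal.ofReal_mul (by positivity), mul_pow]
          congr 1
          ring
  rw [h1]
  refine (Finset.sum_le_sum h2).trans ?_
  rw [← ENNReal.ofReal_sum_of_nonneg fun u _ => by positivity, ← Finset.mul_sum]
  refine ENNReal.ofReal_le_ofReal ?_
  rw [mul_assoc]
  gcongr
  exact hK ε hε hε1 Q fun u hu => (hmem u).1 hu

end Cost

section Error

variable {S : Type} [MeasurableSpace S] {k : ReproducingKernel S} {γ : Finset ℕ → ℝ≥0}
  {ρ : Measure S} {a : S} {c C τ τ' α α₁ α₂ : ℝ}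
  {q : (u : Finset ℕ) → (n : ℕ+) → UnbiasedQuadrature ρ u n}

theorem cdValue_eq_sum {ε : ℝ} {Q : Finset (Finset ℕ)}
    (hQ : ∀ u, u ∈ Q ↔ u ∈ activeSets k γ a c C τ' α ε) (f : (weightedKernel k γ).Space)
    (ω : ∀ u : Finset ℕ, u → (cdQuadrature k γ a q c C τ' α ε u).Ω) :
    cdValue k γ a q c C τ' α ε f ω = toFunction k γ f (fun _ => a) + ∑ u ∈ Q.erase ∅,
      (cdQuadrature k γ a q c C τ' α ε u).eval a
        (anchoredComponent a (toFunction k γ f) u) (ω u) := by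
  rw [cdValue]
  have h1 : activeSets k γ a c C τ' α ε \ {∅} = ((Q.erase ∅ : Finset (Finset ℕ)) : Set _) := by
    ext u; simp [hQ]
  rw [h1, finsum_mem_coe_finset]

variable [IsProbabilityMeasure ρ]

theorem CardLogBound.exists_cdError_le (h : CardLogBound γ)
    (hk : Measurable fun p : S × S => k p.1 p.2) (hM : Integrable (fun x => k x x) ρ)
    (hκ : 0 < k a a) (ha : Summable fun u : Finset ℕ => (γ u : ℝ) * k a a ^ u.card)
    (h0 : ∀ y, ∫ x, k x y ∂ρ = 0) (hγ : γ ∅ = 1)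
    (hsum : Summable fun u : Finset ℕ => (γ u : ℝ) * (∫ x, k x x ∂ρ) ^ u.card)
    (hA6 : ∀ u v : Finset ℕ, u ⊆ v → 0 < γ v → 0 < γ u)
    (hc : 0 < c) (hC : 0 < C) (hα₁ : 0 ≤ α₁) (hα₂ : α₂ ∈ Set.Icc (0 : ℝ) 1)
    (hA7 : VarianceBound k γ a q c C τ α₁ α₂)
    {R : ℝ} (hR : ∀ u : Finset ℕ, rSq k γ a u u ≤ R * γ u)
    (hadm : Admissible k γ a τ τ' α) {η : ℝ} (hη : 0 < η) :
    ∃ K : ℝ, 0 < K ∧ ∀ ε : ℝ, 0 < ε → ε < 1 →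
      (∀ f, MemLp (cdValue k γ a q c C τ' α ε f) 2 (cdMeasure k γ a q c C τ' α ε)) ∧
      cdError k γ a q c C τ' α ε ^ 2 ≤ ENNReal.ofReal (K * ε ^ (2 - η)) := by
  obtain ⟨hτ', -, hα0, -, -, -⟩ := hadm.exponents
  have hW := h.weightSum_ne_top hκ hadm
  obtain ⟨K, hK0, hK⟩ := h.error_terms_le hκ hc hC hadm hα₁ hα₂ hR hη
  refine ⟨K, hK0, fun ε hε hε1 => ?_⟩
  have hfin := h.finite_activeSets (C := C) hκ hc hadm hε
  set Q := hfin.toFinset with hQ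
  have hmem : ∀ u, u ∈ Q ↔ u ∈ activeSets k γ a c C τ' α ε := fun u => by simp [hQ]
  have hact := fun u => mem_activeSets_iff_real (u := u) (C := C) hκ hc hα0.le hW hε hτ'
  obtain ⟨G, hG, hs, hle⟩ := hK ε hε hε1 Q hmem
  have hpos : ∀ u ∈ Q, 0 < natPoints k γ a c C τ' α ε u := fun u hu =>
    natPoints_pos hκ hc hα0.le hW hε hτ' ((hmem u).1 hu)
  -- The default value of `toPNat'` at zero plays no role on `Q`.
  have hm : ∀ u ∈ Q, ((natPoints k γ a c C τ' α ε u).toPNat' : ℕ) = natPoints k γ a c C τ' α ε u :=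
    fun u hu => PNat.toPNat'_coe (hpos u hu)
  have hQ0 : ∅ ∈ Q := (hmem ∅).2 ((hact ∅).2 (Or.inl rfl))
  have hQd : ∀ w ∈ Q, ∀ u ⊆ w, u ∈ Q := by
    intro w hw u huw
    rw [hmem, hact] at hw ⊢
    rcases hw with rfl | ⟨v, hwv, hv⟩
    · exact Or.inl (Finset.subset_empty.1 huw)
    · exact Or.inr ⟨v, huw.trans hwv, hv⟩
  have hQγ : ∀ u ∈ Q, 0 < γ u := by
    intro u hu
    rw [hmem, hact] at hu
    rcases hu with rfl | ⟨v, huv, hv⟩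
    · rw [hγ]; exact one_pos
    · exact hA6 u v huv (pos_of_le_realImportance hα0 hε hv)
  have key := lintegral_error_sq_le hk hM hκ ha h0 hγ hsum hA6 hc hC hA7 hQ0 hQd hQγ
    (fun u => (natPoints k γ a c C τ' α ε u).toPNat') (G := G)
    (fun u hu w hw => by rw [hm u hu]; exact hG u hu w hw) hs
  have hval : ∀ f, cdValue k γ a q c C τ' α ε f = fun ω => toFunction k γ f (fun _ => a) +
      ∑ u ∈ Q.erase ∅, (q u (natPoints k γ a c C τ' α ε u).toPNat').eval a
        (anchoredComponent a (toFunction k γ f) u) (ω u) := fun f =>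
    funext fun ω => cdValue_eq_sum hmem f ω
  refine ⟨fun f => by rw [hval]; exact (key f).1, ?_⟩
  have hsq : cdError k γ a q c C τ' α ε ^ 2 = ⨆ f ∈ unitBall k γ, ∫⁻ ω,
      ENNReal.ofReal ((integral k γ ρ f - cdValue k γ a q c C τ' α ε f ω) ^ 2)
      ∂(cdMeasure k γ a q c C τ' α ε) := by
    rw [cdError, ← ENNReal.rpow_natCast, ← ENNReal.rpow_mul]
    norm_num
  rw [hsq]
  refine iSup₂_le fun f hf => ?_
  rw [hval]
  refine ((key f).2).trans (ENNReal.ofReal_le_ofReal ?_)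
  have hf1 : ‖f‖ ^ 2 ≤ 1 := pow_le_one₀ (norm_nonneg _) hf
  have hsums : ∑ u ∈ Q.erase ∅, c * (2 * C * (1 + k a a)) ^ u.card *
      (((natPoints k γ a c C τ' α ε u).toPNat' : ℕ) + 1 : ℝ) ^ (-τ) * G * rSq k γ a u u
      = ∑ u ∈ Q.erase ∅, c * (2 * C * (1 + k a a)) ^ u.card *
          ((natPoints k γ a c C τ' α ε u : ℝ) + 1) ^ (-τ) * G * rSq k γ a u u :=
    Finset.sum_congr rfl fun u hu => by rw [hm u (Finset.mem_of_mem_erase hu)]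
  rw [hsums]
  refine le_trans (mul_le_of_le_one_left ?_ hf1) hle
  refine add_nonneg (tsum_nonneg fun w => by split_ifs <;> positivity)
    (Finset.sum_nonneg fun u hu => ?_)
  have h3 : 0 ≤ G := (growth_nonneg α₁ α₂ u _).trans
    (hG u (Finset.mem_of_mem_erase hu) u subset_rfl)
  have h4 := rSq_nonneg (γ := γ) hκ u
  positivity

end Error

end

end InfDimInt

namespace InfDimInt

noncomputable section

/-! ### Nonadaptive algorithms in the class `𝒜^res` -/

theorem history_of_nonadaptive {S : Type} (p : ℕ → ℕ → S) (f : (ℕ → S) → ℝ) (n : ℕ) :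
    history (fun i _ => p i) f n = (List.range n).map fun i => f (p i) := by
  induction n with
  | zero => rfl
  | succ n ih => rw [history, ih, List.range_succ, List.map_append]; rfl

/-- The set of coordinates different from the anchor is the smallest one allowed in the infimum. -/
theorem evalCost_eq {S : Type} {a : S} {price : ℕ → ℝ≥0∞} (hmono : Monotone price) {x : ℕ → S}
    {v : Finset ℕ} (hx : ∀ j, x j ≠ a ↔ j ∈ v) : evalCost a price x = price v.card := by
  refine le_antisymm (iInf₂_le_of_le v (fun j hj => ?_) le_rfl) (le_iInf₂ fun u hu => ?_)
  · exact not_not.1 fun h => hj ((hx j).1 h)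
  · exact hmono (Finset.card_le_card fun j hj => not_not.1 fun h => (hx j).2 hj (hu j h))

section Nonadaptive

variable {S : Type} {k : ReproducingKernel S} {γ : Finset ℕ → ℝ≥0} {a : S} {price : ℕ → ℝ≥0∞}

/-- Membership in `𝒜^res` demands an expected cost of exactly `∑ $(|v_i|)`. Requiring the non-anchor
coordinates to be precisely `v i` makes the cost deterministic and equal to this sum. -/
theorem exists_restrictedAlgorithm (hmono : Monotone price) {ι : Type} [Fintype ι]
    {Ω : Type} [MeasurableSpace Ω] (P : Measure Ω) [IsProbabilityMeasure P]
    (pt : ι → Ω → ℕ → S) (v : ι → Finset ℕ) (hpt : ∀ i ω j, pt i ω j ≠ a ↔ j ∈ v i)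
    (out : Ω → (ι → ℝ) → ℝ)
    (hout : ∀ f, MemLp (fun ω => out ω fun i => toFunction k γ f (pt i ω)) 2 P) :
    ∃ Q : RestrictedAlgorithm k γ a price, Q.worstCost ≤ ∑ i, price (v i).card ∧
      ∀ [MeasurableSpace S] (ρ : Measure S) [IsProbabilityMeasure ρ],
        Q.error ρ = (⨆ f ∈ unitBall k γ, ∫⁻ ω, ENNReal.ofReal ((integral k γ ρ f -
          out ω fun i => toFunction k γ f (pt i ω)) ^ 2) ∂P) ^ (1 / 2 : ℝ) := by
  set e := Fintype.equivFin ι with he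
  let p : ℕ → Ω → ℕ → S := fun i ω =>
    if h : i < Fintype.card ι then pt (e.symm ⟨i, h⟩) ω else fun _ => a
  let v' : ℕ → Finset ℕ := fun i => if h : i < Fintype.card ι then v (e.symm ⟨i, h⟩) else ∅
  have hp : ∀ i ω j, p i ω j ≠ a ↔ j ∈ v' i := by
    intro i ω j
    simp only [p, v']
    split_ifs with h
    · exact hpt _ _ _
    · simp
  have hval : ∀ f ω, (fun i => (history (fun i _ => p i ω) (toFunction k γ f)
      (Fintype.card ι)).getD (e i) 0) = fun i => toFunction k γ f (pt i ω) := by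
    intro f ω
    ext i
    rw [history_of_nonadaptive (fun i => p i ω), List.getD_eq_getElem _ _ (by simp)]
    simp [p]
  have hcost : ∀ (f : (weightedKernel k γ).Space) ω, ∑ i ∈ Finset.range (Fintype.card ι),
      evalCost a price (p i ω) = ∑ i ∈ Finset.range (Fintype.card ι), price (v' i).card :=
    fun f ω => Finset.sum_congr rfl fun i _ => evalCost_eq hmono (hp i ω)
  let A : RestrictedAlgorithm k γ a price :=
    { Ω := Ω
      P := P
      n := Fintype.card ι
      v := v'
      point := fun i ω _ => p i ω
      output := fun ω y => out ω fun i => y.getD (e i) 0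
      point_mem := fun i _ ω _ j hj => not_not.1 fun h => hj ((hp i ω j).1 h)
      square_integrable := fun f => by simpa only [hval] using hout f
      cost_measurable := fun f => by simp only [hcost f]; exact aemeasurable_const
      cost_eq := fun f => by simp only [hcost f]; simp }
  refine ⟨A, iSup₂_le fun f _ => ?_, fun ρ _ => ?_⟩
  · have h1 : ∀ ω, A.cost f ω = ∑ i, price (v i).card := by
      intro ω
      refine (hcost f ω).trans ?_
      rw [Finset.sum_range, ← e.symm.sum_comp]
      simp [v']
    simp [h1]
  · have h1 : ∀ f ω, A.value f ω = out ω fun i => toFunction k γ f (pt i ω) := fun f ω =>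
      congrArg (out ω) (hval f ω)
    simp only [RestrictedAlgorithm.error, h1]
    rfl

end Nonadaptive

section ChangingDimension

variable {S : Type} [MeasurableSpace S] {k : ReproducingKernel S} {γ : Finset ℕ → ℝ≥0}
  {ρ : Measure S} [IsProbabilityMeasure ρ] {a : S} {c C τ' α : ℝ} {price : ℕ → ℝ≥0∞}
  {q : (u : Finset ℕ) → (n : ℕ+) → UnbiasedQuadrature ρ u n}

/-- Changing dimension algorithms belong to the class `𝒜^res`, up to the replacement of nodes with
coordinates that accidentally agree with the anchor, where the anchored components vanish. -/
theorem exists_restrictedAlgorithm_cd (hmono : Monotone price) {b : S} (hb : b ≠ a) {ε : ℝ}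
    {Q : Finset (Finset ℕ)} (hQ : ∀ u, u ∈ Q ↔ u ∈ activeSets k γ a c C τ' α ε) (hQ0 : ∅ ∈ Q)
    (hpos : ∀ u ∈ Q, 0 < natPoints k γ a c C τ' α ε u)
    (hnum : ∀ u, numPoints k γ a c C τ' α ε u = natPoints k γ a c C τ' α ε u)
    (hL : ∀ f, MemLp (cdValue k γ a q c C τ' α ε f) 2 (cdMeasure k γ a q c C τ' α ε)) :
    ∃ A : RestrictedAlgorithm k γ a price,
      A.worstCost ≤ cdCost k γ a price c C τ' α ε ∧ A.error ρ = cdError k γ a q c C τ' α ε := by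
  classical
  let M : Finset ℕ → ℕ := fun u => ((numPoints k γ a c C τ' α ε u).toNat.toPNat' : ℕ)
  let ι : Type := Σ u : {u // u ∈ Q}, Fin (M u.1) × {v // v ∈ u.1.powerset}
  let Ω : Type := ∀ u : Finset ℕ, u → (cdQuadrature k γ a q c C τ' α ε u).Ω
  let x : (u : Finset ℕ) → Fin (M u) → Ω → ℕ → S := fun u i ω =>
    (cdQuadrature k γ a q c C τ' α ε u).nodePoint a i (ω u)
  -- A node meeting the anchor on `u` would be cheaper than `$(|v|)` for some `v`. It is replaced by
  -- a point with all coordinates in `v` equal to `b ≠ a`.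
  let pt : ι → Ω → ℕ → S := fun i ω =>
    anchorAt a i.2.2.1 (if ∀ j ∈ i.1.1, x i.1.1 i.2.1 ω j ≠ a then x i.1.1 i.2.1 ω else fun _ => b)
  let val : (ι → ℝ) → (u : Finset ℕ) → Fin (M u) → Finset ℕ → ℝ := fun y u i v =>
    if h : u ∈ Q ∧ v ∈ u.powerset then y ⟨⟨u, h.1⟩, i, ⟨v, h.2⟩⟩ else 0
  -- Values at replaced nodes are ignored: there the anchored component is zero.
  let out : Ω → (ι → ℝ) → ℝ := fun ω y =>
    val y ∅ ⟨0, PNat.pos _⟩ ∅ + ∑ u ∈ Q.erase ∅, ∑ i : Fin (M u),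
      (cdQuadrature k γ a q c C τ' α ε u).coeff i *
        if ∀ j ∈ u, x u i ω j ≠ a then
          ∑ v ∈ u.powerset, (-1 : ℝ) ^ (u \ v).card * val y u i v else 0
  have hprob : IsProbabilityMeasure (cdMeasure k γ a q c C τ' α ε) := by
    unfold cdMeasure; infer_instance
  have hpt : ∀ i ω j, pt i ω j ≠ a ↔ j ∈ i.2.2.1 := by
    intro i ω j
    simp only [pt, anchorAt]
    split_ifs with h1 h2
    · simpa [h1] using h2 j (Finset.mem_powerset.1 i.2.2.2 h1)
    · simp [h1, hb]
    · simp [h1]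
  have hout : ∀ f ω, (out ω fun i => toFunction k γ f (pt i ω)) = cdValue k γ a q c C τ' α ε f ω := by
    intro f ω
    rw [cdValue_eq_sum hQ]
    refine congrArg₂ (· + ·) ?_ (Finset.sum_congr rfl fun u hu => ?_)
    · simp only [val, hQ0, Finset.mem_powerset, Finset.Subset.refl, and_self, dite_true, pt]
      congr 1
    · have huQ : u ∈ Q := Finset.mem_of_mem_erase hu
      refine Finset.sum_congr rfl fun i _ => congrArg _ ?_
      split_ifs with h
      · refine Finset.sum_congr rfl fun v hv => congrArg _ ?_
        simp only [val, huQ, hv, and_self, dite_true, pt, if_pos h]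
        rfl
      · push Not at h
        obtain ⟨j, hj, hja⟩ := h
        exact (anchoredComponent_eq_zero _ hj hja).symm
  obtain ⟨A, hA1, hA2⟩ := exists_restrictedAlgorithm (k := k) (γ := γ) hmono
    (cdMeasure k γ a q c C τ' α ε) pt (fun i => i.2.2.1) hpt out
    (fun f => by simp only [hout]; exact hL f)
  refine ⟨A, hA1.trans (le_of_eq ?_), ?_⟩
  · rw [cdCost_eq_sum price hQ, Fintype.sum_sigma, ← Finset.sum_coe_sort Q]
    refine Finset.sum_congr rfl fun u _ => ?_
    rw [Fintype.sum_prod_type]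
    simp only [Finset.sum_coe_sort u.1.powerset fun v => price v.card]
    rw [Finset.sum_const, Finset.card_univ, Fintype.card_fin, nsmul_eq_mul, hnum,
      ENat.toENNReal_coe]
    congr 2
    exact PNat.toPNat'_coe (hpos u.1 u.2)
  · rw [hA2 ρ, cdError]
    simp only [hout]

end ChangingDimension

end

end InfDimInt

namespace InfDimInt

noncomputable section

/-! ### From bounds in `ε` to convergence rates -/

/-- Choose `ε = (N/K₁)^{-τ'/2}`, for which the cost bound equals `N`. -/
theorem exists_rate {K₁ K₂ τ' δ : ℝ} (hK₁ : 0 < K₁) (hτ' : 0 < τ') :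
    ∃ A : ℝ, ∀ᶠ N : ℝ in atTop, ∃ ε : ℝ, 0 < ε ∧ ε < 1 ∧ K₁ * ε ^ (-(2 / τ')) ≤ N ∧
      K₂ * ε ^ (2 - 2 * δ / τ') ≤ A * N ^ (-τ' + δ) := by
  refine ⟨K₂ * K₁ ^ (τ' - δ), ?_⟩
  filter_upwards [eventually_gt_atTop K₁] with N hN
  have hN0 : 0 < N := hK₁.trans hN
  have h1 : 1 < N / K₁ := (one_lt_div hK₁).2 hN
  refine ⟨(N / K₁) ^ (-(τ' / 2)), by positivity, ?_, ?_, ?_⟩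
  · exact Real.rpow_lt_one_of_one_lt_of_neg h1 (by linarith)
  · rw [← Real.rpow_mul (by positivity)]
    have : -(τ' / 2) * -(2 / τ') = 1 := by field_simp
    rw [this, Real.rpow_one]
    exact (mul_div_cancel₀ _ hK₁.ne').le
  · rw [← Real.rpow_mul (by positivity)]
    have : -(τ' / 2) * (2 - 2 * δ / τ') = -τ' + δ := by field_simp; ring
    rw [this, Real.div_rpow hN0.le hK₁.le]
    have h2 : K₁ ^ (τ' - δ) = (K₁ ^ (-τ' + δ))⁻¹ := by
      rw [← Real.rpow_neg hK₁.le]; ring_nf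
    rw [h2]
    exact le_of_eq (by ring)

/-- Choose `ε' = t ε^{2/(2-η)}`, with `t` small enough to absorb `K₂` and, by `t ≤ 1/2`, to keep `ε'
< 1`. -/
theorem exists_complexity_rate {K₁ K₂ τ' p η : ℝ} (hK₁ : 0 < K₁) (hK₂ : 0 < K₂)
    (hη2 : η < 2) (hp : 2 / (2 - η) * (2 / τ') ≤ p) :
    ∃ K : ℝ, 0 < K ∧ ∀ ε : ℝ, 0 < ε → ε < 1 → ∃ ε' : ℝ, 0 < ε' ∧ ε' < 1 ∧
      K₂ * ε' ^ (2 - η) ≤ ε ^ 2 ∧ K₁ * ε' ^ (-(2 / τ')) ≤ K * ε ^ (-p) := by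
  have h0 : 0 < 2 - η := by linarith
  set t := min (1 / 2) (K₂ ^ (-(1 / (2 - η)))) with ht
  have ht0 : 0 < t := by positivity
  have htK : K₂ * t ^ (2 - η) ≤ 1 := by
    calc K₂ * t ^ (2 - η) ≤ K₂ * (K₂ ^ (-(1 / (2 - η)))) ^ (2 - η) := by
          gcongr; exact min_le_right _ _
      _ = 1 := by
          rw [← Real.rpow_mul hK₂.le]
          have : -(1 / (2 - η)) * (2 - η) = -1 := by field_simp
          rw [this, Real.rpow_neg_one, mul_inv_cancel₀ hK₂.ne']
  refine ⟨K₁ * t ^ (-(2 / τ')), by positivity, fun ε hε hε1 => ?_⟩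
  have hE : ε ^ (2 / (2 - η)) ≤ 1 := Real.rpow_le_one hε.le hε1.le (by positivity)
  refine ⟨t * ε ^ (2 / (2 - η)), by positivity, ?_, ?_, ?_⟩
  · have : t ≤ 1 / 2 := min_le_left _ _
    have h2 : 0 < ε ^ (2 / (2 - η)) := by positivity
    nlinarith
  · rw [Real.mul_rpow ht0.le (by positivity), ← Real.rpow_mul hε.le,
      div_mul_cancel₀ _ h0.ne', Real.rpow_two, ← mul_assoc]
    exact mul_le_of_le_one_left (by positivity) htK
  · rw [Real.mul_rpow ht0.le (by positivity), ← Real.rpow_mul hε.le, ← mul_assoc]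
    gcongr _ * ?_
    refine Real.rpow_le_rpow_of_exponent_ge hε hε1.le ?_
    linarith

section Main

variable {S : Type} [MeasurableSpace S] {k : ReproducingKernel S} {γ : Finset ℕ → ℝ≥0}
  {ρ : Measure S} [IsProbabilityMeasure ρ] {a : S} {price : ℕ → ℝ≥0∞}

/-- On a one-point domain (A2a) would give `k(a,a) = 0`. -/
theorem exists_ne_anchor (hκ : 0 < k a a) (h0 : ∀ y, ∫ x, k x y ∂ρ = 0) : ∃ b : S, b ≠ a := by
  by_contra! h
  have h1 : ∫ x, k x a ∂ρ = k a a := by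
    rw [show (fun x => k x a) = fun _ => k a a from funext fun x => by rw [h x]]
    simp
  exact hκ.ne' (h1.symm.trans (h0 a))

/-- The zero algorithm uses no samples, and its error is at most 1 because `|I(f)| = |e_∅| ≤ ‖f‖`.
-/
theorem complexity_eq_zero (hk : Measurable fun p : S × S => k p.1 p.2)
    (hM : Integrable (fun x => k x x) ρ) (h0 : ∀ y, ∫ x, k x y ∂ρ = 0) (hγ : γ ∅ = 1)
    (hsum : Summable fun u : Finset ℕ => (γ u : ℝ) * (∫ x, k x x ∂ρ) ^ u.card)
    (hmono : Monotone price) {ε : ℝ} (hε : 1 ≤ ε) : complexity k γ a price ρ ε = 0 := by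
  obtain ⟨A, hA1, hA2⟩ := exists_restrictedAlgorithm (k := k) (γ := γ) (a := a) hmono
    (Measure.dirac ()) (fun (i : Empty) _ => i.elim) (fun i => i.elim) (fun i => i.elim)
    (fun _ _ => 0) (fun _ => memLp_const 0)
  have h1 : A.error ρ ≤ 1 := by
    rw [hA2 ρ]
    refine ENNReal.rpow_le_one (iSup₂_le fun f hf => ?_) (by norm_num)
    obtain ⟨e, he, hF⟩ := exists_superposition f
    have h2 : integral k γ ρ f = e ∅ (fun _ => a) :=
      integral_toFunction_eq hk hM hsum h0 hγ hF _
    have h3 := (k.prod ∅).apply_sq_le (e ∅) (fun _ => a)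
    have h4 : k.prod ∅ (fun _ => a) (fun _ => a) = 1 := by simp [ReproducingKernel.prod]
    have h5 : ‖e ∅‖ ≤ 1 := (lp.norm_apply_le_norm (by norm_num) e ∅).trans (he.trans hf)
    rw [h4, mul_one] at h3
    have h6 : e ∅ (fun _ => a) ^ 2 ≤ 1 := h3.trans (pow_le_one₀ (norm_nonneg _) h5)
    simp [h2, h6]
  have h2 : A.worstCost = 0 := by simpa using hA1
  refine le_antisymm ?_ zero_le
  rw [← h2]
  refine iInf₂_le A (h1.trans ?_)
  rwa [ENNReal.one_le_ofReal]

theorem two_div_lt_min {τ p : ℝ} (hτ : 0 < τ) {d : EReal} (hd : 1 < d)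
    (hp : max ((2 : EReal) / (τ : EReal)) (2 / (d - 1)) < p) :
    0 < p ∧ ((2 / p : ℝ) : EReal) < min (τ : EReal) (d - 1) := by
  obtain ⟨h1, h2⟩ := max_lt_iff.1 hp
  have h1' : 2 / τ < p := by
    have : (2 : EReal) = ((2 : ℝ) : EReal) := rfl
    rw [this, ← EReal.coe_div] at h1
    exact_mod_cast h1
  have hp0 : 0 < p := lt_trans (by positivity) h1'
  refine ⟨hp0, lt_min ?_ ?_⟩
  · rw [EReal.coe_lt_coe_iff, div_lt_iff₀ hp0]
    rwa [div_lt_iff₀ hτ, mul_comm] at h1'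
  · induction d with
    | bot => simp at hd
    | top => rw [← EReal.coe_one, EReal.top_sub_coe]; exact EReal.coe_lt_top _
    | coe d =>
      have hd1 : 0 < d - 1 := by
        have : 1 < d := by exact_mod_cast hd
        linarith
      have : (2 : EReal) = ((2 : ℝ) : EReal) := rfl
      rw [this, ← EReal.coe_one, ← EReal.coe_sub, ← EReal.coe_div, EReal.coe_lt_coe_iff] at h2
      rw [← EReal.coe_one, ← EReal.coe_sub, EReal.coe_lt_coe_iff, div_lt_iff₀ hp0]
      rwa [div_lt_iff₀ hd1, mul_comm] at h2

end Main

end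

end InfDimInt

theorem mainTheorem2
    -- the domain `D ⊆ ℝ`, the probability measure `ρ` on it and the kernel `k`
    (D : Set ℝ) (ρ : Measure D) [IsProbabilityMeasure ρ]
    (k : InfDimInt.ReproducingKernel D) (γ : Finset ℕ → ℝ≥0)
    (hA1_measurable : Measurable fun p : D × D => k p.1 p.2)
    (hA1_ne_zero : ∃ x y, k x y ≠ 0)
    (hA2 : {g : D → ℝ | ∃ f : k.Space, g = fun x => f x} ∩
      {g : D → ℝ | ∃ f : (InfDimInt.ReproducingKernel.one D).Space, g = fun x => f x} = {0})
    (hA2a : ∀ y, ∫ x, k x y ∂ρ = 0)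
    (hA3 : Integrable (fun x => k x x) ρ)
    (hA4_empty : γ ∅ = 1)
    (hA4_summable : Summable fun u : Finset ℕ => (γ u : ℝ) * (∫ x, k x x ∂ρ) ^ u.card)
    (hA5 : ∀ x, 0 < k x x)
    (hA6 : ∀ u v : Finset ℕ, u ⊆ v → 0 < γ v → 0 < γ u)
    -- the anchor `(a, a, …)`
    (a : D) (ha : Summable fun u : Finset ℕ => (γ u : ℝ) * k a a ^ u.card)
    (hdecay : 1 < InfDimInt.decay k γ a)
    -- the cost function
    (price : ℕ → ℝ≥0∞) (hprice_one : ∀ ν, 1 ≤ price ν) (hprice_mono : Monotone price)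
    (σ : ℝ) (hσ : 0 < σ)
    (hprice : ∃ A : ℝ, ∀ᶠ ν : ℕ in atTop, price ν ≤ ENNReal.ofReal (A * Real.exp (σ * ν)))
    -- the building blocks
    (c C τ α₁ α₂ : ℝ) (hc : 0 < c) (hC : 0 < C) (hτ : 0 < τ) (hα₁ : 0 ≤ α₁)
    (hα₂ : α₂ ∈ Set.Icc (0 : ℝ) 1)
    (q : (u : Finset ℕ) → (n : ℕ+) → InfDimInt.UnbiasedQuadrature ρ u n)
    (hA7 : InfDimInt.VarianceBound k γ a q c C τ α₁ α₂)
    -- the growth condition, for some choice of the parameters of the construction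
    (τ₀ α₀ : ℝ) (hadm : InfDimInt.Admissible k γ a τ τ₀ α₀)
    (hgrowth : InfDimInt.GrowthCondition k γ a α₁ α₂ c C τ₀ α₀) :
    (∀ δ : ℝ, 0 < δ → ∃ A : ℝ, ∀ᶠ N : ℝ in atTop,
      InfDimInt.minimalError k γ a price ρ N ^ 2 ≤
        ENNReal.ofReal
          (A * N ^ (-(min (τ : EReal) (InfDimInt.decay k γ a - 1)).toReal + δ))) ∧
    InfDimInt.strongExponent k γ a price ρ ≤
      max ((2 : EReal) / (τ : EReal)) (2 / (InfDimInt.decay k γ a - 1)) ∧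
    (∀ τ' α' : ℝ, InfDimInt.Admissible k γ a τ τ' α' →
      ∀ δ : ℝ, 0 < δ → ∃ A : ℝ, ∀ᶠ N : ℝ in atTop, ∃ ε : ℝ, 0 < ε ∧
        InfDimInt.cdCost k γ a price c C τ' α' ε ≤ ENNReal.ofReal N ∧
        InfDimInt.cdError k γ a q c C τ' α' ε ^ 2 ≤ ENNReal.ofReal (A * N ^ (-τ' + δ))) := by
  have hκ : 0 < k a a := hA5 a
  obtain ⟨hτ₀, -, hα₀0, hα₀1, -, -⟩ := hadm.exponents
  obtain ⟨⟨R, hR⟩, hd, -⟩ := hgrowth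
  -- From here on the pair `(τ₀, α₀)` is no longer needed; the bound on the weights serves every
  -- admissible pair.
  have h := InfDimInt.cardLogBound_of_epsDim hκ ha hc hτ₀ hα₀0 hα₀1 hd
  have hcost := fun τ' α' (hadm' : InfDimInt.Admissible k γ a τ τ' α') =>
    h.exists_cdCost_le (C := C) hκ hc hadm' hprice_mono hprice
  have herr := fun τ' α' (hadm' : InfDimInt.Admissible k γ a τ τ' α') η (hη : 0 < η) =>
    h.exists_cdError_le hA1_measurable hA3 hκ ha hA2a hA4_empty hA4_summable hA6 hc hC hα₁ hα₂ hA7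
      hR hadm' hη
  have hpart3 : ∀ τ' α' : ℝ, InfDimInt.Admissible k γ a τ τ' α' →
      ∀ δ : ℝ, 0 < δ → ∃ A : ℝ, ∀ᶠ N : ℝ in atTop, ∃ ε : ℝ, (0 < ε ∧ ε < 1) ∧
        InfDimInt.cdCost k γ a price c C τ' α' ε ≤ ENNReal.ofReal N ∧
        InfDimInt.cdError k γ a q c C τ' α' ε ^ 2 ≤ ENNReal.ofReal (A * N ^ (-τ' + δ)) := by
    intro τ' α' hadm' δ hδ
    have hτ' := hadm'.exponents.1
    obtain ⟨K₁, hK₁, h1⟩ := hcost τ' α' hadm'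
    obtain ⟨K₂, -, h2⟩ := herr τ' α' hadm' (2 * δ / τ') (by positivity)
    obtain ⟨A, hA⟩ := InfDimInt.exists_rate (K₂ := K₂) (δ := δ) hK₁ hτ'
    refine ⟨A, hA.mono ?_⟩
    rintro N ⟨ε, hε, hε1, h3, h4⟩
    exact ⟨ε, ⟨hε, hε1⟩, (h1 ε hε hε1).trans (ENNReal.ofReal_le_ofReal h3),
      (h2 ε hε hε1).2.trans (ENNReal.ofReal_le_ofReal h4)⟩
  have halg : ∀ τ' α' : ℝ, InfDimInt.Admissible k γ a τ τ' α' → ∀ ε : ℝ, 0 < ε → ε < 1 →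
      ∃ Q : InfDimInt.RestrictedAlgorithm k γ a price,
        Q.worstCost ≤ InfDimInt.cdCost k γ a price c C τ' α' ε ∧
        Q.error ρ = InfDimInt.cdError k γ a q c C τ' α' ε := by
    intro τ' α' hadm' ε hε hε1
    obtain ⟨hτ', -, hα0, -, -, -⟩ := hadm'.exponents
    obtain ⟨b, hb⟩ := InfDimInt.exists_ne_anchor hκ hA2a
    obtain ⟨K₂, -, h2⟩ := herr τ' α' hadm' 1 one_pos
    have hW := h.weightSum_ne_top hκ hadm'
    have hfin := h.finite_activeSets (C := C) hκ hc hadm' hε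
    refine InfDimInt.exists_restrictedAlgorithm_cd hprice_mono hb (Q := hfin.toFinset)
      (fun u => by simp) ?_ (fun u hu => ?_)
      (InfDimInt.numPoints_eq_natPoints hκ hc hα0.le hW hε hτ') (h2 ε hε hε1).1
    · rw [Set.Finite.mem_toFinset, InfDimInt.mem_activeSets_iff hε hτ']
      exact Or.inl rfl
    · exact InfDimInt.natPoints_pos hκ hc hα0.le hW hε hτ' (by simpa using hu)
  refine ⟨fun δ hδ => ?_, ?_, fun τ' α' hadm' δ hδ => ?_⟩
  · set m : EReal := min (τ : EReal) (InfDimInt.decay k γ a - 1) with hm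
    have hm0 : ∃ m' : ℝ, m = m' := by
      rw [hm]
      generalize InfDimInt.decay k γ a = d at hdecay
      induction d with
      | bot => simp at hdecay
      | top => exact ⟨τ, by rw [← EReal.coe_one, EReal.top_sub_coe]; simp⟩
      | coe d => exact ⟨min τ (d - 1), by
          rw [← EReal.coe_one, ← EReal.coe_sub, EReal.coe_strictMono.monotone.map_min]⟩
    obtain ⟨m', hm'⟩ := hm0
    -- Half of `δ` pays for `τ'` being below the minimum, the other half for the loss in the rate of
    -- the algorithm.
    obtain ⟨τ', α', hadm', hle⟩ := InfDimInt.exists_admissible (k := k) (γ := γ) (a := a)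
      (m := m' - δ / 2) hτ (by rw [← hm, hm', EReal.coe_lt_coe_iff]; linarith) hdecay
    obtain ⟨A, hA⟩ := hpart3 τ' α' hadm' (δ / 2) (half_pos hδ)
    refine ⟨|A|, ?_⟩
    filter_upwards [hA, eventually_ge_atTop 1] with N hN hN1
    obtain ⟨ε, ⟨hε, hε1⟩, h1, h2⟩ := hN
    obtain ⟨Q, hQ1, hQ2⟩ := halg τ' α' hadm' ε hε hε1
    have h3 : InfDimInt.minimalError k γ a price ρ N ≤ InfDimInt.cdError k γ a q c C τ' α' ε := by
      rw [← hQ2]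
      exact iInf₂_le Q (hQ1.trans h1)
    refine ((pow_le_pow_left₀ zero_le h3 2).trans h2).trans (ENNReal.ofReal_le_ofReal ?_)
    rw [hm', EReal.toReal_coe]
    calc A * N ^ (-τ' + δ / 2) ≤ |A| * N ^ (-τ' + δ / 2) := by
          gcongr; exact le_abs_self A
      _ ≤ |A| * N ^ (-m' + δ) :=
          mul_le_mul_of_nonneg_left (Real.rpow_le_rpow_of_exponent_le hN1 (by linarith))
            (abs_nonneg _)
  · refine EReal.le_of_forall_lt_iff_le.1 fun p hp => ?_
    obtain ⟨hp0, hpm⟩ := InfDimInt.two_div_lt_min hτ hdecay hp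
    obtain ⟨m, hm1, hm2⟩ := EReal.exists_between_coe_real hpm
    obtain ⟨τ', α', hadm', hle⟩ := InfDimInt.exists_admissible hτ hm2 hdecay
    have hτ' := hadm'.exponents.1
    have hpτ : 2 / p < τ' := (by exact_mod_cast hm1 : 2 / p < m).trans_le hle
    have hpτ2 : 2 < τ' * p := (div_lt_iff₀ hp0).1 hpτ
    obtain ⟨η, hη0, hη2, hη⟩ : ∃ η : ℝ, 0 < η ∧ η < 2 ∧ 2 / (2 - η) * (2 / τ') ≤ p := by
      have h4 : 4 / (τ' * p) < 2 := by rw [div_lt_iff₀ (by positivity)]; linarith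
      have h5 : 0 < 4 / (τ' * p) := by positivity
      -- This `η` solves `2/(2-η) · 2/τ' = p`; it is positive because `τ' p > 2`.
      refine ⟨2 - 4 / (τ' * p), by linarith, by linarith, le_of_eq ?_⟩
      rw [sub_sub_cancel]
      field_simp
      norm_num
    obtain ⟨K₁, hK₁, h1⟩ := hcost τ' α' hadm'
    obtain ⟨K₂, hK₂, h2⟩ := herr τ' α' hadm' η hη0
    obtain ⟨K, hK, h3⟩ := InfDimInt.exists_complexity_rate hK₁ hK₂ hη2 hη
    refine sInf_le ⟨p, hp0.le, rfl, K, hK, fun ε hε => ?_⟩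
    rcases le_or_gt 1 ε with hε1 | hε1
    · rw [InfDimInt.complexity_eq_zero hA1_measurable hA3 hA2a hA4_empty hA4_summable hprice_mono
        hε1]
      exact zero_le
    · obtain ⟨ε', hε', hε'1, h4, h5⟩ := h3 ε hε hε1
      obtain ⟨Q, hQ1, hQ2⟩ := halg τ' α' hadm' ε' hε' hε'1
      have h6 : Q.error ρ ≤ ENNReal.ofReal ε := by
        have h7 : Q.error ρ ^ 2 ≤ ENNReal.ofReal ε ^ 2 := by
          rw [hQ2, ← ENNReal.ofReal_pow hε.le]
          exact (h2 ε' hε' hε'1).2.trans (ENNReal.ofReal_le_ofReal h4)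
        exact (ENNReal.pow_le_pow_left_iff two_ne_zero).1 h7
      exact (iInf₂_le Q h6).trans (hQ1.trans ((h1 ε' hε' hε'1).trans
        (ENNReal.ofReal_le_ofReal h5)))
  · obtain ⟨A, hA⟩ := hpart3 τ' α' hadm' δ hδ
    exact ⟨A, hA.mono fun N ⟨ε, hε, hN⟩ => ⟨ε, hε.1, hN⟩⟩
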